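/- Let $P>0$, let $\mathbb T^2_P=(\mathbb R/P\mathbb Z)\times(\mathbb R/2\pi\mathbb Z)$ be the torus with coordinates $z=x+iy$ and Lebesgue measure $dx\,dy$ (total mass $2\pi P$), and for real $\rho$ let $L_\rho=\frac{\partial^2}{\partial x^2}+\frac{\partial^2}{\partial y^2}+2\rho\frac{\partial}{\partial x}+\rho^2$, with formal adjoint $L_{-\rho}$. An $L_\rho$-subfunction is an upper semicontinuous, Lebesgue integrable function $v:\mathbb T^2_P\to[-\infty,\infty)$ with $L_\rho v\ge 0$ in the sense of distributions, i.e. $\int v\,L_{-\rho}\varphi\,dx\,dy\ge 0$ for all smooth $\varphi\ge0$ on $\mathbb T^2_P$. For such $v$ there is a unique finite Borel measure $\nu$ on $\mathbb T^2_P$ (the Riesz measure of $v$) with $L_\rho v=\nu$ in the sense of distributions. Call $v$ normalized if $V(Z)=v(\log Z)|Z|^\rho$ is subharmonic in $\mathbb C\setminus\{0\}$ (upper semicontinuous with the submean inequality on circles). All kernels $E$ below are integrable functions on $\mathbb T^2_P$ that are finite and $C^\infty$ off $0$, with $E(z)\to E(0)=-\infty$ as $z\to0$. (1) Let $\rho>0$,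 $\rho\notin\mathbb Z$. There is a unique such kernel $E_\rho$ with $L_\rho E_\rho=\delta_0$ (the fundamental solution). For every $L_\rho$-subfunction $v$ with Riesz measure $\nu$, $$v(z)=\int_{\mathbb T^2_P}E_\rho(z-\zeta)\,d\nu(\zeta)$$ for almost every $z$, and for every $z\in\mathbb T^2_P$ if $v$ is normalized. (2) Let $\rho=p\in\mathbb Z$, and put $\kappa_p(z)=\frac{\cos py}{\pi P}$ if $p\ne0$ and $\kappa_0(z)=\frac1{2\pi P}$. There is such a kernel $E$ with $L_pE=\delta_0-\kappa_p$ (a generalized fundamental solution). For every $L_p$-subfunction $v$ with Riesz measure $\nu$, $$\int_{\mathbb T^2_P}e^{ipy}\,d\nu=\int_{\mathbb T^2_P}e^{-ipy}\,d\nu=0,$$ and for every generalized fundamental solution $E'_p$ there is $C\in\mathbb C$ such that $$v(z)=\int_{\mathbb T^2_P}E'_p(z-\zeta)\,d\nu(\zeta)+\operatorname{Re}\bigl(Ce^{ipy}\bigr)$$ for almost every $z$, and for every $z\in\mathbb T^2_P$ if $v$ is normalized. -/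

import Mathlib

open MeasureTheory
open scoped ContDiff

namespace LRho

instance factTwoPiPos : Fact (0 < 2 * Real.pi) := ⟨Real.two_pi_pos⟩

/-- The torus obtained from the rectangle `(0, P) × (-π, π)` by identifying opposite sides.
Its `volume` is Lebesgue measure `dx dy`, of total mass `2 π P`. -/
abbrev Torus (P : ℝ) : Type := AddCircle P × AddCircle (2 * Real.pi)

/-- The covering map of the plane onto the torus. -/
noncomputable def proj (P : ℝ) (w : ℝ × ℝ) : Torus P :=
  ((w.1 : AddCircle P), (w.2 : AddCircle (2 * Real.pi)))

/-- The partial derivative `∂f/∂x` of a function on the torus. -/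
noncomputable def dX {P : ℝ} (f : Torus P → ℝ) (z : Torus P) : ℝ :=
  deriv (fun h : ℝ => f (z + proj P (h, 0))) 0

/-- The partial derivative `∂f/∂y` of a function on the torus. -/
noncomputable def dY {P : ℝ} (f : Torus P → ℝ) (z : Torus P) : ℝ :=
  deriv (fun h : ℝ => f (z + proj P (0, h))) 0

/-- The operator `L_ρ = ∂²/∂x² + ∂²/∂y² + 2 ρ ∂/∂x + ρ²` on smooth functions on the torus.
Its formal adjoint is `L_{-ρ}`. -/
noncomputable def lOp {P : ℝ} (ρ : ℝ) (f : Torus P → ℝ) (z : Torus P) : ℝ :=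
  dX (dX f) z + dY (dY f) z + 2 * ρ * dX f z + ρ ^ 2 * f z

/-- The (real) test functions: smooth functions on the torus. -/
def IsTest {P : ℝ} (φ : Torus P → ℝ) : Prop :=
  ContDiff ℝ ∞ (fun w : ℝ × ℝ => φ (proj P w))

/-- The function `e^{iky}` on the torus. -/
noncomputable def expIY {P : ℝ} (k : ℤ) (z : Torus P) : ℂ := fourier k z.2

theorem expIY_proj {P : ℝ} (k : ℤ) (w : ℝ × ℝ) :
    expIY k (proj P w) = Complex.exp (Complex.I * k * w.2) := by
  have h : (Real.pi : ℂ) ≠ 0 := by exact_mod_cast Real.pi_ne_zero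
  simp only [expIY, proj, fourier_coe_apply]
  congr 1
  push_cast
  field_simp

/-- `∫ f⁺ dμ - ∫ f⁻ dμ` for an extended-real-valued function (used only for functions that are
bounded above and finite measures, so that the first term is finite). -/
noncomputable def extIntegral {α : Type*} [MeasurableSpace α] (μ : Measure α) (f : α → EReal) :
    EReal :=
  ((∫⁻ a, (f a).toENNReal ∂μ : ENNReal) : EReal) -
    ((∫⁻ a, (-(f a)).toENNReal ∂μ : ENNReal) : EReal)

/-- A subharmonic function (with values in `[-∞, ∞)`) on the set `Ω`: upper semicontinuity and
the submean inequality on every circle whose closed disc lies in `Ω`. -/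
structure IsSubharmonicOn (V : ℂ → EReal) (Ω : Set ℂ) : Prop where
  usc : UpperSemicontinuousOn V Ω
  lt_top : ∀ Z ∈ Ω, V Z < ⊤
  submean : ∀ Z ∈ Ω, ∀ r : ℝ, 0 < r → Metric.closedBall Z r ⊆ Ω →
    V Z ≤ extIntegral ((ENNReal.ofReal (2 * Real.pi))⁻¹ •
      (volume : Measure ℝ).restrict (Set.Ioc 0 (2 * Real.pi))) (fun θ => V (circleMap Z r θ))

/-- The function `V(Z) = v(log Z) |Z|^ρ` on the punctured plane. -/
noncomputable def lift {P : ℝ} (ρ : ℝ) (v : Torus P → EReal) (Z : ℂ) : EReal :=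
  v (proj P ((Complex.log Z).re, (Complex.log Z).im)) * ((‖Z‖ ^ ρ : ℝ) : EReal)

/-- `L_ρ`-subfunctions: upper semicontinuous functions with values in `[-∞, ∞)`, integrable (so
that they define a distribution), with `L_ρ v ≥ 0` in the sense of distributions. -/
structure IsSubfunction (P : ℝ) [Fact (0 < P)] (ρ : ℝ) (v : Torus P → EReal) : Prop where
  usc : UpperSemicontinuous v
  lt_top : ∀ z, v z < ⊤
  ae_ne_bot : ∀ᵐ z ∂(volume : Measure (Torus P)), v z ≠ ⊥
  integrable : Integrable (fun z => (v z).toReal) (volume : Measure (Torus P))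
  nonneg : ∀ φ : Torus P → ℝ, IsTest φ → (∀ z, 0 ≤ φ z) →
    0 ≤ ∫ z, (v z).toReal * lOp (-ρ) φ z

/-- `ν = L_ρ v` in the sense of distributions, `ν` being a finite Borel measure. -/
structure IsRieszMeasure (P : ℝ) [Fact (0 < P)] (ρ : ℝ) (v : Torus P → EReal)
    (ν : Measure (Torus P)) : Prop where
  finite : IsFiniteMeasure ν
  eq : ∀ φ : Torus P → ℝ, IsTest φ →
    ∫ z, (v z).toReal * lOp (-ρ) φ z = ∫ z, φ z ∂ν

/-- `E` is an integrable function, smooth and finite off the origin of the torus, with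
`E(z) → E(0) = -∞` as `z → 0`, that solves `L_ρ E = δ₀ - κ` in the sense of distributions. -/
structure IsKernel (P : ℝ) [Fact (0 < P)] (ρ : ℝ) (κ : Torus P → ℝ) (E : Torus P → EReal) :
    Prop where
  continuous : Continuous E
  ne_top : ∀ z, E z ≠ ⊤
  eq_bot_iff : ∀ z, E z = ⊥ ↔ z = 0
  smooth : ContDiffOn ℝ ∞ (fun w : ℝ × ℝ => (E (proj P w)).toReal) {w | proj P w ≠ 0}
  integrable : Integrable (fun z => (E z).toReal) (volume : Measure (Torus P))
  eq : ∀ φ : Torus P → ℝ, IsTest φ →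
    ∫ z, (E z).toReal * lOp (-ρ) φ z = φ 0 - ∫ z, κ z * φ z

/-- `E` is a fundamental solution of `L_ρ` on the torus: `L_ρ E = δ₀`. -/
def IsFundamentalSolution (P : ℝ) [Fact (0 < P)] (ρ : ℝ) (E : Torus P → EReal) : Prop :=
  IsKernel P ρ (fun _ => 0) E

/-- The `L²(dx dy)`-projection of `δ₀` to the span of `e^{ipy}` and `e^{-ipy}`. It is
`cos (p y) / (π P)` for `p ≠ 0` and `1 / (2 π P)` for `p = 0`, where the two exponentials
coincide. -/
noncomputable def resonance (P : ℝ) (p : ℤ) (z : Torus P) : ℝ :=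
  (∑ k ∈ ({p, -p} : Finset ℤ), (expIY k z).re) / (2 * Real.pi * P)

/-- `E` is a generalized fundamental solution of `L_p` on the torus, for an integer `p`. -/
def IsGenFundamentalSolution (P : ℝ) [Fact (0 < P)] (p : ℤ) (E : Torus P → EReal) : Prop :=
  IsKernel P p (resonance P p) E

/-- The potential `∫ E(z - ζ) dν(ζ)`. -/
noncomputable def potential {P : ℝ} (E : Torus P → EReal) (ν : Measure (Torus P))
    (z : Torus P) : EReal :=
  extIntegral ν (fun ζ => E (z - ζ))

end LRho

/-!
The operator factors as `L_ρ = (∂_x + ρ)² + ∂_y²`, so it acts diagonally on the characters of the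
torus, and the eigenvalue of `L_{-ρ}` on `e^{i(2πmx/P + ky)}` is `(2πim/P - ρ)² - k²`. It vanishes
only for `m = 0` and `ρ = ±k` (`symb_eq_zero_iff`), and the other eigenvalues are bounded away from
zero. Hence an integrable weak solution of the homogeneous equation is zero if `ρ` is not an integer
(`ae_eq_zero_of_weak_null`) and a multiple `Re (C e^{ipy})` if `ρ = p` (`ae_eq_trig_of_weak_null`),
and `L_ρ h = G` has a smooth solution for smooth `G` orthogonal to the resonant characters
(`exists_isTest_lOp_eq`).

Kernels are built from a parametrix rather than from a Fourier series. The function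
`gap = 2 cosh x - 2 cos y` is `e^{-x} |e^z - 1|²`, so `e^{-ρx} log gap` is annihilated by `L_ρ` near
the origin except for a positive point mass there. Cut off away from the origin, it satisfies the
equation up to a smooth error (`integral_regLog_mul_lOp`, by regularizing to `log (gap + s)` and
rescaling), and the error is removed by solving with smooth data (`exists_isKernel`). The condition
for solvability is what forces the right-hand side `δ₀ - κ_p` for an integral exponent.

The Riesz measure exists because `φ ↦ ∫ v L_{-ρ} φ` is a positive functional on the test functions;
it is unique, and orthogonal to the resonant characters, because it is determined by its Fourier
coefficients. By Fubini the potential of `ν` satisfies `L_ρ u = ν`, so that `v - u` is an integrable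
solution of the homogeneous equation. This gives the representation almost everywhere.

For the representation at every point, both sides are recovered from their almost everywhere classes
by averaging. In the coordinate `Z = e^z`, the mean of a function over a disc about `Z` is the mean
of its translates by `log ξ` over a disc about `ξ = 1`, and null sets do not affect it. Let `N` be
`M - v` or `M` minus a kernel: it is nonnegative and lower semicontinuous, so its disc means are
asymptotically at least its value. The opposite bound is the property `Regular`. For a normalized
`v` it follows from the submean inequality of `v(log Z) |Z|^ρ`, the weight `|ξ|^ρ` tending to `1`.
For a potential it follows from a bound for the kernel that is uniform over the torus
(`regular_lintegral_sub`): away from the pole by continuity, and at the pole because `log gap` is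
`log |Z - 1|²` plus a harmonic function (`eventually_discMean_log_gap_le`). Two regular functions
that agree almost everywhere are equal (`Regular.eq_of_ae_eq`).
-/

namespace LRho

open Filter Topology Set

/-! ### The covering map and smooth functions on the torus -/

section Torus

variable {P : ℝ}

theorem proj_add (w w' : ℝ × ℝ) : proj P (w + w') = proj P w + proj P w' := rfl

theorem proj_zero : proj P 0 = 0 := rfl

theorem proj_mk_zero : proj P (0, 0) = 0 := rfl

theorem isOpenQuotientMap_proj : IsOpenQuotientMap (proj P) :=
  QuotientAddGroup.isOpenQuotientMap_mk.prodMap QuotientAddGroup.isOpenQuotientMap_mk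

theorem continuous_proj : Continuous (proj P) := isOpenQuotientMap_proj.continuous

theorem surjective_proj : Function.Surjective (proj P) := isOpenQuotientMap_proj.surjective

/-- Lebesgue measure on the torus is the image of Lebesgue measure on a fundamental rectangle. -/
theorem measurePreserving_proj [Fact (0 < P)] (a b : ℝ) :
    MeasurePreserving (proj P)
      ((volume.restrict (Ioc a (a + P))).prod (volume.restrict (Ioc b (b + 2 * Real.pi))))
      volume :=
  (AddCircle.measurePreserving_mk P a).prod (AddCircle.measurePreserving_mk (2 * Real.pi) b)

theorem IsTest.continuous {φ : Torus P → ℝ} (hφ : IsTest φ) : Continuous φ :=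
  isOpenQuotientMap_proj.isQuotientMap.continuous_iff.2 (ContDiff.continuous hφ)

theorem IsTest.integrable [Fact (0 < P)] {φ : Torus P → ℝ} (hφ : IsTest φ)
    (μ : Measure (Torus P)) [IsFiniteMeasure μ] : Integrable φ μ :=
  hφ.continuous.integrable_of_hasCompactSupport (HasCompactSupport.of_compactSpace φ)

theorem IsTest.exists_bound [Fact (0 < P)] {φ : Torus P → ℝ} (hφ : IsTest φ) :
    ∃ C, 0 ≤ C ∧ ∀ z, ‖φ z‖ ≤ C := by
  obtain ⟨C, hC⟩ := isCompact_univ.exists_bound_of_continuousOn hφ.continuous.continuousOn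
  exact ⟨C, (norm_nonneg _).trans (hC 0 trivial), fun z => hC z trivial⟩

theorem isTest_const (c : ℝ) : IsTest (fun _ : Torus P => c) := contDiff_const

theorem IsTest.add {f g : Torus P → ℝ} (hf : IsTest f) (hg : IsTest g) :
    IsTest (fun z => f z + g z) := ContDiff.add hf hg

theorem IsTest.sub {f g : Torus P → ℝ} (hf : IsTest f) (hg : IsTest g) :
    IsTest (fun z => f z - g z) := ContDiff.sub hf hg

theorem IsTest.mul {f g : Torus P → ℝ} (hf : IsTest f) (hg : IsTest g) :
    IsTest (fun z => f z * g z) := ContDiff.mul hf hg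

theorem IsTest.const_mul {f : Torus P → ℝ} (hf : IsTest f) (c : ℝ) :
    IsTest (fun z => c * f z) := (isTest_const c).mul hf

theorem IsTest.comp_add_right {f : Torus P → ℝ} (hf : IsTest f) (ζ : Torus P) :
    IsTest (fun z => f (z + ζ)) := by
  obtain ⟨w, rfl⟩ := surjective_proj ζ
  have : ContDiff ℝ ∞ fun u : ℝ × ℝ => f (proj P (u + w)) :=
    ContDiff.comp (g := fun u => f (proj P u)) hf (contDiff_id.add contDiff_const)
  exact this

theorem hasDerivAt_line_fst {F : ℝ × ℝ → ℝ} (hF : ContDiff ℝ ∞ F) (w : ℝ × ℝ) (t : ℝ) :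
    HasDerivAt (fun h : ℝ => F (w + (h, 0))) (fderiv ℝ F (w + (t, 0)) (1, 0)) t := by
  have h1 : HasDerivAt (fun h : ℝ => w + (h, (0 : ℝ))) (1, 0) t := by
    have := (hasDerivAt_id t).prodMk (hasDerivAt_const t (0 : ℝ))
    simpa using this.const_add w
  exact ((hF.differentiable (by simp)) _).hasFDerivAt.comp_hasDerivAt t h1

theorem hasDerivAt_line_snd {F : ℝ × ℝ → ℝ} (hF : ContDiff ℝ ∞ F) (w : ℝ × ℝ) (t : ℝ) :
    HasDerivAt (fun h : ℝ => F (w + (0, h))) (fderiv ℝ F (w + (0, t)) (0, 1)) t := by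
  have h1 : HasDerivAt (fun h : ℝ => w + ((0 : ℝ), h)) (0, 1) t := by
    have := (hasDerivAt_const t (0 : ℝ)).prodMk (hasDerivAt_id t)
    simpa using this.const_add w
  exact ((hF.differentiable (by simp)) _).hasFDerivAt.comp_hasDerivAt t h1

theorem IsTest.dX_proj {f : Torus P → ℝ} (hf : IsTest f) (w : ℝ × ℝ) :
    dX f (proj P w) = fderiv ℝ (fun w => f (proj P w)) w (1, 0) := by
  have := (hasDerivAt_line_fst hf w 0).deriv
  simp only [Prod.mk_zero_zero, add_zero] at this
  exact this

theorem IsTest.dY_proj {f : Torus P → ℝ} (hf : IsTest f) (w : ℝ × ℝ) :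
    dY f (proj P w) = fderiv ℝ (fun w => f (proj P w)) w (0, 1) := by
  have := (hasDerivAt_line_snd hf w 0).deriv
  simp only [Prod.mk_zero_zero, add_zero] at this
  exact this

theorem IsTest.dX {f : Torus P → ℝ} (hf : IsTest f) : IsTest (dX f) := by
  have : (fun w => LRho.dX f (proj P w)) =
      fun w => fderiv ℝ (fun w => f (proj P w)) w (1, 0) := funext hf.dX_proj
  unfold IsTest
  rw [this]
  exact (ContDiff.fderiv_right hf (by simp)).clm_apply contDiff_const

theorem IsTest.dY {f : Torus P → ℝ} (hf : IsTest f) : IsTest (dY f) := by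
  have : (fun w => LRho.dY f (proj P w)) =
      fun w => fderiv ℝ (fun w => f (proj P w)) w (0, 1) := funext hf.dY_proj
  unfold IsTest
  rw [this]
  exact (ContDiff.fderiv_right hf (by simp)).clm_apply contDiff_const

theorem IsTest.hasDerivAt_dX {f : Torus P → ℝ} (hf : IsTest f) (z : Torus P) (t : ℝ) :
    HasDerivAt (fun h : ℝ => f (z + proj P (h, 0))) (LRho.dX f (z + proj P (t, 0))) t := by
  obtain ⟨w, rfl⟩ := surjective_proj z
  rw [← proj_add, hf.dX_proj]
  exact hasDerivAt_line_fst hf w t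

theorem IsTest.hasDerivAt_dY {f : Torus P → ℝ} (hf : IsTest f) (z : Torus P) (t : ℝ) :
    HasDerivAt (fun h : ℝ => f (z + proj P (0, h))) (LRho.dY f (z + proj P (0, t))) t := by
  obtain ⟨w, rfl⟩ := surjective_proj z
  rw [← proj_add, hf.dY_proj]
  exact hasDerivAt_line_snd hf w t

theorem IsTest.hasDerivAt_dX_zero {f : Torus P → ℝ} (hf : IsTest f) (z : Torus P) :
    HasDerivAt (fun h : ℝ => f (z + proj P (h, 0))) (LRho.dX f z) 0 := by
  simpa only [proj_mk_zero, add_zero] using hf.hasDerivAt_dX z 0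

theorem IsTest.hasDerivAt_dY_zero {f : Torus P → ℝ} (hf : IsTest f) (z : Torus P) :
    HasDerivAt (fun h : ℝ => f (z + proj P (0, h))) (LRho.dY f z) 0 := by
  simpa only [proj_mk_zero, add_zero] using hf.hasDerivAt_dY z 0

theorem dX_add {f g : Torus P → ℝ} (hf : IsTest f) (hg : IsTest g) :
    dX (fun z => f z + g z) = fun z => dX f z + dX g z :=
  funext fun z => ((hf.hasDerivAt_dX_zero z).add (hg.hasDerivAt_dX_zero z)).deriv

theorem dY_add {f g : Torus P → ℝ} (hf : IsTest f) (hg : IsTest g) :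
    dY (fun z => f z + g z) = fun z => dY f z + dY g z :=
  funext fun z => ((hf.hasDerivAt_dY_zero z).add (hg.hasDerivAt_dY_zero z)).deriv

theorem dX_const_mul {f : Torus P → ℝ} (hf : IsTest f) (c : ℝ) :
    dX (fun z => c * f z) = fun z => c * dX f z :=
  funext fun z => ((hf.hasDerivAt_dX_zero z).const_mul c).deriv

theorem dY_const_mul {f : Torus P → ℝ} (hf : IsTest f) (c : ℝ) :
    dY (fun z => c * f z) = fun z => c * dY f z :=
  funext fun z => ((hf.hasDerivAt_dY_zero z).const_mul c).deriv

theorem dX_mul {f g : Torus P → ℝ} (hf : IsTest f) (hg : IsTest g) :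
    dX (fun z => f z * g z) = fun z => dX f z * g z + f z * dX g z := by
  funext z
  have := ((hf.hasDerivAt_dX_zero z).mul (hg.hasDerivAt_dX_zero z)).deriv
  simp only [proj_mk_zero, add_zero] at this
  exact this

theorem dY_mul {f g : Torus P → ℝ} (hf : IsTest f) (hg : IsTest g) :
    dY (fun z => f z * g z) = fun z => dY f z * g z + f z * dY g z := by
  funext z
  have := ((hf.hasDerivAt_dY_zero z).mul (hg.hasDerivAt_dY_zero z)).deriv
  simp only [proj_mk_zero, add_zero] at this
  exact this

theorem dX_comp_add_right (f : Torus P → ℝ) (ζ : Torus P) :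
    dX (fun z => f (z + ζ)) = fun z => dX f (z + ζ) := by
  funext z
  simp only [dX, add_right_comm]

theorem dY_comp_add_right (f : Torus P → ℝ) (ζ : Torus P) :
    dY (fun z => f (z + ζ)) = fun z => dY f (z + ζ) := by
  funext z
  simp only [dY, add_right_comm]

theorem IsTest.lOp {f : Torus P → ℝ} (hf : IsTest f) (ρ : ℝ) : IsTest (lOp ρ f) :=
  (((hf.dX.dX.add hf.dY.dY).add (hf.dX.const_mul (2 * ρ))).add (hf.const_mul (ρ ^ 2)))

theorem lOp_add {f g : Torus P → ℝ} (hf : IsTest f) (hg : IsTest g) (ρ : ℝ) (z : Torus P) :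
    lOp ρ (fun z => f z + g z) z = lOp ρ f z + lOp ρ g z := by
  simp only [lOp, dX_add hf hg, dY_add hf hg, dX_add hf.dX hg.dX, dY_add hf.dY hg.dY]
  ring

theorem lOp_const_mul {f : Torus P → ℝ} (hf : IsTest f) (ρ c : ℝ) (z : Torus P) :
    lOp ρ (fun z => c * f z) z = c * lOp ρ f z := by
  simp only [lOp, dX_const_mul hf, dY_const_mul hf, dX_const_mul hf.dX, dY_const_mul hf.dY]
  ring

theorem lOp_comp_add_right (f : Torus P → ℝ) (ρ : ℝ) (ζ z : Torus P) :
    lOp ρ (fun z => f (z + ζ)) z = lOp ρ f (z + ζ) := by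
  simp only [lOp, dX_comp_add_right, dY_comp_add_right]

variable [Fact (0 < P)]

instance isAddHaarMeasure_volume : (volume : Measure (Torus P)).IsAddHaarMeasure :=
  inferInstanceAs ((volume : Measure (AddCircle P)).prod
    (volume : Measure (AddCircle (2 * Real.pi)))).IsAddHaarMeasure

theorem integral_dX {f : Torus P → ℝ} (hf : IsTest f) : ∫ z, dX f z = 0 := by
  obtain ⟨C, -, hC⟩ := hf.dX.exists_bound
  have key := hasDerivAt_integral_of_dominated_loc_of_deriv_le (μ := (volume : Measure (Torus P)))
    (F := fun (h : ℝ) z => f (z + proj P (h, 0))) (F' := fun h z => dX f (z + proj P (h, 0)))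
    (x₀ := 0) (s := univ) (bound := fun _ => C) univ_mem
    (.of_forall fun h => ((hf.comp_add_right _).integrable volume).aestronglyMeasurable)
    ((hf.comp_add_right _).integrable volume)
    ((hf.dX.comp_add_right _).integrable volume).aestronglyMeasurable
    (.of_forall fun z h _ => hC _) (integrable_const C)
    (.of_forall fun z h _ => hf.hasDerivAt_dX z h)
  have h2 := key.2
  simp only [integral_add_right_eq_self (μ := (volume : Measure (Torus P)))] at h2
  exact h2.unique (hasDerivAt_const 0 _)

theorem integral_dY {f : Torus P → ℝ} (hf : IsTest f) : ∫ z, dY f z = 0 := by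
  obtain ⟨C, -, hC⟩ := hf.dY.exists_bound
  have key := hasDerivAt_integral_of_dominated_loc_of_deriv_le (μ := (volume : Measure (Torus P)))
    (F := fun (h : ℝ) z => f (z + proj P (0, h))) (F' := fun h z => dY f (z + proj P (0, h)))
    (x₀ := 0) (s := univ) (bound := fun _ => C) univ_mem
    (.of_forall fun h => ((hf.comp_add_right _).integrable volume).aestronglyMeasurable)
    ((hf.comp_add_right _).integrable volume)
    ((hf.dY.comp_add_right _).integrable volume).aestronglyMeasurable
    (.of_forall fun z h _ => hC _) (integrable_const C)
    (.of_forall fun z h _ => hf.hasDerivAt_dY z h)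
  have h2 := key.2
  simp only [integral_add_right_eq_self (μ := (volume : Measure (Torus P)))] at h2
  exact h2.unique (hasDerivAt_const 0 _)

theorem integral_add_four {α : Type*} [MeasurableSpace α] {μ : Measure α} {a b c d : α → ℝ}
    (ha : Integrable a μ) (hb : Integrable b μ) (hc : Integrable c μ) (hd : Integrable d μ) :
    ∫ z, (a z + b z + c z + d z) ∂μ
      = (∫ z, a z ∂μ) + (∫ z, b z ∂μ) + (∫ z, c z ∂μ) + ∫ z, d z ∂μ := by
  have hab : Integrable (fun z => a z + b z) μ := ha.add hb
  have habc : Integrable (fun z => a z + b z + c z) μ := hab.add hc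
  rw [integral_add habc hd, integral_add hab hc, integral_add ha hb]

theorem integral_mul_dX {f g : Torus P → ℝ} (hf : IsTest f) (hg : IsTest g) :
    ∫ z, f z * dX g z = -∫ z, dX f z * g z := by
  have h := integral_dX (hf.mul hg)
  rw [dX_mul hf hg, integral_add ((hf.dX.mul hg).integrable volume)
    ((hf.mul hg.dX).integrable volume)] at h
  linarith

theorem integral_mul_dY {f g : Torus P → ℝ} (hf : IsTest f) (hg : IsTest g) :
    ∫ z, f z * dY g z = -∫ z, dY f z * g z := by
  have h := integral_dY (hf.mul hg)
  rw [dY_mul hf hg, integral_add ((hf.dY.mul hg).integrable volume)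
    ((hf.mul hg.dY).integrable volume)] at h
  linarith

/-- The operators `L_ρ` and `L_{-ρ}` are formally adjoint. -/
theorem integral_mul_lOp {f g : Torus P → ℝ} (hf : IsTest f) (hg : IsTest g) (ρ : ℝ) :
    ∫ z, f z * lOp (-ρ) g z = ∫ z, lOp ρ f z * g z := by
  have h1 : ∫ z, f z * dX (dX g) z = ∫ z, dX (dX f) z * g z := by
    rw [integral_mul_dX hf hg.dX, integral_mul_dX hf.dX hg, neg_neg]
  have h2 : ∫ z, f z * dY (dY g) z = ∫ z, dY (dY f) z * g z := by
    rw [integral_mul_dY hf hg.dY, integral_mul_dY hf.dY hg, neg_neg]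
  have h3 := integral_mul_dX hf hg
  have i1 := (hf.mul hg.dX.dX).integrable volume
  have i2 := (hf.mul hg.dY.dY).integrable volume
  have i3 := (hf.mul hg.dX).integrable volume
  have i4 := (hf.mul hg).integrable volume
  have j1 := (hf.dX.dX.mul hg).integrable volume
  have j2 := (hf.dY.dY.mul hg).integrable volume
  have j3 := (hf.dX.mul hg).integrable volume
  calc ∫ z, f z * lOp (-ρ) g z
      = ∫ z, (f z * dX (dX g) z + f z * dY (dY g) z + (2 * -ρ) * (f z * dX g z)
          + ρ ^ 2 * (f z * g z)) := by
        congr 1; funext z; simp only [LRho.lOp]; ring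
    _ = (∫ z, f z * dX (dX g) z) + (∫ z, f z * dY (dY g) z) + (2 * -ρ) * (∫ z, f z * dX g z)
          + ρ ^ 2 * ∫ z, f z * g z := by
        rw [integral_add_four i1 i2 (i3.const_mul _) (i4.const_mul _), integral_const_mul,
          integral_const_mul]
    _ = (∫ z, dX (dX f) z * g z) + (∫ z, dY (dY f) z * g z) + (2 * ρ) * (∫ z, dX f z * g z)
          + ρ ^ 2 * ∫ z, f z * g z := by rw [h1, h2, h3]; ring
    _ = ∫ z, (dX (dX f) z * g z + dY (dY f) z * g z + (2 * ρ) * (dX f z * g z)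
          + ρ ^ 2 * (f z * g z)) := by
        rw [integral_add_four j1 j2 (j3.const_mul _) (i4.const_mul _), integral_const_mul,
          integral_const_mul]
    _ = ∫ z, lOp ρ f z * g z := by
        congr 1; funext z; simp only [LRho.lOp]; ring

end Torus

/-! ### Trigonometric functions on the torus -/

section Trig

variable {P : ℝ}

/-- The character `e^{i(2πmx/P + ky)}` of the torus. -/
noncomputable def expT (m k : ℤ) (z : Torus P) : ℂ := fourier m z.1 * fourier k z.2

/-- The frequency vector of the character `expT m k`. -/
noncomputable def freq (P : ℝ) (m k : ℤ) : ℝ × ℝ →L[ℝ] ℝ :=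
  (2 * Real.pi / P * m) • ContinuousLinearMap.fst ℝ ℝ ℝ + (k : ℝ) • ContinuousLinearMap.snd ℝ ℝ ℝ

theorem freq_apply (m k : ℤ) (w : ℝ × ℝ) :
    freq P m k w = 2 * Real.pi / P * m * w.1 + k * w.2 := by simp [freq]

theorem expT_proj (m k : ℤ) (w : ℝ × ℝ) :
    expT m k (proj P w) = Complex.exp (Complex.I * (freq P m k w : ℝ)) := by
  have h : (Real.pi : ℂ) ≠ 0 := by exact_mod_cast Real.pi_ne_zero
  simp only [expT, proj, fourier_coe_apply, freq_apply]
  rw [← Complex.exp_add]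
  congr 1
  push_cast
  field_simp

theorem expIY_eq_expT (k : ℤ) (z : Torus P) : expIY k z = expT 0 k z := by
  simp [expIY, expT]

theorem expT_zero (m k : ℤ) : expT m k (0 : Torus P) = 1 := by
  simp [expT]

theorem expT_zero_zero (z : Torus P) : expT 0 0 z = 1 := by simp [expT]

theorem expT_mul (m k m' k' : ℤ) (z : Torus P) :
    expT m k z * expT m' k' z = expT (m + m') (k + k') z := by
  simp only [expT, fourier_add]
  ring

theorem expT_neg (m k : ℤ) (z : Torus P) :
    expT (-m) (-k) z = (starRingEnd ℂ) (expT m k z) := by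
  simp only [expT, fourier_neg, map_mul]

theorem expT_add_apply (m k : ℤ) (z ζ : Torus P) :
    expT m k (z + ζ) = expT m k z * expT m k ζ := by
  obtain ⟨w, rfl⟩ := surjective_proj z
  obtain ⟨w', rfl⟩ := surjective_proj ζ
  rw [← proj_add, expT_proj, expT_proj, expT_proj, ← Complex.exp_add]
  simp only [map_add]
  push_cast
  ring_nf

theorem norm_expT (m k : ℤ) (z : Torus P) : ‖expT m k z‖ = 1 := by
  obtain ⟨w, rfl⟩ := surjective_proj z
  rw [expT_proj, mul_comm, Complex.norm_exp_ofReal_mul_I]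

theorem continuous_expT (m k : ℤ) : Continuous (expT m k : Torus P → ℂ) :=
  ((fourier m).continuous.comp continuous_fst).mul ((fourier k).continuous.comp continuous_snd)

/-- The real trigonometric function `Re (a e^{i(2πmx/P + ky)})`. -/
noncomputable def trig (a : ℂ) (m k : ℤ) (z : Torus P) : ℝ := (a * expT m k z).re

/-- The profile `t ↦ Re (a e^{it})` of a real trigonometric function. -/
noncomputable def wave (a : ℂ) (t : ℝ) : ℝ := (a * Complex.exp (Complex.I * t)).re

theorem trig_proj (a : ℂ) (m k : ℤ) (w : ℝ × ℝ) :
    trig a m k (proj P w) = wave a (freq P m k w) := by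
  rw [trig, expT_proj, wave]

theorem hasDerivAt_wave (a : ℂ) (t : ℝ) : HasDerivAt (wave a) (wave (a * Complex.I) t) t := by
  have h1 : HasDerivAt (fun s : ℂ => a * Complex.exp (Complex.I * s))
      (a * (Complex.exp (Complex.I * t) * Complex.I)) (t : ℂ) :=
    ((((hasDerivAt_id (t : ℂ)).const_mul Complex.I).cexp).const_mul a).congr_deriv (by simp)
  have h2 := h1.real_of_complex
  exact h2.congr_deriv (by simp only [wave]; congr 1; ring)

theorem contDiff_wave (a : ℂ) : ContDiff ℝ ∞ (wave a) := by
  have h1 : ContDiff ℝ ∞ fun t : ℝ => a * Complex.exp (Complex.I * t) :=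
    contDiff_const.mul ((contDiff_const.mul Complex.ofRealCLM.contDiff).cexp)
  exact Complex.reCLM.contDiff.comp h1

theorem iteratedDeriv_wave (a : ℂ) (n : ℕ) :
    iteratedDeriv n (wave a) = wave (a * Complex.I ^ n) := by
  induction n with
  | zero => simp
  | succ n ih =>
    rw [iteratedDeriv_succ, ih]
    funext t
    rw [(hasDerivAt_wave _ t).deriv, pow_succ, mul_assoc]

theorem abs_wave_le (a : ℂ) (t : ℝ) : |wave a t| ≤ ‖a‖ := by
  refine (Complex.abs_re_le_norm _).trans ?_
  rw [norm_mul, mul_comm Complex.I, Complex.norm_exp_ofReal_mul_I, mul_one]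

theorem abs_trig_le (a : ℂ) (m k : ℤ) (z : Torus P) : |trig a m k z| ≤ ‖a‖ := by
  refine (Complex.abs_re_le_norm _).trans ?_
  rw [norm_mul, norm_expT, mul_one]

theorem isTest_trig (a : ℂ) (m k : ℤ) : IsTest (trig a m k : Torus P → ℝ) := by
  have : (fun w => trig a m k (proj P w)) = wave a ∘ freq P m k := funext (trig_proj a m k)
  unfold IsTest
  rw [this]
  exact (contDiff_wave a).comp (freq P m k).contDiff

theorem dX_trig (a : ℂ) (m k : ℤ) :
    dX (trig a m k : Torus P → ℝ) = trig (a * (Complex.I * (2 * Real.pi / P * m : ℝ))) m k := by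
  funext z
  obtain ⟨w, rfl⟩ := surjective_proj z
  have h1 : HasDerivAt (fun h : ℝ => freq P m k w + (2 * Real.pi / P * m) * h)
      (2 * Real.pi / P * m) 0 := by
    simpa using ((hasDerivAt_id (0 : ℝ)).const_mul (2 * Real.pi / P * m)).const_add (freq P m k w)
  have h2 := (hasDerivAt_wave a (freq P m k w + (2 * Real.pi / P * m) * 0)).comp (0 : ℝ) h1
  have h3 : (fun h : ℝ => trig a m k (proj P w + proj P (h, 0))) =
      wave a ∘ fun h : ℝ => freq P m k w + (2 * Real.pi / P * m) * h := by
    funext h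
    rw [← proj_add, trig_proj, map_add, freq_apply m k (h, 0)]
    simp
  rw [dX, h3, h2.deriv, trig_proj, mul_zero, add_zero]
  simp only [wave]
  rw [← Complex.re_mul_ofReal]
  congr 1
  ring

theorem dY_trig (a : ℂ) (m k : ℤ) :
    dY (trig a m k : Torus P → ℝ) = trig (a * (Complex.I * (k : ℝ))) m k := by
  funext z
  obtain ⟨w, rfl⟩ := surjective_proj z
  have h1 : HasDerivAt (fun h : ℝ => freq P m k w + (k : ℝ) * h) (k : ℝ) 0 := by
    simpa using ((hasDerivAt_id (0 : ℝ)).const_mul (k : ℝ)).const_add (freq P m k w)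
  have h2 := (hasDerivAt_wave a (freq P m k w + (k : ℝ) * 0)).comp (0 : ℝ) h1
  have h3 : (fun h : ℝ => trig a m k (proj P w + proj P (0, h))) =
      wave a ∘ fun h : ℝ => freq P m k w + (k : ℝ) * h := by
    funext h
    rw [← proj_add, trig_proj, map_add, freq_apply m k (0, h)]
    simp
  rw [dY, h3, h2.deriv, trig_proj, mul_zero, add_zero]
  simp only [wave]
  rw [← Complex.re_mul_ofReal]
  congr 1
  ring

/-- The symbol of `L_{-ρ}`: its eigenvalue on the character `expT m k`. -/
noncomputable def symb (P ρ : ℝ) (m k : ℤ) : ℂ :=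
  (Complex.I * (2 * Real.pi / P * m : ℝ) - ρ) ^ 2 - (k : ℂ) ^ 2

theorem trig_add_coeff (a b : ℂ) (m k : ℤ) (z : Torus P) :
    trig (a + b) m k z = trig a m k z + trig b m k z := by
  simp only [trig, add_mul, Complex.add_re]

theorem trig_smul_coeff (c : ℝ) (a : ℂ) (m k : ℤ) (z : Torus P) :
    trig (c * a) m k z = c * trig a m k z := by
  simp only [trig, mul_assoc, Complex.re_ofReal_mul]

theorem lOp_trig (ρ : ℝ) (a : ℂ) (m k : ℤ) (z : Torus P) :
    lOp (-ρ) (trig a m k) z = trig (a * symb P ρ m k) m k z := by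
  simp only [lOp, dX_trig, dY_trig]
  rw [← trig_smul_coeff, ← trig_smul_coeff, ← trig_add_coeff, ← trig_add_coeff, ← trig_add_coeff]
  congr 1
  simp only [symb]
  push_cast
  ring_nf
  simp only [Complex.I_sq]
  ring

theorem trig_mul (a b : ℂ) (m k m' k' : ℤ) (z : Torus P) :
    trig a m k z * trig b m' k' z =
      1 / 2 * (trig (a * b) (m + m') (k + k') z +
        trig (a * (starRingEnd ℂ) b) (m - m') (k - k') z) := by
  simp only [trig, sub_eq_add_neg]
  rw [← expT_mul, ← expT_mul, expT_neg]
  simp only [Complex.mul_re, Complex.mul_im, Complex.conj_re, Complex.conj_im]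
  ring

/-- The total mass `2πP` of the torus. -/
noncomputable def mass (P : ℝ) : ℝ := 2 * Real.pi * P

variable [hP : Fact (0 < P)]

theorem mass_pos : 0 < mass P := mul_pos Real.two_pi_pos hP.out

theorem measureReal_univ : (volume : Measure (Torus P)).real univ = mass P := by
  rw [Measure.volume_eq_prod, ← univ_prod_univ, measureReal_prod_prod]
  simp only [Measure.real, AddCircle.measure_univ]
  rw [ENNReal.toReal_ofReal hP.out.le, ENNReal.toReal_ofReal Real.two_pi_pos.le, mass, mul_comm]

theorem integral_trig (a : ℂ) (m k : ℤ) :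
    ∫ z : Torus P, trig a m k z = if m = 0 ∧ k = 0 then mass P * a.re else 0 := by
  split_ifs with h
  · obtain ⟨rfl, rfl⟩ := h
    simp [trig, expT_zero_zero, measureReal_univ]
  · by_cases hm : m = 0
    · have hk : k ≠ 0 := fun hk => h ⟨hm, hk⟩
      have hk' : (k : ℂ) ≠ 0 := by exact_mod_cast hk
      have := integral_dY (isTest_trig (P := P) (a / (Complex.I * k)) m k)
      rw [dY_trig] at this
      convert this using 3
      push_cast
      field_simp
    · have hm' : (m : ℂ) ≠ 0 := by exact_mod_cast hm
      have hπ : (Real.pi : ℂ) ≠ 0 := by exact_mod_cast Real.pi_ne_zero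
      have hP' : (P : ℂ) ≠ 0 := by exact_mod_cast hP.out.ne'
      have := integral_dX (isTest_trig (P := P) (a / (Complex.I * (2 * Real.pi / P * m))) m k)
      rw [dX_trig] at this
      convert this using 3
      push_cast
      field_simp

theorem integral_trig_mul_trig (a b : ℂ) (m k m' k' : ℤ) :
    ∫ z : Torus P, trig a m k z * trig b m' k' z =
      (if m = -m' ∧ k = -k' then mass P / 2 * (a * b).re else 0) +
        (if m = m' ∧ k = k' then mass P / 2 * (a * (starRingEnd ℂ) b).re else 0) := by
  simp only [trig_mul]
  rw [integral_const_mul, integral_add ((isTest_trig _ _ _).integrable _)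
    ((isTest_trig _ _ _).integrable _), integral_trig, integral_trig]
  simp only [add_eq_zero_iff_eq_neg, sub_eq_zero, mul_add, mul_ite, mul_zero]
  congr 2 <;> ring

end Trig

/-! ### Trigonometric functions determine measures and integrable functions -/

section Determine

variable {P : ℝ} [hP : Fact (0 < P)]

/-- `trig a m k` as a bounded continuous function. -/
noncomputable def trigB (P : ℝ) [Fact (0 < P)] (i : ℂ × ℤ × ℤ) :
    BoundedContinuousFunction (Torus P) ℝ :=
  BoundedContinuousFunction.mkOfCompact ⟨trig i.1 i.2.1 i.2.2, (isTest_trig _ _ _).continuous⟩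

theorem trigB_apply (i : ℂ × ℤ × ℤ) (z : Torus P) : trigB P i z = trig i.1 i.2.1 i.2.2 z := rfl

theorem mul_mem_span_trigB {f g : BoundedContinuousFunction (Torus P) ℝ}
    (hf : f ∈ Submodule.span ℝ (range (trigB P))) (hg : g ∈ Submodule.span ℝ (range (trigB P))) :
    f * g ∈ Submodule.span ℝ (range (trigB P)) := by
  induction hf using Submodule.span_induction with
  | mem x hx =>
    obtain ⟨⟨a, m, k⟩, rfl⟩ := hx
    induction hg using Submodule.span_induction with
    | mem y hy =>
      obtain ⟨⟨b, m', k'⟩, rfl⟩ := hy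
      have : trigB P (a, m, k) * trigB P (b, m', k') =
          (1 / 2 : ℝ) • (trigB P (a * b, m + m', k + k') +
            trigB P (a * (starRingEnd ℂ) b, m - m', k - k')) := by
        ext z
        exact trig_mul a b m k m' k' z
      rw [this]
      exact Submodule.smul_mem _ _ (Submodule.add_mem _ (Submodule.subset_span ⟨_, rfl⟩)
        (Submodule.subset_span ⟨_, rfl⟩))
    | zero => simp
    | add x y _ _ hx hy => rw [mul_add]; exact Submodule.add_mem _ hx hy
    | smul c x _ hx => rw [mul_smul_comm]; exact Submodule.smul_mem _ _ hx
  | zero => simp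
  | add x y _ _ hx hy => rw [add_mul]; exact Submodule.add_mem _ hx hy
  | smul c x _ hx => rw [smul_mul_assoc]; exact Submodule.smul_mem _ _ hx

theorem algebraMap_eq_trigB (r : ℝ) :
    algebraMap ℝ (BoundedContinuousFunction (Torus P) ℝ) r = trigB P (r, 0, 0) := by
  ext z
  simp [trigB_apply, trig, expT_zero_zero]

/-- The algebra of real trigonometric polynomials on the torus. It is a span of trigonometric
functions, closed under products by `trig_mul`. -/
noncomputable def trigAlgebra (P : ℝ) [Fact (0 < P)] :
    StarSubalgebra ℝ (BoundedContinuousFunction (Torus P) ℝ) where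
  carrier := Submodule.span ℝ (range (trigB P))
  mul_mem' := mul_mem_span_trigB
  add_mem' := Submodule.add_mem _
  algebraMap_mem' r := by
    rw [algebraMap_eq_trigB]
    exact Submodule.subset_span ⟨_, rfl⟩
  star_mem' {f} hf := by
    have : star f = f := by ext z; simp
    rw [this]
    exact hf

theorem eq_of_trig_eq {z ζ : Torus P} (h : ∀ a m k, trig a m k z = trig a m k ζ) : z = ζ := by
  have h' : ∀ m k, expT m k z = expT m k ζ := by
    intro m k
    apply Complex.ext
    · simpa [trig] using h 1 m k
    · simpa [trig] using h (-Complex.I) m k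
  have h1 := h' 1 0
  have h2 := h' 0 1
  simp only [expT, fourier_one, fourier_zero, mul_one, one_mul] at h1 h2
  exact Prod.ext (AddCircle.injective_toCircle hP.out.ne' (Subtype.coe_injective h1))
    (AddCircle.injective_toCircle Real.two_pi_pos.ne' (Subtype.coe_injective h2))

/-- Finite measures on the torus are determined by their Fourier coefficients, since trigonometric
polynomials form an algebra that separates points. -/
theorem measure_ext_of_trig {μ ν : Measure (Torus P)} [IsFiniteMeasure μ] [IsFiniteMeasure ν]
    (h : ∀ a m k, ∫ z, trig a m k z ∂μ = ∫ z, trig a m k z ∂ν) : μ = ν := by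
  refine ext_of_forall_mem_subalgebra_integral_eq_of_pseudoEMetric_complete_countable
    (A := trigAlgebra P) ?_ ?_
  · intro z ζ hzζ
    by_contra hcon
    push Not at hcon
    refine hzζ (eq_of_trig_eq fun a m k => ?_)
    exact hcon _ ⟨_, ⟨trigB P (a, m, k), Submodule.subset_span ⟨_, rfl⟩, rfl⟩, rfl⟩
  · intro g hg
    change g ∈ Submodule.span ℝ (range (trigB P)) at hg
    induction hg using Submodule.span_induction with
    | mem x hx =>
      obtain ⟨⟨a, m, k⟩, rfl⟩ := hx
      exact h a m k
    | zero => simp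
    | add x y _ _ hx hy =>
      simp only [BoundedContinuousFunction.coe_add, Pi.add_apply]
      rw [integral_add (x.integrable μ) (y.integrable μ),
        integral_add (x.integrable ν) (y.integrable ν), hx, hy]
    | smul c x _ hx =>
      simp only [BoundedContinuousFunction.coe_smul, smul_eq_mul]
      rw [integral_const_mul, integral_const_mul, hx]

/-- The uniqueness theorem for measures, applied to the measures with densities `f⁺` and `f⁻`. -/
theorem ae_eq_zero_of_trig {f : Torus P → ℝ} (hf : Integrable f volume)
    (h : ∀ a m k, ∫ z, f z * trig a m k z = 0) : f =ᵐ[volume] 0 := by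
  have hf' : Integrable (fun z => -f z) volume := hf.neg
  have fin1 := hf.lintegral_lt_top
  have fin2 := hf'.lintegral_lt_top
  have : IsFiniteMeasure ((volume : Measure (Torus P)).withDensity fun z => ENNReal.ofReal (f z)) :=
    isFiniteMeasure_withDensity fin1.ne
  have : IsFiniteMeasure
      ((volume : Measure (Torus P)).withDensity fun z => ENNReal.ofReal (-f z)) :=
    isFiniteMeasure_withDensity fin2.ne
  have key : (volume : Measure (Torus P)).withDensity (fun z => ENNReal.ofReal (f z)) =
      volume.withDensity fun z => ENNReal.ofReal (-f z) := by
    refine measure_ext_of_trig fun a m k => ?_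
    rw [integral_withDensity_eq_integral_toReal_smul₀ hf.aemeasurable.ennreal_ofReal
        (.of_forall fun _ => ENNReal.ofReal_lt_top),
      integral_withDensity_eq_integral_toReal_smul₀ hf'.aemeasurable.ennreal_ofReal
        (.of_forall fun _ => ENNReal.ofReal_lt_top), ← sub_eq_zero, ← integral_sub, ← h a m k]
    · congr 1
      funext z
      simp only [smul_eq_mul, ← sub_mul, ENNReal.toReal_ofReal']
      congr 1
      rcases le_total (f z) 0 with h0 | h0
      · rw [max_eq_right h0, max_eq_left (by linarith)]; ring
      · rw [max_eq_left h0, max_eq_right (by linarith)]; ring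
    · simp only [ENNReal.toReal_ofReal', smul_eq_mul]
      exact hf.pos_part.mul_bdd (c := ‖a‖) (isTest_trig a m k).continuous.aestronglyMeasurable
        (.of_forall fun z => abs_trig_le a m k z)
    · simp only [ENNReal.toReal_ofReal', smul_eq_mul]
      exact hf'.pos_part.mul_bdd (c := ‖a‖) (isTest_trig a m k).continuous.aestronglyMeasurable
        (.of_forall fun z => abs_trig_le a m k z)
  rw [withDensity_eq_iff hf.aemeasurable.ennreal_ofReal hf'.aemeasurable.ennreal_ofReal
    fin1.ne] at key
  filter_upwards [key] with z hz
  have := congrArg ENNReal.toReal hz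
  simp only [ENNReal.toReal_ofReal'] at this
  rcases le_total (f z) 0 with h0 | h0
  · rw [max_eq_right h0, max_eq_left (by linarith)] at this
    simp; linarith
  · rw [max_eq_left h0, max_eq_right (by linarith)] at this
    simpa using this

end Determine

/-! ### Solving `L_ρ h = G` for smooth data -/

section Solve

variable {P : ℝ} [hP : Fact (0 < P)]

omit hP in
theorem symb_neg (ρ : ℝ) (m k : ℤ) : symb P ρ (-m) (-k) = (starRingEnd ℂ) (symb P ρ m k) := by
  simp only [symb, map_sub, map_pow, map_mul, Complex.conj_I, Complex.conj_ofReal, map_intCast]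
  push_cast
  ring

omit hP in
theorem symb_eq_mul (ρ : ℝ) (m k : ℤ) :
    symb P ρ m k = (Complex.I * (2 * Real.pi / P * m : ℝ) - ((ρ + k : ℝ) : ℂ)) *
      (Complex.I * (2 * Real.pi / P * m : ℝ) - ((ρ + (-k : ℤ) : ℝ) : ℂ)) := by
  simp only [symb]
  push_cast
  ring

theorem symb_eq_zero_iff (ρ : ℝ) (m k : ℤ) :
    symb P ρ m k = 0 ↔ m = 0 ∧ (ρ = k ∨ ρ = -k) := by
  have hω : 2 * Real.pi / P ≠ 0 := (div_pos Real.two_pi_pos hP.out).ne'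
  have aux : ∀ x y : ℝ, Complex.I * (x : ℂ) - (y : ℂ) = 0 ↔ x = 0 ∧ y = 0 := by
    intro x y
    rw [Complex.ext_iff]
    simp
    tauto
  rw [symb_eq_mul, mul_eq_zero, aux, aux]
  simp only [mul_eq_zero, hω, Int.cast_eq_zero, false_or]
  push_cast
  rw [← and_or_left, add_eq_zero_iff_eq_neg, add_eq_zero_iff_eq_neg, neg_neg, or_comm]

omit hP in
theorem exists_pos_le_abs_add_int (ρ : ℝ) :
    ∃ δ : ℝ, 0 < δ ∧ ∀ k : ℤ, ρ + k ≠ 0 → δ ≤ |ρ + k| := by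
  by_cases h : ρ = round ρ
  · refine ⟨1, one_pos, fun k hk => ?_⟩
    rw [h] at hk ⊢
    norm_cast at hk ⊢
    exact Int.one_le_abs hk
  · refine ⟨|ρ - round ρ|, abs_pos.2 (sub_ne_zero.2 h), fun k _ => ?_⟩
    simpa using round_le ρ (-k)

/-- The nonzero eigenvalues of `L_{-ρ}` are bounded away from zero. -/
theorem exists_pos_le_norm_symb (P : ℝ) [hP : Fact (0 < P)] (ρ : ℝ) :
    ∃ δ : ℝ, 0 < δ ∧ ∀ m k : ℤ, symb P ρ m k ≠ 0 → δ ≤ ‖symb P ρ m k‖ := by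
  obtain ⟨δ, hδ, h⟩ := exists_pos_le_abs_add_int ρ
  have hω : 0 < 2 * Real.pi / P := div_pos Real.two_pi_pos hP.out
  have hmin : 0 < min δ (2 * Real.pi / P) := lt_min hδ hω
  have aux : ∀ m k : ℤ, Complex.I * (2 * Real.pi / P * m : ℝ) - ((ρ + k : ℝ) : ℂ) ≠ 0 →
      min δ (2 * Real.pi / P) ≤
        ‖Complex.I * (2 * Real.pi / P * m : ℝ) - ((ρ + k : ℝ) : ℂ)‖ := by
    intro m k hne
    by_cases hm : m = 0
    · subst hm
      have hk : ρ + k ≠ 0 := by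
        intro hk
        apply hne
        rw [hk]
        simp
      have := h k hk
      refine (min_le_left _ _).trans (this.trans ?_)
      simp only [Int.cast_zero, mul_zero, Complex.ofReal_zero, zero_sub, norm_neg,
        Complex.norm_real, Real.norm_eq_abs, le_refl]
    · have h1 : (1 : ℝ) ≤ |(m : ℝ)| := by exact_mod_cast Int.one_le_abs hm
      refine (min_le_right _ _).trans (le_trans ?_ (Complex.abs_im_le_norm _))
      simp only [Complex.sub_im, Complex.mul_im, Complex.I_re, Complex.I_im, Complex.ofReal_re,
        Complex.ofReal_im, one_mul, mul_zero, zero_add, sub_zero]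
      rw [abs_mul, abs_of_pos hω]
      exact le_mul_of_one_le_right hω.le h1
  refine ⟨min δ (2 * Real.pi / P) * min δ (2 * Real.pi / P), mul_pos hmin hmin, ?_⟩
  intro m k hne
  rw [symb_eq_mul] at hne ⊢
  rw [norm_mul]
  exact mul_le_mul (aux m k (left_ne_zero_of_mul hne)) (aux m (-k) (right_ne_zero_of_mul hne))
    hmin.le (norm_nonneg _)

/-- The eigenvalue `1 + (2πm/P)² + k²` of `1 - Δ` on the character `expT m k`. -/
noncomputable def quad (P : ℝ) (m k : ℤ) : ℝ := 1 + (2 * Real.pi / P * m) ^ 2 + (k : ℝ) ^ 2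

omit hP in
theorem one_le_quad (m k : ℤ) : 1 ≤ quad P m k := by
  unfold quad
  nlinarith [sq_nonneg (2 * Real.pi / P * m), sq_nonneg (k : ℝ)]

omit hP in
theorem quad_pos (m k : ℤ) : 0 < quad P m k := one_pos.trans_le (one_le_quad m k)

omit hP in
theorem norm_freq_le (m k : ℤ) : ‖freq P m k‖ ≤ quad P m k := by
  refine ContinuousLinearMap.opNorm_le_bound _ (quad_pos m k).le fun w => ?_
  rw [freq_apply, Real.norm_eq_abs]
  set x := 2 * Real.pi / P * m
  have h1 : |w.1| ≤ ‖w‖ := norm_fst_le w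
  have h2 : |w.2| ≤ ‖w‖ := norm_snd_le w
  calc |x * w.1 + k * w.2| ≤ |x| * |w.1| + |(k : ℝ)| * |w.2| := by
        rw [← abs_mul, ← abs_mul]; exact abs_add_le _ _
    _ ≤ |x| * ‖w‖ + |(k : ℝ)| * ‖w‖ := by gcongr
    _ = (|x| + |(k : ℝ)|) * ‖w‖ := by ring
    _ ≤ quad P m k * ‖w‖ := by
        gcongr
        unfold quad
        nlinarith [sq_nonneg (|x| - 1), sq_nonneg (|(k : ℝ)| - 1), sq_abs x, sq_abs (k : ℝ)]

theorem summable_inv_quad_sq : Summable fun i : ℤ × ℤ => (quad P i.1 i.2 ^ 2)⁻¹ := by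
  have hω : 0 < 2 * Real.pi / P := div_pos Real.two_pi_pos hP.out
  have aux : ∀ c : ℝ, 0 < c → Summable fun m : ℤ => (1 + (c * m) ^ 2)⁻¹ := by
    intro c hc
    have h1 : Summable fun m : ℤ => (c ^ 2)⁻¹ * (1 / (m : ℝ) ^ 2) :=
      (Real.summable_one_div_int_pow.2 one_lt_two).mul_left _
    refine h1.of_norm_bounded_eventually ?_
    have : ∀ᶠ m : ℤ in cofinite, m ≠ 0 := eventually_cofinite_ne 0
    filter_upwards [this] with m hm
    have hm' : (0 : ℝ) < (m : ℝ) ^ 2 := by positivity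
    rw [Real.norm_of_nonneg (by positivity), one_div, ← mul_inv]
    apply inv_anti₀ (by positivity)
    rw [mul_pow]
    linarith
  have h2 := (aux _ hω).mul_of_nonneg (aux 1 one_pos) (fun _ => by positivity)
    (fun _ => by positivity)
  refine Summable.of_nonneg_of_le (fun i => by positivity) (fun i => ?_) h2
  rw [← mul_inv]
  apply inv_anti₀ (by positivity)
  unfold quad
  set x := (2 * Real.pi / P * i.1) ^ 2
  have hx : 0 ≤ x := sq_nonneg _
  have hy : 0 ≤ (i.2 : ℝ) ^ 2 := sq_nonneg _
  nlinarith [mul_nonneg hx hy]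

/-- The operator `1 - Δ`. -/
noncomputable def oneSubLap (f : Torus P → ℝ) (z : Torus P) : ℝ :=
  f z - dX (dX f) z - dY (dY f) z

omit hP in
theorem IsTest.oneSubLap {f : Torus P → ℝ} (hf : IsTest f) : IsTest (oneSubLap f) :=
  (hf.sub hf.dX.dX).sub hf.dY.dY

omit hP in
theorem oneSubLap_trig (b : ℂ) (m k : ℤ) (z : Torus P) :
    oneSubLap (trig b m k) z = quad P m k * trig b m k z := by
  simp only [oneSubLap, dX_trig, dY_trig]
  rw [← trig_smul_coeff, sub_sub, ← trig_add_coeff, sub_eq_add_neg, ← neg_one_mul,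
    ← trig_smul_coeff, ← trig_add_coeff]
  congr 1
  simp only [quad]
  push_cast
  ring_nf
  simp only [Complex.I_sq]
  ring

theorem integral_oneSubLap_mul {f g : Torus P → ℝ} (hf : IsTest f) (hg : IsTest g) :
    ∫ z, oneSubLap f z * g z = ∫ z, f z * oneSubLap g z := by
  have h := integral_mul_lOp hf hg 0
  have e1 : ∀ z, f z * oneSubLap g z = f z * g z - f z * lOp (-0) g z := by
    intro z; simp only [oneSubLap, LRho.lOp]; ring
  have e2 : ∀ z, oneSubLap f z * g z = f z * g z - lOp 0 f z * g z := by
    intro z; simp only [oneSubLap, LRho.lOp]; ring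
  simp only [e1, e2]
  rw [integral_sub ((hf.mul hg).integrable _) ((hf.mul (hg.lOp _)).integrable _),
    integral_sub ((hf.mul hg).integrable _) (((hf.lOp _).mul hg).integrable _), h]

omit hP in
theorem IsTest.iterate_oneSubLap {f : Torus P → ℝ} (hf : IsTest f) (n : ℕ) :
    IsTest (LRho.oneSubLap^[n] f) := by
  induction n with
  | zero => exact hf
  | succ n ih => rw [Function.iterate_succ_apply']; exact ih.oneSubLap

theorem integral_iterate_oneSubLap_mul_trig {f : Torus P → ℝ} (hf : IsTest f) (n : ℕ)
    (b : ℂ) (m k : ℤ) :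
    ∫ z, (oneSubLap^[n] f) z * trig b m k z = quad P m k ^ n * ∫ z, f z * trig b m k z := by
  induction n with
  | zero => simp
  | succ n ih =>
    rw [Function.iterate_succ_apply',
      integral_oneSubLap_mul (hf.iterate_oneSubLap n) (isTest_trig b m k)]
    simp only [oneSubLap_trig, mul_left_comm _ (quad P m k)]
    rw [integral_const_mul, ih, pow_succ']
    ring

/-- Fourier coefficients of a smooth function decrease rapidly, as seen by moving powers of the
symmetric operator `1 - Δ` between the factors. -/
theorem exists_abs_integral_mul_trig_le {f : Torus P → ℝ} (hf : IsTest f) (n : ℕ) :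
    ∃ C : ℝ, 0 ≤ C ∧ ∀ (b : ℂ) (m k : ℤ),
      |∫ z, f z * trig b m k z| ≤ C * ‖b‖ / quad P m k ^ n := by
  obtain ⟨C, hC0, hC⟩ := (hf.iterate_oneSubLap n).exists_bound
  refine ⟨C * mass P, mul_nonneg hC0 mass_pos.le, fun b m k => ?_⟩
  rw [le_div_iff₀ (pow_pos (quad_pos m k) n), mul_comm, ← abs_of_pos (pow_pos (quad_pos m k) n),
    ← abs_mul, ← integral_iterate_oneSubLap_mul_trig hf]
  have := norm_integral_le_of_norm_le_const (μ := (volume : Measure (Torus P)))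
    (f := fun z => (oneSubLap^[n] f) z * trig b m k z) (C := C * ‖b‖) (.of_forall fun z => by
      rw [norm_mul]
      exact mul_le_mul (hC z) (abs_trig_le b m k z) (norm_nonneg _) hC0)
  rw [measureReal_univ, Real.norm_eq_abs] at this
  linarith

/-- The complex number `∫ f e^{i(2πmx/P + ky)} dx dy`, given by its real and imaginary parts; note
the sign in the exponent. -/
noncomputable def coeffT (f : Torus P → ℝ) (m k : ℤ) : ℂ :=
  ⟨∫ z, f z * trig 1 m k z, ∫ z, f z * trig (-Complex.I) m k z⟩

omit hP in
theorem trig_eq_sub (b : ℂ) (m k : ℤ) (z : Torus P) :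
    trig b m k z = b.re * trig 1 m k z - b.im * trig (-Complex.I) m k z := by
  simp [trig]

theorem integrable_mul_trig {f : Torus P → ℝ} (hf : Integrable f volume) (b : ℂ) (m k : ℤ) :
    Integrable (fun z => f z * trig b m k z) volume :=
  hf.mul_bdd (c := ‖b‖) (isTest_trig b m k).continuous.aestronglyMeasurable
    (.of_forall fun z => abs_trig_le b m k z)

theorem integral_mul_trig {f : Torus P → ℝ} (hf : Integrable f volume) (b : ℂ) (m k : ℤ) :
    ∫ z, f z * trig b m k z = (b * coeffT f m k).re := by
  simp only [trig_eq_sub b, mul_sub, mul_left_comm _ b.re, mul_left_comm _ b.im]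
  rw [integral_sub ((integrable_mul_trig hf 1 m k).const_mul _)
    ((integrable_mul_trig hf _ m k).const_mul _), integral_const_mul, integral_const_mul]
  simp [coeffT]

theorem coeffT_neg {f : Torus P → ℝ} (m k : ℤ) :
    coeffT f (-m) (-k) = (starRingEnd ℂ) (coeffT f m k) := by
  have h1 : ∀ z : Torus P, trig 1 (-m) (-k) z = trig 1 m k z := by
    intro z; simp [trig, expT_neg]
  have h2 : ∀ z : Torus P, trig (-Complex.I) (-m) (-k) z = -trig (-Complex.I) m k z := by
    intro z; simp [trig, expT_neg]
  apply Complex.ext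
  · simp only [coeffT, h1, Complex.conj_re]
  · simp only [coeffT, h2, Complex.conj_im, mul_neg, integral_neg]

theorem exists_norm_coeffT_le {f : Torus P → ℝ} (hf : IsTest f) (n : ℕ) :
    ∃ C : ℝ, 0 ≤ C ∧ ∀ m k : ℤ, ‖coeffT f m k‖ ≤ C / quad P m k ^ n := by
  obtain ⟨C, hC0, hC⟩ := exists_abs_integral_mul_trig_le hf n
  refine ⟨C + C, by linarith, fun m k => (Complex.norm_le_abs_re_add_abs_im _).trans ?_⟩
  have h1 := hC 1 m k
  have h2 := hC (-Complex.I) m k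
  simp only [norm_one, norm_neg, Complex.norm_I, mul_one] at h1 h2
  rw [add_div]
  exact add_le_add h1 h2

omit hP in
theorem norm_iteratedFDeriv_trig_le (a : ℂ) (m k : ℤ) (n : ℕ) (w : ℝ × ℝ) :
    ‖iteratedFDeriv ℝ n (fun w => trig a m k (proj P w)) w‖ ≤ ‖a‖ * ‖freq P m k‖ ^ n := by
  have : (fun w => trig a m k (proj P w)) = wave a ∘ freq P m k := funext (trig_proj a m k)
  rw [this, ContinuousLinearMap.iteratedFDeriv_comp_right (freq P m k) (contDiff_wave a) w
    (by exact_mod_cast le_top)]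
  refine (ContinuousMultilinearMap.norm_compContinuousLinearMap_le _ _).trans ?_
  rw [Finset.prod_const, Finset.card_univ, Fintype.card_fin]
  gcongr
  rw [norm_iteratedFDeriv_eq_norm_iteratedDeriv, iteratedDeriv_wave]
  refine (abs_wave_le _ _).trans ?_
  simp

/-- A trigonometric series with rapidly decreasing coefficients has a smooth sum. -/
theorem isTest_tsum_trig {a : ℤ → ℤ → ℂ}
    (ha : ∀ n : ℕ, ∃ C : ℝ, ∀ m k : ℤ, ‖a m k‖ ≤ C / quad P m k ^ n) :
    IsTest (fun z : Torus P => ∑' i : ℤ × ℤ, trig (a i.1 i.2) i.1 i.2 z) := by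
  choose C hC using ha
  change ContDiff ℝ ((⊤ : ℕ∞) : WithTop ℕ∞)
    fun w : ℝ × ℝ => ∑' i : ℤ × ℤ, trig (a i.1 i.2) i.1 i.2 (proj P w)
  -- the `n`-th derivatives cost a factor `quad ^ n`; two more powers make the series summable
  refine contDiff_tsum (f := fun (i : ℤ × ℤ) w => trig (a i.1 i.2) i.1 i.2 (proj P w))
    (v := fun n i => C (n + 2) * (quad P i.1 i.2 ^ 2)⁻¹)
    (fun i => isTest_trig _ _ _) (fun n _ => (summable_inv_quad_sq (P := P)).mul_left _) ?_
  intro n i w _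
  refine (norm_iteratedFDeriv_trig_le _ _ _ n w).trans ?_
  have hq := quad_pos (P := P) i.1 i.2
  calc ‖a i.1 i.2‖ * ‖freq P i.1 i.2‖ ^ n
      ≤ C (n + 2) / quad P i.1 i.2 ^ (n + 2) * quad P i.1 i.2 ^ n :=
        mul_le_mul (hC _ _ _) (pow_le_pow_left₀ (norm_nonneg _) (norm_freq_le _ _) n)
          (by positivity) ((norm_nonneg _).trans (hC _ _ _))
    _ = C (n + 2) * (quad P i.1 i.2 ^ 2)⁻¹ := by
        rw [pow_add]; field_simp

/-- The Fourier coefficients of a trigonometric series. Both `(m, k)` and `(-m, -k)` contribute, as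
`trig` is the real part of a character. -/
theorem integral_tsum_trig_mul_trig {a : ℤ → ℤ → ℂ} {C : ℝ}
    (hC : ∀ m k : ℤ, ‖a m k‖ ≤ C / quad P m k ^ 2) (b : ℂ) (m k : ℤ) :
    ∫ z : Torus P, (∑' i : ℤ × ℤ, trig (a i.1 i.2) i.1 i.2 z) * trig b m k z =
      mass P / 2 * (a (-m) (-k) * b).re + mass P / 2 * (a m k * (starRingEnd ℂ) b).re := by
  have hint : ∀ i : ℤ × ℤ,
      Integrable (fun z : Torus P => trig (a i.1 i.2) i.1 i.2 z * trig b m k z) volume :=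
    fun i => ((isTest_trig _ _ _).mul (isTest_trig _ _ _)).integrable _
  have hsum : Summable fun i : ℤ × ℤ =>
      ∫ z : Torus P, ‖trig (a i.1 i.2) i.1 i.2 z * trig b m k z‖ := by
    refine Summable.of_nonneg_of_le (fun i => integral_nonneg fun z => norm_nonneg _) (fun i => ?_)
      ((summable_inv_quad_sq (P := P)).mul_left (C * ‖b‖ * mass P))
    have := norm_integral_le_of_norm_le_const (μ := (volume : Measure (Torus P)))
      (f := fun z => ‖trig (a i.1 i.2) i.1 i.2 z * trig b m k z‖)
      (C := C / quad P i.1 i.2 ^ 2 * ‖b‖) (.of_forall fun z => by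
        rw [norm_norm, norm_mul]
        exact mul_le_mul ((abs_trig_le _ _ _ z).trans (hC _ _)) (abs_trig_le b m k z)
          (norm_nonneg _) ((norm_nonneg _).trans (hC _ _)))
    rw [measureReal_univ] at this
    refine (le_abs_self _).trans (this.trans (le_of_eq ?_))
    rw [div_eq_mul_inv]
    ring
  have key := hasSum_integral_of_summable_integral_norm hint hsum
  simp only [tsum_mul_right, integral_trig_mul_trig] at key
  refine key.unique (HasSum.add ?_ ?_)
  · have : (fun i : ℤ × ℤ => if i.1 = -m ∧ i.2 = -k then mass P / 2 * (a i.1 i.2 * b).re else 0) =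
        fun i => if i = (-m, -k) then mass P / 2 * (a (-m) (-k) * b).re else 0 := by
      funext ⟨i, j⟩
      simp only [Prod.mk.injEq]
      split_ifs with h
      · rw [h.1, h.2]
      · rfl
    rw [this]
    exact hasSum_ite_eq _ _
  · have : (fun i : ℤ × ℤ => if i.1 = m ∧ i.2 = k then
          mass P / 2 * (a i.1 i.2 * (starRingEnd ℂ) b).re else 0) =
        fun i => if i = (m, k) then mass P / 2 * (a m k * (starRingEnd ℂ) b).re else 0 := by
      funext ⟨i, j⟩
      simp only [Prod.mk.injEq]
      split_ifs with h
      · rw [h.1, h.2]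
      · rfl
    rw [this]
    exact hasSum_ite_eq _ _

/-- If the smooth function `G` is orthogonal to the kernel of `L_{-ρ}`, then `L_ρ h = G` has a
smooth solution, obtained by dividing the Fourier coefficients of `G` by the symbol. -/
theorem exists_isTest_lOp_eq (ρ : ℝ) {G : Torus P → ℝ} (hG : IsTest G)
    (horth : ∀ m k, symb P ρ m k = 0 → coeffT G m k = 0) :
    ∃ h : Torus P → ℝ, IsTest h ∧
      ∀ φ, IsTest φ → ∫ z, h z * lOp (-ρ) φ z = ∫ z, G z * φ z := by
  obtain ⟨δ, hδ, hsymb⟩ := exists_pos_le_norm_symb P ρ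
  -- at resonant indices both terms of the quotient vanish, and so does the quotient
  set c : ℤ → ℤ → ℂ := fun m k => coeffT G m k / (mass P * symb P ρ m k) with hc
  have hM : (mass P : ℂ) ≠ 0 := by exact_mod_cast (mass_pos (P := P)).ne'
  have hcneg : ∀ m k, c (-m) (-k) = (starRingEnd ℂ) (c m k) := by
    intro m k
    simp only [hc, coeffT_neg, symb_neg, map_div₀, map_mul, Complex.conj_ofReal]
  have hdecay : ∀ n : ℕ, ∃ C : ℝ, ∀ m k : ℤ, ‖(starRingEnd ℂ) (c m k)‖ ≤ C / quad P m k ^ n := by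
    intro n
    obtain ⟨C, hC0, hC⟩ := exists_norm_coeffT_le hG n
    refine ⟨C / (mass P * δ), fun m k => ?_⟩
    have hMp := mass_pos (P := P)
    have hq := pow_pos (quad_pos (P := P) m k) n
    rw [RCLike.norm_conj]
    by_cases h0 : symb P ρ m k = 0
    · simp only [hc, h0, mul_zero, div_zero, norm_zero]
      positivity
    · simp only [hc, norm_div, norm_mul, Complex.norm_real, Real.norm_eq_abs, abs_of_pos hMp]
      rw [div_right_comm]
      exact div_le_div₀ (by positivity) (hC m k) (by positivity)
        (mul_le_mul_of_nonneg_left (hsymb m k h0) hMp.le)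
  set h : Torus P → ℝ :=
    fun z => ∑' i : ℤ × ℤ, trig ((starRingEnd ℂ) (c i.1 i.2)) i.1 i.2 z with hh
  have htest : IsTest h := isTest_tsum_trig hdecay
  refine ⟨h, htest, ?_⟩
  obtain ⟨C, hC⟩ := hdecay 2
  have hcoeff : ∀ b m k, ∫ z, h z * lOp (-ρ) (trig b m k) z = ∫ z, G z * trig b m k z := by
    intro b m k
    simp only [lOp_trig, hh]
    rw [integral_tsum_trig_mul_trig hC, hcneg, Complex.conj_conj, ← map_mul, Complex.conj_re,
      integral_mul_trig (hG.integrable _), ← add_mul, add_halves, ← Complex.re_ofReal_mul]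
    congr 1
    by_cases h0 : symb P ρ m k = 0
    · simp [h0, horth m k h0]
    · simp only [hc]
      field_simp
  have hzero : (fun z => lOp ρ h z - G z) =ᵐ[volume] 0 := by
    refine ae_eq_zero_of_trig (((htest.lOp ρ).sub hG).integrable _) fun b m k => ?_
    have := hcoeff b m k
    rw [integral_mul_lOp htest (isTest_trig b m k)] at this
    simp only [sub_mul]
    rw [integral_sub (((htest.lOp ρ).mul (isTest_trig b m k)).integrable _)
      ((hG.mul (isTest_trig b m k)).integrable _), this, sub_self]
  intro φ hφ
  rw [integral_mul_lOp htest hφ]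
  refine integral_congr_ae ?_
  filter_upwards [hzero] with z hz
  rw [sub_eq_zero.1 hz]

/-! ### Integrable solutions of the homogeneous equation -/

/-- The homogeneous equation on the Fourier side: only resonant coefficients survive. -/
theorem symb_mul_coeffT_eq_zero {ρ : ℝ} {d : Torus P → ℝ} (hd : Integrable d volume)
    (h : ∀ φ, IsTest φ → ∫ z, d z * lOp (-ρ) φ z = 0) (m k : ℤ) :
    symb P ρ m k * coeffT d m k = 0 := by
  have key : ∀ b : ℂ, (b * (symb P ρ m k * coeffT d m k)).re = 0 := by
    intro b
    have := h _ (isTest_trig b m k)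
    simp only [lOp_trig] at this
    rw [integral_mul_trig hd] at this
    rw [← mul_assoc, this]
  apply Complex.ext
  · simpa using key 1
  · simpa using key (-Complex.I)

theorem ae_eq_zero_of_weak_null {ρ : ℝ} (hρ : ∀ n : ℤ, ρ ≠ n) {d : Torus P → ℝ}
    (hd : Integrable d volume) (h : ∀ φ, IsTest φ → ∫ z, d z * lOp (-ρ) φ z = 0) :
    d =ᵐ[volume] 0 := by
  refine ae_eq_zero_of_trig hd fun b m k => ?_
  have h1 := symb_mul_coeffT_eq_zero hd h m k
  have h2 : symb P ρ m k ≠ 0 := by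
    rw [Ne, symb_eq_zero_iff]
    rintro ⟨-, h | h⟩
    · exact hρ k h
    · exact hρ (-k) (by push_cast; exact h)
  rw [integral_mul_trig hd, (mul_eq_zero.1 h1).resolve_left h2, mul_zero, Complex.zero_re]

/-- For an integral exponent the surviving coefficients are those at `(0, p)` and `(0, -p)`, which
are complex conjugates of each other. -/
theorem ae_eq_trig_of_weak_null {p : ℤ} {d : Torus P → ℝ}
    (hd : Integrable d volume) (h : ∀ φ, IsTest φ → ∫ z, d z * lOp (-(p : ℝ)) φ z = 0) :
    ∃ C : ℂ, d =ᵐ[volume] trig C 0 p := by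
  have hM : mass P ≠ 0 := mass_pos.ne'
  have hM' : (mass P : ℂ) ≠ 0 := by exact_mod_cast hM
  -- for `p ≠ 0` the real part of a character has half of its mass at each of `±p`
  set C : ℂ := (if p = 0 then 1 else 2) * (starRingEnd ℂ) (coeffT d 0 p) / mass P with hC
  refine ⟨C, ?_⟩
  have hdiv : ∀ x y : ℂ, (x / mass P * y).re = (x * y).re / mass P := by
    intro x y
    rw [div_mul_eq_mul_div, Complex.div_ofReal_re]
  have ht := (isTest_trig (P := P) C 0 p).integrable volume
  have key : (fun z => d z - trig C 0 p z) =ᵐ[volume] 0 := by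
    refine ae_eq_zero_of_trig (hd.sub ht) fun b m k => ?_
    simp only [sub_mul]
    rw [integral_sub (integrable_mul_trig hd b m k) (integrable_mul_trig ht b m k),
      integral_trig_mul_trig, integral_mul_trig hd]
    by_cases h2 : symb P p m k = 0
    · obtain ⟨rfl, h3⟩ := (symb_eq_zero_iff _ _ _).1 h2
      have h3 : p = k ∨ p = -k := by exact_mod_cast h3
      have hself : p = 0 → (coeffT d 0 0).im = 0 := by
        intro _
        have := coeffT_neg (f := d) 0 0
        rw [neg_zero] at this
        exact Complex.conj_eq_iff_im.1 this.symm
      have hneg : coeffT d 0 (-p) = (starRingEnd ℂ) (coeffT d 0 p) := by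
        simpa using coeffT_neg (f := d) 0 p
      by_cases hp : p = 0
      · subst hp
        have hk : k = 0 := by omega
        subst hk
        simp only [hC, if_true, one_mul, neg_zero, true_and]
        rw [Complex.conj_eq_iff_im.2 (hself rfl)]
        have hre : coeffT d 0 0 = ((coeffT d 0 0).re : ℂ) :=
          Complex.ext rfl (by simpa using hself rfl)
        rw [hre, ← Complex.ofReal_div]
        simp only [Complex.mul_re, Complex.ofReal_re, Complex.ofReal_im, Complex.conj_re,
          Complex.conj_im]
        field_simp
        ring
      · rcases h3 with rfl | rfl
        · have : p ≠ -p := by omega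
          simp only [hC, hp, if_false, this, and_false, and_self, if_true, zero_add]
          rw [mul_div_assoc, ← Complex.ofReal_ofNat, mul_assoc, Complex.re_ofReal_mul,
            hdiv, ← map_mul, Complex.conj_re,
            mul_comm (coeffT d 0 p)]
          field_simp
          ring
        · have hk : k ≠ 0 := by omega
          have h1 : ¬ -k = k := by omega
          rw [neg_neg] at hneg
          simp only [hC, hp, if_false, h1, and_false, neg_zero, and_self, if_true, add_zero]
          rw [mul_div_assoc, ← Complex.ofReal_ofNat, mul_assoc, Complex.re_ofReal_mul,
            hdiv, hneg, mul_comm b]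
          field_simp
          ring
    · have h1 := (mul_eq_zero.1 (symb_mul_coeffT_eq_zero hd h m k)).resolve_left h2
      rw [symb_eq_zero_iff] at h2
      have c1 : ¬ (0 = -m ∧ p = -k) := by
        rintro ⟨h3, h4⟩
        exact h2 ⟨by omega, Or.inr (by rw [h4]; push_cast; ring)⟩
      have c2 : ¬ (0 = m ∧ p = k) := by
        rintro ⟨h3, h4⟩
        exact h2 ⟨by omega, Or.inl (by rw [h4])⟩
      rw [h1, if_neg c1, if_neg c2]
      simp
  filter_upwards [key] with z hz
  exact sub_eq_zero.1 hz

end Solve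

/-! ### Periodization in the `x` variable -/

section Periodization

variable {P : ℝ} [hP : Fact (0 < P)]

omit hP in
theorem periodic_centered (hP : P ≠ 0) :
    Function.Periodic (fun x : ℝ => x - round (P⁻¹ * x) * P) P := by
  intro x
  have : P⁻¹ * (x + P) = P⁻¹ * x + (1 : ℤ) := by field_simp; simp
  simp only [this, round_add_intCast]
  push_cast
  ring

/-- The representative in `[-P/2, P/2]` of a point of `ℝ/Pℤ`. -/
noncomputable def cent (x : AddCircle P) : ℝ := (periodic_centered hP.out.ne').lift x

theorem cent_coe (x : ℝ) : cent (x : AddCircle P) = x - round (P⁻¹ * x) * P :=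
  Function.Periodic.lift_coe _ _

theorem coe_cent (x : AddCircle P) : (cent x : AddCircle P) = x := by
  induction x using QuotientAddGroup.induction_on with
  | H x =>
    rw [cent_coe, AddCircle.coe_sub, ← zsmul_eq_mul, AddCircle.coe_zsmul, AddCircle.coe_period,
      smul_zero, sub_zero]

theorem abs_cent (x : AddCircle P) : |cent x| = ‖x‖ := by
  induction x using QuotientAddGroup.induction_on with
  | H x =>
    change |cent (x : AddCircle P)| = ‖(x : AddCircle P)‖
    rw [cent_coe, AddCircle.norm_eq]

theorem continuous_abs_cent : Continuous fun z : Torus P => |cent z.1| := by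
  simp only [abs_cent]
  fun_prop

theorem cent_coe_of_abs_lt {x : ℝ} (hx : |x| < P / 2) : cent (x : AddCircle P) = x := by
  have hp := hP.out
  have : round (P⁻¹ * x) = 0 := by
    rw [round_eq_zero_iff]
    rw [abs_lt] at hx
    rw [inv_mul_eq_div]
    constructor
    · rw [le_div_iff₀ hp]; linarith
    · rw [div_lt_iff₀ hp]; linarith
  rw [cent_coe, this]
  simp

theorem cent_zero : cent (0 : AddCircle P) = 0 := by
  have := cent_coe_of_abs_lt (P := P) (x := 0) (by simpa using hP.out)
  simpa using this

/-- Smooth functions on the line that are constant outside `[-P/4, P/4]`; their restrictions to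
`[-P/2, P/2]` extend to smooth `P`-periodic functions. -/
structure IsProfile (P : ℝ) (f : ℝ → ℝ) : Prop where
  contDiff : ContDiff ℝ ∞ f
  const : ∃ c, ∀ x, P / 4 < |x| → f x = c

omit hP in
theorem IsProfile.deriv {f : ℝ → ℝ} (hf : IsProfile P f) : IsProfile P (deriv f) := by
  refine ⟨(contDiff_infty_iff_deriv.1 hf.contDiff).2, 0, fun x hx => ?_⟩
  obtain ⟨c, hc⟩ := hf.const
  have : f =ᶠ[𝓝 x] fun _ => c := by
    filter_upwards [(isOpen_lt continuous_const continuous_abs).mem_nhds hx] with y hy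
    exact hc y hy
  rw [this.deriv_eq, deriv_const]

/-- Locally, the periodization of a profile is a translate of the profile. -/
theorem IsProfile.eventuallyEq {f : ℝ → ℝ} (hf : IsProfile P f) (x : ℝ) :
    (fun t : ℝ => f (cent (t : AddCircle P))) =ᶠ[𝓝 x] fun t => f (t - round (P⁻¹ * x) * P) := by
  have hp := hP.out
  obtain ⟨c, hc⟩ := hf.const
  set n := round (P⁻¹ * x) with hn
  have hx : |x - n * P| = ‖(x : AddCircle P)‖ := by rw [AddCircle.norm_eq]
  by_cases h : |x - n * P| < P / 2
  · have : ∀ᶠ t in 𝓝 x, |t - n * P| < P / 2 :=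
      (isOpen_lt (by fun_prop) continuous_const).mem_nhds h
    filter_upwards [this] with t ht
    have h1 : ((t - n * P : ℝ) : AddCircle P) = (t : AddCircle P) := by
      rw [AddCircle.coe_sub, ← zsmul_eq_mul, AddCircle.coe_zsmul, AddCircle.coe_period,
        smul_zero, sub_zero]
    rw [← h1, cent_coe_of_abs_lt ht]
  · have h1 : P / 4 < |x - n * P| := by linarith
    have e1 : ∀ᶠ t in 𝓝 x, P / 4 < |t - n * P| :=
      (isOpen_lt continuous_const (by fun_prop)).mem_nhds h1
    have e2 : ∀ᶠ t : ℝ in 𝓝 x, P / 4 < ‖(t : AddCircle P)‖ := by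
      refine (isOpen_lt continuous_const ?_).mem_nhds (by rwa [hx] at h1)
      exact continuous_norm.comp (AddCircle.continuous_mk' P)
    filter_upwards [e1, e2] with t h3 h4
    rw [hc _ h3, hc _ (by rwa [abs_cent])]

/-- The function on the torus, depending on `x` only, with the given profile. -/
noncomputable def ofProfile (f : ℝ → ℝ) (z : Torus P) : ℝ := f (cent z.1)

theorem IsProfile.isTest {f : ℝ → ℝ} (hf : IsProfile P f) :
    IsTest (ofProfile f : Torus P → ℝ) := by
  have h1 : ContDiff ℝ ∞ fun t : ℝ => f (cent (t : AddCircle P)) := by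
    rw [contDiff_iff_contDiffAt]
    intro x
    have : ContDiff ℝ ∞ fun t => f (t - round (P⁻¹ * x) * P) :=
      hf.contDiff.comp (contDiff_id.sub contDiff_const)
    exact this.contDiffAt.congr_of_eventuallyEq (hf.eventuallyEq x)
  exact h1.comp contDiff_fst

theorem IsProfile.dX_ofProfile {f : ℝ → ℝ} (hf : IsProfile P f) :
    dX (ofProfile f : Torus P → ℝ) = ofProfile (_root_.deriv f) := by
  funext z
  obtain ⟨⟨x, y⟩, rfl⟩ := surjective_proj z
  have h1 : (fun h : ℝ => ofProfile f (proj P (x, y) + proj P (h, 0))) =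
      (fun t : ℝ => f (cent (t : AddCircle P))) ∘ fun h => x + h := by
    funext h
    simp [ofProfile, proj]
  have h2 := ((hf.eventuallyEq x).deriv_eq)
  have h3 : DifferentiableAt ℝ f (x - round (P⁻¹ * x) * P) :=
    hf.contDiff.differentiable (by simp) _
  have h4 : HasDerivAt (fun t => f (t - round (P⁻¹ * x) * P))
      (_root_.deriv f (x - round (P⁻¹ * x) * P)) x := by
    simpa using h3.hasDerivAt.comp_sub_const x (round (P⁻¹ * x) * P)
  have h5 := h4.congr_of_eventuallyEq (hf.eventuallyEq x)
  have h6 : HasDerivAt (fun h : ℝ => x + h) 1 0 := (hasDerivAt_id 0).const_add x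
  have h7 := HasDerivAt.comp (0 : ℝ) (by simpa using h5) h6
  rw [dX, h1, h7.deriv]
  simp [ofProfile, proj, cent_coe]

omit hP in
theorem dY_ofProfile [Fact (0 < P)] (f : ℝ → ℝ) :
    dY (ofProfile f : Torus P → ℝ) = fun _ => 0 := by
  funext z
  simp [dY, ofProfile, proj]

/-- A cutoff function equal to `1` on `[-P/8, P/8]` and supported in `[-P/4, P/4]`. -/
noncomputable def cutoff (P : ℝ) [hP : Fact (0 < P)] : ContDiffBump (0 : ℝ) where
  rIn := P / 8
  rOut := P / 4
  rIn_pos := by linarith [hP.out]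
  rIn_lt_rOut := by linarith [hP.out]

theorem cutoff_eq_one {x : ℝ} (hx : |x| ≤ P / 8) : cutoff P x = 1 :=
  (cutoff P).one_of_mem_closedBall (by simpa [cutoff] using hx)

theorem cutoff_eq_zero {x : ℝ} (hx : P / 4 < |x|) : cutoff P x = 0 :=
  (cutoff P).zero_of_le_dist (by simpa [cutoff] using hx.le)

/-- The profile of the weight `e^{-ρx}`, cut off away from `x = 0`. -/
noncomputable def weightProfile (P ρ : ℝ) [Fact (0 < P)] (x : ℝ) : ℝ :=
  cutoff P x * Real.exp (-ρ * x)

/-- A profile that agrees with `2 cosh x` near `0` and is larger than `2` elsewhere. -/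
noncomputable def coshProfile (P : ℝ) [Fact (0 < P)] (x : ℝ) : ℝ :=
  3 + cutoff P x * (2 * Real.cosh x - 3)

theorem isProfile_weight (ρ : ℝ) : IsProfile P (weightProfile P ρ) := by
  refine ⟨?_, 0, fun x hx => by simp [weightProfile, cutoff_eq_zero hx]⟩
  exact (cutoff P).contDiff.mul (contDiff_const.mul contDiff_id).exp

theorem isProfile_cosh : IsProfile P (coshProfile P) := by
  refine ⟨?_, 3, fun x hx => by simp [coshProfile, cutoff_eq_zero hx]⟩
  exact contDiff_const.add ((cutoff P).contDiff.mul
    ((contDiff_const.mul Real.contDiff_cosh).sub contDiff_const))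

theorem weightProfile_eq {ρ x : ℝ} (hx : |x| ≤ P / 8) :
    weightProfile P ρ x = Real.exp (-ρ * x) := by
  rw [weightProfile, cutoff_eq_one hx, one_mul]

theorem coshProfile_eq {x : ℝ} (hx : |x| ≤ P / 8) : coshProfile P x = 2 * Real.cosh x := by
  rw [coshProfile, cutoff_eq_one hx]
  ring

omit hP in
theorem eventually_abs_le {x : ℝ} (hx : |x| < P / 8) : ∀ᶠ t in 𝓝 x, |t| < P / 8 :=
  (isOpen_lt continuous_abs continuous_const).mem_nhds hx

theorem deriv_weightProfile {ρ x : ℝ} (hx : |x| < P / 8) :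
    deriv (weightProfile P ρ) x = -ρ * Real.exp (-ρ * x) := by
  have : weightProfile P ρ =ᶠ[𝓝 x] fun x => Real.exp (-ρ * x) := by
    filter_upwards [eventually_abs_le hx] with t ht using weightProfile_eq ht.le
  rw [this.deriv_eq]
  have h := ((hasDerivAt_id x).const_mul (-ρ)).exp
  simp only [id, mul_one] at h
  rw [h.deriv, mul_comm]

theorem deriv_deriv_weightProfile {ρ x : ℝ} (hx : |x| < P / 8) :
    deriv (deriv (weightProfile P ρ)) x = ρ ^ 2 * Real.exp (-ρ * x) := by
  have : deriv (weightProfile P ρ) =ᶠ[𝓝 x] fun x => -ρ * Real.exp (-ρ * x) := by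
    filter_upwards [eventually_abs_le hx] with t ht using deriv_weightProfile ht
  rw [this.deriv_eq]
  have h := (((hasDerivAt_id x).const_mul (-ρ)).exp).const_mul (-ρ)
  simp only [id, mul_one] at h
  rw [h.deriv]
  ring

theorem deriv_coshProfile {x : ℝ} (hx : |x| < P / 8) :
    deriv (coshProfile P) x = 2 * Real.sinh x := by
  have : coshProfile P =ᶠ[𝓝 x] fun x => 2 * Real.cosh x := by
    filter_upwards [eventually_abs_le hx] with t ht using coshProfile_eq ht.le
  rw [this.deriv_eq, ((Real.hasDerivAt_cosh x).const_mul 2).deriv]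

theorem deriv_deriv_coshProfile {x : ℝ} (hx : |x| < P / 8) :
    deriv (deriv (coshProfile P)) x = 2 * Real.cosh x := by
  have : deriv (coshProfile P) =ᶠ[𝓝 x] fun x => 2 * Real.sinh x := by
    filter_upwards [eventually_abs_le hx] with t ht using deriv_coshProfile ht
  rw [this.deriv_eq, ((Real.hasDerivAt_sinh x).const_mul 2).deriv]

omit hP in
theorem sq_le_two_mul_cosh_sub_two (x : ℝ) : x ^ 2 ≤ 2 * Real.cosh x - 2 := by
  have h1 : Real.cosh x = 1 + 2 * Real.sinh (x / 2) ^ 2 := by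
    have := Real.cosh_two_mul (x / 2)
    rw [show 2 * (x / 2) = x by ring, Real.cosh_sq] at this
    linarith
  have h2 : (x / 2) ^ 2 ≤ Real.sinh (x / 2) ^ 2 := by
    rw [sq_le_sq, Real.abs_sinh]
    exact Real.self_le_sinh_iff.2 (abs_nonneg _)
  rw [h1]
  linarith

/-- The cutoff keeps `coshProfile` above `2`, so that `gap` has no zero off the line `x = 0`. -/
theorem min_le_coshProfile (x : ℝ) : 2 + min 1 (x ^ 2) ≤ coshProfile P x := by
  have h0 := (cutoff P).nonneg (x := x)
  have h1 := (cutoff P).le_one (x := x)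
  have h2 := sq_le_two_mul_cosh_sub_two x
  have h3 := min_le_left 1 (x ^ 2)
  have h4 := min_le_right 1 (x ^ 2)
  unfold coshProfile
  nlinarith [mul_nonneg h0 (by linarith : 0 ≤ 2 * Real.cosh x - 2 - min 1 (x ^ 2)),
    mul_nonneg (sub_nonneg.2 h1) (sub_nonneg.2 h3)]

end Periodization

/-! ### The regularized logarithm -/

section Parametrix

variable {P : ℝ} [hP : Fact (0 < P)]

/-- A smooth function on the torus that vanishes only at the origin, and equals
`2 cosh x - 2 cos y = |2 sinh ((x + iy) / 2)|²` for `x` near `0`. -/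
noncomputable def gap (z : Torus P) : ℝ := ofProfile (coshProfile P) z - 2 * trig 1 0 1 z

/-- The weight `e^{-ρx}` near `x = 0`, cut off away from there. -/
noncomputable def weight (ρ : ℝ) : Torus P → ℝ := ofProfile (weightProfile P ρ)

theorem isTest_gap : IsTest (gap : Torus P → ℝ) :=
  isProfile_cosh.isTest.sub ((isTest_trig 1 0 1).const_mul 2)

theorem isTest_weight (ρ : ℝ) : IsTest (weight ρ : Torus P → ℝ) := (isProfile_weight ρ).isTest

omit hP in
theorem trig_one_zero_one_proj (w : ℝ × ℝ) : trig 1 0 1 (proj P w) = Real.cos w.2 := by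
  rw [trig_proj, wave, freq_apply]
  simp only [Int.cast_zero, mul_zero, zero_mul, zero_add, Int.cast_one, one_mul]
  rw [mul_comm, Complex.exp_ofReal_mul_I_re]

omit hP in
theorem trig_I_zero_one_proj (w : ℝ × ℝ) : trig Complex.I 0 1 (proj P w) = -Real.sin w.2 := by
  rw [trig_proj, wave, freq_apply]
  simp only [Int.cast_zero, mul_zero, zero_mul, zero_add, Int.cast_one, one_mul]
  rw [mul_comm Complex.I (w.2 : ℂ), Complex.I_mul_re, Complex.exp_ofReal_mul_I_im]

theorem gap_proj (w : ℝ × ℝ) :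
    gap (proj P w) = coshProfile P (cent (w.1 : AddCircle P)) - 2 * Real.cos w.2 := by
  rw [gap, trig_one_zero_one_proj]
  rfl

theorem min_le_gap (z : Torus P) : min 1 (cent z.1 ^ 2) ≤ gap z := by
  obtain ⟨w, rfl⟩ := surjective_proj z
  rw [gap_proj]
  have h1 := min_le_coshProfile (P := P) (cent (w.1 : AddCircle P))
  have h2 := Real.cos_le_one w.2
  have h3 : (proj P w).1 = (w.1 : AddCircle P) := rfl
  rw [h3]
  linarith

theorem two_sub_two_mul_cos_le_gap (w : ℝ × ℝ) : 2 - 2 * Real.cos w.2 ≤ gap (proj P w) := by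
  rw [gap_proj]
  have h1 := min_le_coshProfile (P := P) (cent (w.1 : AddCircle P))
  have h2 : 0 ≤ min 1 (cent (w.1 : AddCircle P) ^ 2) := by positivity
  linarith

theorem gap_nonneg (z : Torus P) : 0 ≤ gap z :=
  le_trans (by positivity) (min_le_gap z)

theorem gap_eq_zero_iff (z : Torus P) : gap z = 0 ↔ z = 0 := by
  constructor
  · intro h
    have h1 : cent z.1 = 0 := by
      have := min_le_gap z
      rw [h] at this
      have h2 : 0 ≤ cent z.1 ^ 2 := sq_nonneg _
      rcases min_le_iff.1 this with h3 | h3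
      · linarith
      · nlinarith
    have h2 : z.1 = 0 := by
      rw [← coe_cent z.1, h1, AddCircle.coe_zero]
    have h3 : z.2 = 0 := by
      obtain ⟨w, rfl⟩ := surjective_proj z
      have h4 := two_sub_two_mul_cos_le_gap (P := P) w
      rw [h] at h4
      have h5 : Real.cos w.2 = 1 := le_antisymm (Real.cos_le_one _) (by linarith)
      obtain ⟨n, hn⟩ := (Real.cos_eq_one_iff _).1 h5
      change ((w.2 : ℝ) : AddCircle (2 * Real.pi)) = 0
      rw [← hn, ← zsmul_eq_mul, AddCircle.coe_zsmul, AddCircle.coe_period, smul_zero]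
    exact Prod.ext h2 h3
  · rintro rfl
    have := gap_proj (P := P) (0, 0)
    rw [proj_mk_zero] at this
    rw [this]
    simp only [AddCircle.coe_zero, cent_zero, Real.cos_zero]
    rw [coshProfile_eq (by rw [abs_zero]; linarith [hP.out]), Real.cosh_zero]
    ring

theorem gap_pos {z : Torus P} (hz : z ≠ 0) : 0 < gap z :=
  (gap_nonneg z).lt_of_ne fun h => hz ((gap_eq_zero_iff z).1 h.symm)

/-! ### Explicit formulas on the strip around `x = 0` -/

theorem weight_strip {ρ : ℝ} {z : Torus P} (hz : |cent z.1| < P / 8) :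
    weight ρ z = Real.exp (-ρ * cent z.1) := weightProfile_eq hz.le

theorem dX_weight_strip {ρ : ℝ} {z : Torus P} (hz : |cent z.1| < P / 8) :
    dX (weight ρ) z = -ρ * weight ρ z := by
  rw [weight_strip hz, weight, (isProfile_weight ρ).dX_ofProfile]
  exact deriv_weightProfile hz

theorem lOp_weight_strip {ρ : ℝ} {z : Torus P} (hz : |cent z.1| < P / 8) :
    lOp ρ (weight ρ) z = 0 := by
  have h1 : dX (dX (weight ρ)) z = ρ ^ 2 * weight ρ z := by
    rw [weight_strip hz, weight, (isProfile_weight ρ).dX_ofProfile,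
      (isProfile_weight ρ).deriv.dX_ofProfile]
    exact deriv_deriv_weightProfile hz
  have h2 : dY (dY (weight ρ)) z = 0 := by
    rw [weight, dY_ofProfile]
    simp [dY]
  rw [lOp, h1, h2, dX_weight_strip hz]
  ring

theorem dX_gap : dX (gap : Torus P → ℝ) = ofProfile (deriv (coshProfile P)) := by
  have h1 : (gap : Torus P → ℝ) = fun z => ofProfile (coshProfile P) z + (-2) * trig 1 0 1 z := by
    funext z; rw [gap]; ring
  have h2 : dX (trig 1 0 1 : Torus P → ℝ) = fun _ => 0 := by
    rw [dX_trig]; funext z; simp [trig]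
  rw [h1, dX_add isProfile_cosh.isTest ((isTest_trig 1 0 1).const_mul _),
    dX_const_mul (isTest_trig 1 0 1), h2, isProfile_cosh.dX_ofProfile]
  simp

theorem dY_gap : dY (gap : Torus P → ℝ) = fun z => -2 * trig Complex.I 0 1 z := by
  have h1 : (gap : Torus P → ℝ) = fun z => ofProfile (coshProfile P) z + (-2) * trig 1 0 1 z := by
    funext z; rw [gap]; ring
  rw [h1, dY_add isProfile_cosh.isTest ((isTest_trig 1 0 1).const_mul _),
    dY_const_mul (isTest_trig 1 0 1), dY_ofProfile, dY_trig]
  simp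

/-- The Laplacian of `gap`. -/
noncomputable def lapGap (z : Torus P) : ℝ := dX (dX gap) z + dY (dY gap) z

theorem isTest_lapGap : IsTest (lapGap : Torus P → ℝ) :=
  isTest_gap.dX.dX.add isTest_gap.dY.dY

theorem lapGap_strip {w : ℝ × ℝ} (hw : |cent (w.1 : AddCircle P)| < P / 8) :
    lapGap (proj P w) = 2 * Real.cosh (cent (w.1 : AddCircle P)) + 2 * Real.cos w.2 := by
  have h1 : dX (dX gap) (proj P w) = 2 * Real.cosh (cent (w.1 : AddCircle P)) := by
    rw [dX_gap, isProfile_cosh.deriv.dX_ofProfile]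
    exact deriv_deriv_coshProfile hw
  have h2 : dY (dY gap) (proj P w) = 2 * Real.cos w.2 := by
    rw [dY_gap, dY_const_mul (isTest_trig _ _ _), dY_trig]
    have : trig (Complex.I * (Complex.I * ((1 : ℤ) : ℝ))) 0 1 (proj P w) =
        -trig 1 0 1 (proj P w) := by
      simp [trig]
    simp only [this, trig_one_zero_one_proj]
    ring
  rw [lapGap, h1, h2]

theorem gap_strip {w : ℝ × ℝ} (hw : |cent (w.1 : AddCircle P)| < P / 8) :
    gap (proj P w) = 2 * Real.cosh (cent (w.1 : AddCircle P)) - 2 * Real.cos w.2 := by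
  rw [gap_proj, coshProfile_eq hw.le]

/-- Near `x = 0`, `gap` is the squared modulus of a holomorphic function, so `|∇ gap|²` is
`gap` times its Laplacian. -/
theorem sq_grad_gap_strip {z : Torus P} (hz : |cent z.1| < P / 8) :
    dX gap z ^ 2 + dY gap z ^ 2 = gap z * lapGap z := by
  obtain ⟨w, rfl⟩ := surjective_proj z
  have hw : |cent (w.1 : AddCircle P)| < P / 8 := hz
  have h1 : dX gap (proj P w) = 2 * Real.sinh (cent (w.1 : AddCircle P)) := by
    rw [dX_gap]
    exact deriv_coshProfile hw
  have h2 : dY gap (proj P w) = 2 * Real.sin w.2 := by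
    simp only [dY_gap, trig_I_zero_one_proj]
    ring
  rw [h1, h2, gap_strip hw, lapGap_strip hw]
  have h3 := Real.cosh_sq (cent (w.1 : AddCircle P))
  have h4 := Real.sin_sq_add_cos_sq w.2
  linear_combination (-4) * h3 + 4 * h4

/-- The regularized parametrix `e^{-ρx} log (gap + s)`. For `s = 0` it is the parametrix itself,
with the value `0` instead of `-∞` at the origin. -/
noncomputable def regLog (ρ s : ℝ) (z : Torus P) : ℝ := weight ρ z * Real.log (gap z + s)

/-- The coefficient of `1 / (gap + s)` in `L_ρ (regLog ρ s)`. -/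
noncomputable def coeffOne (ρ : ℝ) (z : Torus P) : ℝ :=
  2 * dX (weight ρ) z * dX gap z + 2 * ρ * weight ρ z * dX gap z + weight ρ z * lapGap z

/-- The coefficient of `-1 / (gap + s)²` in `L_ρ (regLog ρ s)`. -/
noncomputable def coeffTwo (ρ : ℝ) (z : Torus P) : ℝ :=
  weight ρ z * (dX gap z ^ 2 + dY gap z ^ 2)

/-- The formula for `L_ρ (regLog ρ s)`, valid for `s > 0` everywhere, and for `s = 0` off the
origin; at the origin its value for `s = 0` is `0`. -/
noncomputable def regDensity (ρ s : ℝ) (z : Torus P) : ℝ :=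
  lOp ρ (weight ρ) z * Real.log (gap z + s) + coeffOne ρ z / (gap z + s) -
    coeffTwo ρ z / (gap z + s) ^ 2

theorem isTest_coeffOne (ρ : ℝ) : IsTest (coeffOne ρ : Torus P → ℝ) := by
  have hw := isTest_weight (P := P) ρ
  exact (((hw.dX.const_mul 2).mul isTest_gap.dX).add ((hw.const_mul (2 * ρ)).mul
    isTest_gap.dX)).add (hw.mul isTest_lapGap)

theorem isTest_coeffTwo (ρ : ℝ) : IsTest (coeffTwo ρ : Torus P → ℝ) := by
  have h : (coeffTwo ρ : Torus P → ℝ) =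
      fun z => weight ρ z * (dX gap z * dX gap z + dY gap z * dY gap z) := by
    funext z; rw [coeffTwo]; ring
  rw [h]
  exact (isTest_weight ρ).mul
    ((isTest_gap.dX.mul isTest_gap.dX).add (isTest_gap.dY.mul isTest_gap.dY))

omit hP in
theorem isTest_log {f : Torus P → ℝ} (hf : IsTest f) (h0 : ∀ z, f z ≠ 0) :
    IsTest fun z => Real.log (f z) := ContDiff.log hf fun _ => h0 _

omit hP in
theorem isTest_inv {f : Torus P → ℝ} (hf : IsTest f) (h0 : ∀ z, f z ≠ 0) :
    IsTest fun z => (f z)⁻¹ := ContDiff.inv hf fun _ => h0 _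

omit hP in
theorem dX_log {f : Torus P → ℝ} (hf : IsTest f) (h0 : ∀ z, f z ≠ 0) :
    dX (fun z => Real.log (f z)) = fun z => dX f z * (f z)⁻¹ := by
  funext z
  have := ((hf.hasDerivAt_dX_zero z).log (by simpa only [proj_mk_zero, add_zero] using h0 z)).deriv
  simp only [proj_mk_zero, add_zero] at this
  rw [← div_eq_mul_inv]
  exact this

omit hP in
theorem dY_log {f : Torus P → ℝ} (hf : IsTest f) (h0 : ∀ z, f z ≠ 0) :
    dY (fun z => Real.log (f z)) = fun z => dY f z * (f z)⁻¹ := by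
  funext z
  have := ((hf.hasDerivAt_dY_zero z).log (by simpa only [proj_mk_zero, add_zero] using h0 z)).deriv
  simp only [proj_mk_zero, add_zero] at this
  rw [← div_eq_mul_inv]
  exact this

omit hP in
theorem dX_inv {f : Torus P → ℝ} (hf : IsTest f) (h0 : ∀ z, f z ≠ 0) :
    dX (fun z => (f z)⁻¹) = fun z => -dX f z / f z ^ 2 := by
  funext z
  have := ((hf.hasDerivAt_dX_zero z).fun_inv
    (by simpa only [proj_mk_zero, add_zero] using h0 z)).deriv
  simp only [proj_mk_zero, add_zero] at this
  exact this

omit hP in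
theorem dY_inv {f : Torus P → ℝ} (hf : IsTest f) (h0 : ∀ z, f z ≠ 0) :
    dY (fun z => (f z)⁻¹) = fun z => -dY f z / f z ^ 2 := by
  funext z
  have := ((hf.hasDerivAt_dY_zero z).fun_inv
    (by simpa only [proj_mk_zero, add_zero] using h0 z)).deriv
  simp only [proj_mk_zero, add_zero] at this
  exact this

theorem gap_add_ne_zero {s : ℝ} (hs : 0 < s) (z : Torus P) : gap z + s ≠ 0 := by
  have := gap_nonneg z
  positivity

theorem isTest_gap_add (s : ℝ) : IsTest fun z : Torus P => gap z + s :=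
  isTest_gap.add (isTest_const s)

theorem isTest_regLog (ρ : ℝ) {s : ℝ} (hs : 0 < s) : IsTest (regLog ρ s : Torus P → ℝ) :=
  (isTest_weight ρ).mul (isTest_log (isTest_gap_add s) (gap_add_ne_zero hs))

theorem lOp_regLog (ρ : ℝ) {s : ℝ} (hs : 0 < s) (z : Torus P) :
    lOp ρ (regLog ρ s) z = regDensity ρ s z := by
  have h0 := gap_add_ne_zero (P := P) hs
  have hg := isTest_gap_add (P := P) s
  have hl := isTest_log hg h0
  have hi := isTest_inv hg h0
  have hw := isTest_weight (P := P) ρ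
  have e1 : dX (fun z : Torus P => gap z + s) = dX gap := by
    funext z; simp [dX]
  have e2 : dY (fun z : Torus P => gap z + s) = dY gap := by
    funext z; simp [dY]
  have e3 : dY (weight ρ : Torus P → ℝ) = fun _ => 0 := dY_ofProfile _
  have x1 : dX (regLog ρ s) = fun z : Torus P =>
      dX (weight ρ) z * Real.log (gap z + s) + weight ρ z * (dX gap z * (gap z + s)⁻¹) := by
    unfold regLog
    rw [dX_mul hw hl, dX_log hg h0, e1]
  have x2 : dX (dX (regLog ρ s)) z =
      dX (dX (weight ρ)) z * Real.log (gap z + s) + dX (weight ρ) z * (dX gap z * (gap z + s)⁻¹) +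
      (dX (weight ρ) z * (dX gap z * (gap z + s)⁻¹) + weight ρ z *
        (dX (dX gap) z * (gap z + s)⁻¹ + dX gap z * (-dX gap z / (gap z + s) ^ 2))) := by
    rw [x1, dX_add (hw.dX.mul hl) (hw.mul (isTest_gap.dX.mul hi)), dX_mul hw.dX hl,
      dX_mul hw (isTest_gap.dX.mul hi), dX_mul isTest_gap.dX hi, dX_log hg h0, dX_inv hg h0, e1]
  have y1 : dY (regLog ρ s) = fun z : Torus P => weight ρ z * (dY gap z * (gap z + s)⁻¹) := by
    unfold regLog
    rw [dY_mul hw hl, dY_log hg h0, e2, e3]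
    simp
  have y2 : dY (dY (regLog ρ s)) z = weight ρ z *
        (dY (dY gap) z * (gap z + s)⁻¹ + dY gap z * (-dY gap z / (gap z + s) ^ 2)) := by
    rw [y1, dY_mul hw (isTest_gap.dY.mul hi), dY_mul isTest_gap.dY hi, dY_inv hg h0, e2, e3]
    simp
  have w2 : dY (dY (weight ρ)) z = 0 := by
    rw [e3]; simp [dY]
  rw [regDensity, coeffOne, coeffTwo, lapGap, lOp, lOp, x2, y2, w2, x1, regLog]
  have := h0 z
  field_simp
  ring

theorem coeffOne_strip {ρ : ℝ} {z : Torus P} (hz : |cent z.1| < P / 8) :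
    coeffOne ρ z = weight ρ z * lapGap z := by
  rw [coeffOne, dX_weight_strip hz]
  ring

theorem coeffTwo_strip {ρ : ℝ} {z : Torus P} (hz : |cent z.1| < P / 8) :
    coeffTwo ρ z = weight ρ z * (gap z * lapGap z) := by
  rw [coeffTwo, sq_grad_gap_strip hz]

/-- Near `x = 0` the logarithmic terms cancel. What remains concentrates at the origin as
`s → 0`. -/
theorem regDensity_strip {ρ s : ℝ} (hs : 0 < s) {z : Torus P} (hz : |cent z.1| < P / 8) :
    regDensity ρ s z = weight ρ z * lapGap z * (s / (gap z + s) ^ 2) := by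
  rw [regDensity, lOp_weight_strip hz, coeffOne_strip hz, coeffTwo_strip hz]
  have := gap_add_ne_zero hs z
  field_simp
  ring

theorem regDensity_zero_strip {ρ : ℝ} {z : Torus P} (hz : |cent z.1| < P / 8) :
    regDensity ρ 0 z = 0 := by
  rw [regDensity, lOp_weight_strip hz, coeffOne_strip hz, coeffTwo_strip hz, add_zero]
  by_cases h : gap z = 0
  · simp [h]
  · field_simp
    ring

theorem cent_eq_zero_of_gap {z : Torus P} (h : gap z = 0) : cent z.1 = 0 := by
  rw [(gap_eq_zero_iff z).1 h]
  exact cent_zero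

/-- `L_ρ (regLog ρ 0)` away from the singularity is a smooth function, because it vanishes
identically on a neighbourhood of the origin. -/
theorem isTest_regDensity_zero (ρ : ℝ) : IsTest (regDensity ρ 0 : Torus P → ℝ) := by
  unfold IsTest
  rw [contDiff_iff_contDiffAt]
  intro w
  by_cases h : gap (proj P w) = 0
  · have h1 : ∀ᶠ u in 𝓝 w, |cent (proj P u).1| < P / 8 := by
      refine (isOpen_lt (continuous_abs_cent.comp continuous_proj)
        continuous_const).mem_nhds ?_
      change |cent (proj P w).1| < P / 8
      rw [cent_eq_zero_of_gap h, abs_zero]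
      linarith [hP.out]
    have h2 : (fun u => regDensity ρ 0 (proj P u)) =ᶠ[𝓝 w] fun _ => 0 := by
      filter_upwards [h1] with u hu using regDensity_zero_strip hu
    exact contDiffAt_const.congr_of_eventuallyEq h2
  · have h1 : gap (proj P w) + 0 ≠ 0 := by rwa [add_zero]
    have hg : ContDiffAt ℝ ∞ (fun u => gap (proj P u) + 0) w :=
      ContDiff.contDiffAt (isTest_gap_add 0)
    have hA : ContDiffAt ℝ ∞ (fun u => lOp ρ (weight ρ) (proj P u)) w :=
      ContDiff.contDiffAt ((isTest_weight ρ).lOp ρ)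
    have hB : ContDiffAt ℝ ∞ (fun u => coeffOne ρ (proj P u)) w :=
      ContDiff.contDiffAt (isTest_coeffOne ρ)
    have hD : ContDiffAt ℝ ∞ (fun u => coeffTwo ρ (proj P u)) w :=
      ContDiff.contDiffAt (isTest_coeffTwo ρ)
    exact ((hA.mul (hg.log h1)).add (hB.div hg h1)).sub (hD.div (hg.pow 2) (pow_ne_zero 2 h1))

end Parametrix

/-! ### The distribution `L_ρ (e^{-ρx} log gap)` -/

section Limit

variable {P : ℝ} [hP : Fact (0 < P)]

theorem abs_log_le_add {a g K : ℝ} (ha : 0 < a) (h1 : a ≤ g) (h2 : g ≤ K) :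
    |Real.log g| ≤ |Real.log a| + |Real.log K| := by
  have h3 := Real.log_le_log ha h1
  have h4 := Real.log_le_log (ha.trans_le h1) h2
  rw [abs_le]
  constructor
  · linarith [neg_abs_le (Real.log a), abs_nonneg (Real.log K)]
  · linarith [le_abs_self (Real.log K), abs_nonneg (Real.log a)]

theorem mul_sq_le_two_sub_two_mul_cos {y : ℝ} (hy : |y| ≤ Real.pi) :
    4 / Real.pi ^ 2 * y ^ 2 ≤ 2 - 2 * Real.cos y := by
  have h := Real.cos_le_one_sub_mul_cos_sq hy
  have e : 4 / Real.pi ^ 2 * y ^ 2 = 2 * (2 / Real.pi ^ 2 * y ^ 2) := by ring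
  rw [e]
  linarith

/-- The fundamental rectangle centred at the origin. -/
def box (P : ℝ) : Set (ℝ × ℝ) :=
  Ioc (-(P / 2)) (-(P / 2) + P) ×ˢ Ioc (-Real.pi) (-Real.pi + 2 * Real.pi)

omit hP in
theorem measurableSet_box : MeasurableSet (box P) := measurableSet_Ioc.prod measurableSet_Ioc

theorem measurePreserving_proj_box :
    MeasurePreserving (proj P) (volume.restrict (box P)) volume := by
  have := measurePreserving_proj (P := P) (-(P / 2)) (-Real.pi)
  rw [Measure.prod_restrict] at this
  exact this

omit hP in
theorem abs_le_of_mem_box {w : ℝ × ℝ} (hw : w ∈ box P) : |w.1| ≤ P / 2 ∧ |w.2| ≤ Real.pi := by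
  obtain ⟨⟨h1, h2⟩, h3, h4⟩ := hw
  constructor <;> rw [abs_le] <;> constructor <;> linarith

theorem abs_cent_of_mem_box {w : ℝ × ℝ} (hw : w ∈ box P) :
    |cent (w.1 : AddCircle P)| = |w.1| := by
  rw [abs_cent, AddCircle.norm_coe_eq_abs_iff P hP.out.ne', abs_of_pos hP.out]
  exact (abs_le_of_mem_box hw).1

theorem integral_eq_integral_box {f : Torus P → ℝ} (hf : AEStronglyMeasurable f volume) :
    ∫ z, f z = ∫ w in box P, f (proj P w) := by
  have h := measurePreserving_proj_box (P := P)
  rw [← integral_map h.measurable.aemeasurable (by rwa [h.map_eq]), h.map_eq]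

theorem ae_ne_zero : ∀ᵐ z : Torus P, z ≠ 0 := by
  have h := measurePreserving_proj_box (P := P)
  rw [← h.map_eq, ae_map_iff (p := fun z : Torus P => z ≠ 0) h.measurable.aemeasurable
    (measurableSet_singleton (0 : Torus P)).compl]
  have h1 : ∀ᵐ w : ℝ × ℝ ∂(volume.restrict (box P)), w ≠ 0 :=
    ae_restrict_of_ae (compl_mem_ae_iff.2 (measure_singleton _))
  filter_upwards [h1, ae_restrict_mem measurableSet_box] with w hw hb h0
  have h1 : |w.1| = 0 := by
    rw [← abs_cent_of_mem_box hb, abs_eq_zero, ← cent_zero (P := P)]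
    exact congrArg (fun z : Torus P => cent z.1) h0
  have h2 : |w.2| = 0 := by
    have e1 : ((w.2 : ℝ) : AddCircle (2 * Real.pi)) = 0 :=
      congrArg (fun z : Torus P => z.2) h0
    have e2 := (AddCircle.norm_coe_eq_abs_iff (2 * Real.pi) Real.two_pi_pos.ne' (x := w.2)).2
      (by rw [abs_of_pos Real.two_pi_pos]; linarith [(abs_le_of_mem_box hb).2])
    rw [← e2, e1, norm_zero]
  exact hw (Prod.ext (abs_eq_zero.1 h1) (abs_eq_zero.1 h2))

theorem exists_gap_le (P : ℝ) [Fact (0 < P)] : ∃ K : ℝ, 0 < K ∧ ∀ z : Torus P, gap z ≤ K := by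
  obtain ⟨K, h0, hK⟩ := (isTest_gap (P := P)).exists_bound
  exact ⟨K + 1, by linarith, fun z => by
    have := (le_abs_self _).trans (hK z)
    linarith⟩

theorem measurable_gap : Measurable (gap : Torus P → ℝ) := isTest_gap.continuous.measurable

/-- The logarithmic pole is integrable, by comparison with a product of functions of one
variable. -/
theorem integrable_log_gap : Integrable (fun z : Torus P => Real.log (gap z)) volume := by
  obtain ⟨K, hK0, hK⟩ := exists_gap_le P
  have hmeas : AEStronglyMeasurable (fun z : Torus P => Real.log (gap z)) volume :=
    (Real.measurable_log.comp measurable_gap).aestronglyMeasurable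
  rw [← measurePreserving_proj_box.integrable_comp hmeas]
  have h1 : Integrable (fun y : ℝ => |Real.log (4 / Real.pi ^ 2) + 2 * Real.log y| + |Real.log K|)
      (volume.restrict (Ioc (-Real.pi) (-Real.pi + 2 * Real.pi))) := by
    have h2 : IntervalIntegrable Real.log volume (-Real.pi) (-Real.pi + 2 * Real.pi) :=
      intervalIntegral.intervalIntegrable_log'
    have h3 : Integrable Real.log (volume.restrict (Ioc (-Real.pi) (-Real.pi + 2 * Real.pi))) :=
      (intervalIntegrable_iff_integrableOn_Ioc_of_le (by linarith [Real.pi_pos])).1 h2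
    exact (((integrable_const _).add (h3.const_mul 2)).abs).add (integrable_const _)
  have h2 := h1.comp_snd (volume.restrict (Ioc (-(P / 2)) (-(P / 2) + P)))
  rw [Measure.prod_restrict] at h2
  refine Integrable.mono' h2 (hmeas.comp_measurePreserving measurePreserving_proj_box) ?_
  have hne : ∀ᵐ w : ℝ × ℝ, w.2 ≠ 0 :=
    Measure.quasiMeasurePreserving_snd.ae (compl_mem_ae_iff.2 (measure_singleton (0 : ℝ)))
  filter_upwards [ae_restrict_mem measurableSet_box, ae_restrict_of_ae hne] with w hw hy
  change ‖Real.log (gap (proj P w))‖ ≤ _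
  have hy2 : 0 < w.2 ^ 2 := by positivity
  have h3 : 4 / Real.pi ^ 2 * w.2 ^ 2 ≤ gap (proj P w) :=
    (mul_sq_le_two_sub_two_mul_cos (abs_le_of_mem_box hw).2).trans
      (two_sub_two_mul_cos_le_gap w)
  have hpi : (0 : ℝ) < 4 / Real.pi ^ 2 := by positivity
  have h4 := abs_log_le_add (mul_pos hpi hy2) h3 (hK (proj P w))
  rw [Real.log_mul hpi.ne' hy2.ne', Real.log_pow] at h4
  exact_mod_cast h4

theorem tendsto_integral_regLog (ρ : ℝ) {ψ : Torus P → ℝ} (hψ : IsTest ψ) :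
    Tendsto (fun s => ∫ z, regLog ρ s z * ψ z) (𝓝[>] 0) (𝓝 (∫ z, regLog ρ 0 z * ψ z)) := by
  obtain ⟨K, hK0, hK⟩ := exists_gap_le P
  obtain ⟨C, hC0, hC⟩ := ((isTest_weight (P := P) ρ).mul hψ).exists_bound
  have hmeas : ∀ s, AEStronglyMeasurable (fun z : Torus P => regLog ρ s z * ψ z) volume := by
    intro s
    exact (((isTest_weight ρ).continuous.measurable.mul
      (Real.measurable_log.comp (measurable_gap.add_const s))).mul
      hψ.continuous.measurable).aestronglyMeasurable
  refine tendsto_integral_filter_of_dominated_convergence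
    (fun z => C * (|Real.log (gap z)| + |Real.log (K + 1)|)) (.of_forall hmeas) ?_ ?_ ?_
  · have : ∀ᶠ s : ℝ in 𝓝[>] 0, s ∈ Ioo (0 : ℝ) 1 := Ioo_mem_nhdsGT one_pos
    filter_upwards [this] with s hs
    filter_upwards [ae_ne_zero] with z hz
    have h1 : regLog ρ s z * ψ z = weight ρ z * ψ z * Real.log (gap z + s) := by
      rw [regLog]; ring
    rw [h1, norm_mul]
    refine mul_le_mul (hC z) ?_ (norm_nonneg _) hC0
    exact abs_log_le_add (gap_pos hz) (by linarith [hs.1]) (by linarith [hK z, hs.2])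
  · exact (((integrable_log_gap.abs).add (integrable_const _))).const_mul C
  · filter_upwards [ae_ne_zero] with z hz
    have h1 : Tendsto (fun s : ℝ => gap z + s) (𝓝[>] 0) (𝓝 (gap z + 0)) :=
      (tendsto_const_nhds.add tendsto_id).mono_left nhdsWithin_le_nhds
    have h2 : gap z + 0 ≠ 0 := by rw [add_zero]; exact (gap_pos hz).ne'
    exact (tendsto_const_nhds.mul (h1.log h2)).mul_const _

/-- The strip around `x = 0` on which the explicit formulas hold. -/
def strip (P : ℝ) [Fact (0 < P)] : Set (Torus P) := {z | |cent z.1| < P / 8}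

theorem isOpen_strip : IsOpen (strip P) := isOpen_lt continuous_abs_cent continuous_const

theorem exists_le_gap_compl_strip (P : ℝ) [hP : Fact (0 < P)] :
    ∃ η : ℝ, 0 < η ∧ ∀ z ∈ (strip P)ᶜ, η ≤ gap z := by
  have hp := hP.out
  refine ⟨min 1 ((P / 8) ^ 2), by positivity, fun z hz => le_trans ?_ (min_le_gap z)⟩
  have hz' : P / 8 ≤ |cent z.1| := not_lt.1 hz
  refine min_le_min_left _ ?_
  rw [← sq_abs (cent z.1)]
  gcongr

/-- Off the strip `gap` is bounded below, and the regularization is harmless. -/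
theorem tendsto_integral_compl_strip (ρ : ℝ) {φ : Torus P → ℝ} (hφ : IsTest φ) :
    Tendsto (fun s => ∫ z in (strip P)ᶜ, regDensity ρ s z * φ z) (𝓝[>] 0)
      (𝓝 (∫ z in (strip P)ᶜ, regDensity ρ 0 z * φ z)) := by
  obtain ⟨K, hK0, hK⟩ := exists_gap_le P
  obtain ⟨η, hη0, hη⟩ := exists_le_gap_compl_strip P
  obtain ⟨CA, hA0, hA⟩ := ((isTest_weight (P := P) ρ).lOp ρ).exists_bound
  obtain ⟨CB, hB0, hB⟩ := (isTest_coeffOne (P := P) ρ).exists_bound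
  obtain ⟨CD, hD0, hD⟩ := (isTest_coeffTwo (P := P) ρ).exists_bound
  obtain ⟨Cφ, hφ0, hφb⟩ := hφ.exists_bound
  have hmeas : ∀ s, Measurable (fun z : Torus P => regDensity ρ s z * φ z) := by
    intro s
    have hg := measurable_gap (P := P).add_const s
    exact ((((((isTest_weight ρ).lOp ρ).continuous.measurable.mul
      (Real.measurable_log.comp hg)).add
      ((isTest_coeffOne ρ).continuous.measurable.div hg)).sub
      ((isTest_coeffTwo ρ).continuous.measurable.div (hg.pow_const 2)))).mul
      hφ.continuous.measurable
  refine tendsto_integral_filter_of_dominated_convergence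
    (fun _ => (CA * (|Real.log η| + |Real.log (K + 1)|) + CB / η + CD / η ^ 2) * Cφ)
    (.of_forall fun s => (hmeas s).aestronglyMeasurable) ?_ (integrable_const _) ?_
  · have : ∀ᶠ s : ℝ in 𝓝[>] 0, s ∈ Ioo (0 : ℝ) 1 := Ioo_mem_nhdsGT one_pos
    filter_upwards [this] with s hs
    filter_upwards [ae_restrict_mem isOpen_strip.measurableSet.compl] with z hz
    have h1 : η ≤ gap z + s := by linarith [hη z hz, hs.1]
    have h2 : 0 < gap z + s := by linarith
    rw [norm_mul]
    refine mul_le_mul ?_ (hφb z) (norm_nonneg _) (by positivity)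
    rw [regDensity]
    refine (norm_sub_le _ _).trans (add_le_add ((norm_add_le _ _).trans (add_le_add ?_ ?_)) ?_)
    · rw [norm_mul]
      exact mul_le_mul (hA z) (abs_log_le_add hη0 h1 (by linarith [hK z, hs.2]))
        (norm_nonneg _) hA0
    · rw [norm_div, Real.norm_of_nonneg h2.le]
      exact div_le_div₀ hB0 (hB z) hη0 h1
    · rw [norm_div, Real.norm_of_nonneg (by positivity : 0 ≤ (gap z + s) ^ 2)]
      exact div_le_div₀ hD0 (hD z) (by positivity) (by gcongr)
  · filter_upwards [ae_restrict_mem isOpen_strip.measurableSet.compl] with z hz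
    have h1 : Tendsto (fun s : ℝ => gap z + s) (𝓝[>] 0) (𝓝 (gap z + 0)) :=
      (tendsto_const_nhds.add tendsto_id).mono_left nhdsWithin_le_nhds
    have h2 : gap z + 0 ≠ 0 := by rw [add_zero]; exact (hη0.trans_le (hη z hz)).ne'
    exact (((tendsto_const_nhds.mul (h1.log h2)).add (tendsto_const_nhds.div h1 h2)).sub
      (tendsto_const_nhds.div (h1.pow 2) (pow_ne_zero 2 h2))).mul_const _

/-! ### The point mass at the origin -/

/-- The limiting profile of the rescaled density. -/
noncomputable def bubble (u : ℝ × ℝ) : ℝ := ((u.1 ^ 2 + u.2 ^ 2 + 1) ^ 2)⁻¹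

theorem bubble_pos (u : ℝ × ℝ) : 0 < bubble u := by unfold bubble; positivity

theorem integrable_bubble : Integrable bubble volume := by
  have h := integrable_inv_one_add_sq.mul_prod integrable_inv_one_add_sq
  refine Integrable.mono' h ?_ (.of_forall fun u => ?_)
  · unfold bubble
    exact (Measurable.inv (by fun_prop)).aestronglyMeasurable
  · rw [Real.norm_of_nonneg (bubble_pos u).le, ← mul_inv]
    unfold bubble
    apply inv_anti₀ (by positivity)
    nlinarith [sq_nonneg u.1, sq_nonneg u.2, mul_nonneg (sq_nonneg u.1) (sq_nonneg u.2)]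

/-- The mass of the point mass of `L_ρ (e^{-ρx} log gap)` at the origin. -/
noncomputable def poleMass : ℝ := ∫ u : ℝ × ℝ, 4 * bubble u

theorem poleMass_pos : 0 < poleMass := by
  unfold poleMass
  rw [integral_pos_iff_support_of_nonneg
    (fun u => mul_nonneg (by norm_num) (bubble_pos u).le) (integrable_bubble.const_mul 4)]
  have : Function.support (fun u => 4 * bubble u) = univ := by
    ext u
    simp [(bubble_pos u).ne']
  rw [this]
  exact Measure.measure_univ_pos.2 (NeZero.ne _)

/-- The part of the fundamental rectangle over the strip. -/
def stripBox (P : ℝ) : Set (ℝ × ℝ) := Ioo (-(P / 8)) (P / 8) ×ˢ Ioc (-Real.pi) Real.pi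

omit hP in
theorem measurableSet_stripBox : MeasurableSet (stripBox P) :=
  measurableSet_Ioo.prod measurableSet_Ioc

theorem setIntegral_strip_eq {f : Torus P → ℝ} (hf : Measurable f) :
    ∫ z in strip P, f z = ∫ w, (stripBox P).indicator (fun w => f (proj P w)) w := by
  have hp := hP.out
  rw [← integral_indicator isOpen_strip.measurableSet,
    integral_eq_integral_box (hf.indicator isOpen_strip.measurableSet).aestronglyMeasurable,
    ← integral_indicator measurableSet_box]
  congr 1
  funext w
  by_cases hw : w ∈ box P
  · rw [indicator_of_mem hw]
    have h1 : proj P w ∈ strip P ↔ |w.1| < P / 8 := by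
      rw [← abs_cent_of_mem_box hw]
      rfl
    have h2 : w ∈ stripBox P ↔ |w.1| < P / 8 := by
      rw [abs_lt]
      refine ⟨fun h => h.1, fun h => ⟨h, hw.2.1, ?_⟩⟩
      have := hw.2.2
      linarith
    by_cases h3 : |w.1| < P / 8
    · rw [indicator_of_mem (h1.2 h3), indicator_of_mem (h2.2 h3)]
    · rw [indicator_of_notMem (h3 ∘ h1.1), indicator_of_notMem (h3 ∘ h2.1)]
  · have h2 : w ∉ stripBox P := by
      rintro ⟨⟨h1, h2⟩, h3, h4⟩
      exact hw ⟨⟨by linarith, by linarith⟩, h3, by linarith⟩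
    rw [indicator_of_notMem hw, indicator_of_notMem h2]

theorem le_gap_of_mem_stripBox {w : ℝ × ℝ} (hw : w ∈ stripBox P) :
    4 / Real.pi ^ 2 * (w.1 ^ 2 + w.2 ^ 2) ≤ gap (proj P w) := by
  obtain ⟨h1, h2, h3⟩ := hw
  have hp := hP.out
  have h4 : |w.1| < P / 8 := abs_lt.2 h1
  have h5 : cent (w.1 : AddCircle P) = w.1 := cent_coe_of_abs_lt (by linarith)
  rw [gap_strip (by rwa [h5]), h5]
  have h6 := sq_le_two_mul_cosh_sub_two w.1
  have h7 := mul_sq_le_two_sub_two_mul_cos (y := w.2) (abs_le.2 ⟨h2.le, h3⟩)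
  have h8 : 4 / Real.pi ^ 2 ≤ 1 := by
    rw [div_le_one (by positivity)]
    nlinarith [Real.pi_gt_three]
  nlinarith [mul_le_mul_of_nonneg_right h8 (sq_nonneg w.1)]

theorem tendsto_gap_div_sq (u : ℝ × ℝ) :
    Tendsto (fun ε : ℝ => gap (proj P (ε • u)) / ε ^ 2) (𝓝[>] 0) (𝓝 (u.1 ^ 2 + u.2 ^ 2)) := by
  have hp := hP.out
  have h1 : HasDerivAt (fun ε : ℝ => 2 * Real.sinh (ε * (u.1 / 2))) u.1 0 := by
    have := (((hasDerivAt_id (0 : ℝ)).mul_const (u.1 / 2)).sinh).const_mul 2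
    refine this.congr_deriv ?_
    simp
    ring
  have h2 : HasDerivAt (fun ε : ℝ => 2 * Real.sin (ε * (u.2 / 2))) u.2 0 := by
    have := (((hasDerivAt_id (0 : ℝ)).mul_const (u.2 / 2)).sin).const_mul 2
    refine this.congr_deriv ?_
    simp
    ring
  have h3 := ((h1.tendsto_slope_zero_right.pow 2).add (h2.tendsto_slope_zero_right.pow 2))
  refine h3.congr' ?_
  have h4 : ∀ᶠ ε : ℝ in 𝓝[>] 0, |ε * u.1| < P / 8 := by
    refine nhdsWithin_le_nhds ((isOpen_lt (by fun_prop) continuous_const).mem_nhds ?_)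
    simpa using hp
  filter_upwards [h4] with ε hε
  have h5 : cent (((ε • u).1 : ℝ) : AddCircle P) = ε * u.1 :=
    cent_coe_of_abs_lt (by change |ε * u.1| < _; linarith)
  have h6 : Real.cosh (ε * u.1) = 1 + 2 * Real.sinh (ε * (u.1 / 2)) ^ 2 := by
    have := Real.cosh_two_mul (ε * (u.1 / 2))
    rw [show 2 * (ε * (u.1 / 2)) = ε * u.1 by ring, Real.cosh_sq] at this
    linarith
  have h7 : Real.cos (ε * u.2) = 1 - 2 * Real.sin (ε * (u.2 / 2)) ^ 2 := by
    have := Real.cos_two_mul' (ε * (u.2 / 2))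
    rw [show 2 * (ε * (u.2 / 2)) = ε * u.2 by ring, Real.cos_sq'] at this
    linarith
  rw [gap_strip (by rwa [h5]), h5]
  change _ = (2 * Real.cosh (ε * u.1) - 2 * Real.cos (ε * u.2)) / ε ^ 2
  rw [h6, h7]
  simp only [zero_add, zero_mul, Real.sinh_zero, Real.sin_zero, mul_zero, sub_zero, smul_eq_mul]
  generalize Real.sinh (ε * (u.1 / 2)) = a
  generalize Real.sin (ε * (u.2 / 2)) = b
  rw [div_eq_mul_inv]
  ring

/-- The singular part of the integral: with `s = ε²` and after rescaling by `ε`, the density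
converges to a multiple of `bubble`, and it is dominated by one because `gap` is bounded below by a
multiple of `x² + y²`. -/
theorem tendsto_integral_strip (ρ : ℝ) {φ : Torus P → ℝ} (hφ : IsTest φ) :
    Tendsto (fun ε : ℝ => ∫ z in strip P, regDensity ρ (ε ^ 2) z * φ z) (𝓝[>] 0)
      (𝓝 (poleMass * φ 0)) := by
  have hp := hP.out
  set A : Torus P → ℝ := fun z => weight ρ z * lapGap z * φ z with hA
  have hAt : IsTest A := ((isTest_weight ρ).mul isTest_lapGap).mul hφ
  have hA0 : A 0 = 4 * φ 0 := by
    have h0 : |cent (0 : Torus P).1| < P / 8 := by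
      rw [Prod.fst_zero, cent_zero, abs_zero]; linarith
    have h1 : lapGap (0 : Torus P) = 4 := by
      have := lapGap_strip (P := P) (w := (0, 0)) (by simpa [cent_zero] using hp)
      rw [proj_mk_zero] at this
      rw [this]
      simp [cent_zero]
      norm_num
    simp only [hA, weight_strip h0, h1, Prod.fst_zero, cent_zero, mul_zero, Real.exp_zero, one_mul]
  obtain ⟨M, hM0, hM⟩ := hAt.exists_bound
  have hpos : ∀ᶠ ε : ℝ in 𝓝[>] 0, 0 < ε := self_mem_nhdsWithin
  set H : ℝ → ℝ × ℝ → ℝ := fun ε => (stripBox P).indicator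
    (fun w => A (proj P w) * (ε ^ 2 / (gap (proj P w) + ε ^ 2) ^ 2)) with hH
  have hHmeas : ∀ ε, Measurable (H ε) := by
    intro ε
    have h1 := hAt.continuous.measurable.comp (continuous_proj (P := P)).measurable
    have h2 := (measurable_gap.comp (continuous_proj (P := P)).measurable).add_const (ε ^ 2)
    exact (h1.mul (measurable_const.div (h2.pow_const 2))).indicator measurableSet_stripBox
  -- the substitution `w = ε u` has Jacobian `ε ^ 2`
  have key : ∀ᶠ ε : ℝ in 𝓝[>] 0, ∫ u, ε ^ 2 * H ε (ε • u) =
      ∫ z in strip P, regDensity ρ (ε ^ 2) z * φ z := by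
    filter_upwards [hpos] with ε hε
    rw [integral_const_mul, Measure.integral_comp_smul_of_nonneg volume (H ε) ε (hR := hε.le)]
    have hf : Module.finrank ℝ (ℝ × ℝ) = 2 := by simp
    have e1 : ∫ z in strip P, regDensity ρ (ε ^ 2) z * φ z =
        ∫ z in strip P, A z * (ε ^ 2 / (gap z + ε ^ 2) ^ 2) := by
      refine setIntegral_congr_fun isOpen_strip.measurableSet fun z hz => ?_
      simp only [hA]
      rw [regDensity_strip (by positivity) hz]
      ring
    have hmeas : Measurable fun z : Torus P => A z * (ε ^ 2 / (gap z + ε ^ 2) ^ 2) :=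
      hAt.continuous.measurable.mul
        (measurable_const.div ((measurable_gap.add_const _).pow_const 2))
    rw [e1, setIntegral_strip_eq hmeas, hf, smul_eq_mul, ← mul_assoc,
      mul_inv_cancel₀ (by positivity), one_mul]
  refine Tendsto.congr' key ?_
  have hlim : poleMass * φ 0 = ∫ u, A 0 * bubble u := by
    rw [integral_const_mul, hA0, poleMass, integral_const_mul]
    ring
  rw [hlim]
  set q : ℝ := 4 / Real.pi ^ 2 with hq
  have hq0 : 0 < q := by positivity
  have hq1 : q ≤ 1 := by
    rw [hq, div_le_one (by positivity)]
    nlinarith [Real.pi_gt_three]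
  have hscale : ∀ ε : ℝ, 0 < ε → ∀ g : ℝ, ε ^ 2 * (ε ^ 2 / (g + ε ^ 2) ^ 2) =
      ((g / ε ^ 2 + 1) ^ 2)⁻¹ := by
    intro ε hε g
    field_simp
  refine tendsto_integral_filter_of_dominated_convergence
    (fun u => M * (q ^ 2)⁻¹ * bubble u) ?_ ?_ (integrable_bubble.const_mul _) ?_
  · refine .of_forall fun ε => ?_
    exact (((hHmeas ε).comp (measurable_const_smul ε)).const_mul _).aestronglyMeasurable
  · filter_upwards [hpos] with ε hε
    refine .of_forall fun u => ?_
    by_cases hu : ε • u ∈ stripBox P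
    · simp only [hH, indicator_of_mem hu]
      rw [mul_left_comm, hscale ε hε, norm_mul, mul_assoc]
      refine mul_le_mul (hM _) ?_ (norm_nonneg _) hM0
      have h1 : q * (u.1 ^ 2 + u.2 ^ 2) ≤ gap (proj P (ε • u)) / ε ^ 2 := by
        rw [le_div_iff₀ (by positivity)]
        refine le_trans (le_of_eq ?_) (le_gap_of_mem_stripBox hu)
        change _ = q * ((ε * u.1) ^ 2 + (ε * u.2) ^ 2)
        ring
      rw [Real.norm_of_nonneg (by positivity), bubble, ← mul_inv, ← mul_pow]
      have h2 : q * (u.1 ^ 2 + u.2 ^ 2 + 1) ≤ gap (proj P (ε • u)) / ε ^ 2 + 1 := by linarith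
      apply inv_anti₀ (by positivity)
      gcongr
    · simp only [hH, indicator_of_notMem hu, mul_zero, norm_zero]
      have := bubble_pos u
      positivity
  · refine .of_forall fun u => ?_
    have h1 : ∀ᶠ ε : ℝ in 𝓝[>] 0, ε • u ∈ stripBox P := by
      have h2 : Tendsto (fun ε : ℝ => ε • u) (𝓝[>] 0) (𝓝 0) := by
        have : Tendsto (fun ε : ℝ => ε • u) (𝓝 0) (𝓝 ((0 : ℝ) • u)) :=
          (continuous_id.smul continuous_const).tendsto 0
        rw [zero_smul] at this
        exact this.mono_left nhdsWithin_le_nhds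
      refine h2 (prod_mem_nhds (Ioo_mem_nhds ?_ ?_) (Ioc_mem_nhds ?_ ?_)) <;>
        simp [hp, Real.pi_pos]
    have h3 : Tendsto (fun ε : ℝ => A (proj P (ε • u)) *
        ((gap (proj P (ε • u)) / ε ^ 2 + 1) ^ 2)⁻¹) (𝓝[>] 0) (𝓝 (A 0 * bubble u)) := by
      have h4 : Tendsto (fun ε : ℝ => A (proj P (ε • u))) (𝓝[>] 0) (𝓝 (A 0)) := by
        have : Continuous fun ε : ℝ => A (proj P (ε • u)) :=
          hAt.continuous.comp (continuous_proj.comp (continuous_id.smul continuous_const))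
        have := this.tendsto 0
        rw [zero_smul, proj_zero] at this
        exact this.mono_left nhdsWithin_le_nhds
      refine h4.mul (Tendsto.inv₀ (((tendsto_gap_div_sq u).add_const 1).pow 2) ?_)
      positivity
    refine h3.congr' ?_
    filter_upwards [h1, hpos] with ε hε h0
    simp only [hH, indicator_of_mem hε]
    rw [mul_left_comm, hscale ε h0]

/-- In the sense of distributions, `L_ρ (e^{-ρx} log gap)` is a positive multiple of the point
mass at the origin plus a smooth function. -/
theorem integral_regLog_mul_lOp (ρ : ℝ) {φ : Torus P → ℝ} (hφ : IsTest φ) :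
    ∫ z, regLog ρ 0 z * lOp (-ρ) φ z = poleMass * φ 0 + ∫ z, regDensity ρ 0 z * φ z := by
  have hsq : Tendsto (fun ε : ℝ => ε ^ 2) (𝓝[>] 0) (𝓝[>] 0) := by
    refine tendsto_nhdsWithin_iff.2 ⟨?_, ?_⟩
    · have : Tendsto (fun ε : ℝ => ε ^ 2) (𝓝 0) (𝓝 (0 ^ 2)) := (continuous_pow 2).tendsto 0
      rw [zero_pow two_ne_zero] at this
      exact this.mono_left nhdsWithin_le_nhds
    · filter_upwards [self_mem_nhdsWithin] with ε hε
      exact pow_pos (mem_Ioi.1 hε) 2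
  have h1 := (tendsto_integral_regLog ρ (hφ.lOp (-ρ))).comp hsq
  have h2 := (tendsto_integral_strip ρ hφ).add ((tendsto_integral_compl_strip ρ hφ).comp hsq)
  have h3 : ∫ z, regDensity ρ 0 z * φ z = ∫ z in (strip P)ᶜ, regDensity ρ 0 z * φ z := by
    rw [← integral_add_compl isOpen_strip.measurableSet
      (((isTest_regDensity_zero ρ).mul hφ).integrable volume)]
    have : ∫ z in strip P, regDensity ρ 0 z * φ z = 0 := by
      rw [setIntegral_congr_fun (g := fun _ => 0) isOpen_strip.measurableSet]
      · simp
      · intro z hz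
        simp only
        rw [regDensity_zero_strip hz, zero_mul]
    rw [this, zero_add]
  rw [h3]
  -- for `s > 0` the regularized parametrix is smooth and the adjoint relation applies; both sides
  -- are followed to the limit `s = ε ^ 2 → 0`
  refine tendsto_nhds_unique (h1.congr' ?_) h2
  filter_upwards [self_mem_nhdsWithin] with ε hε
  have hε2 : (0 : ℝ) < ε ^ 2 := pow_pos (mem_Ioi.1 hε) 2
  have e : (lOp ρ (regLog ρ (ε ^ 2)) : Torus P → ℝ) = regDensity ρ (ε ^ 2) :=
    funext (lOp_regLog ρ hε2)
  have hint : Integrable (fun z => regDensity ρ (ε ^ 2) z * φ z) volume := by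
    rw [← e]
    exact (((isTest_regLog ρ hε2).lOp ρ).mul hφ).integrable volume
  simp only [Function.comp_apply]
  rw [integral_add_compl isOpen_strip.measurableSet hint,
    integral_mul_lOp (isTest_regLog ρ hε2) hφ, e]

end Limit

/-! ### Existence of kernels -/

section Kernel

variable {P : ℝ} [hP : Fact (0 < P)]

/-- The real part of the kernel: a multiple of `e^{-ρx} log gap` plus a smooth correction. -/
noncomputable def kernelReal (ρ : ℝ) (h : Torus P → ℝ) (z : Torus P) : ℝ :=
  regLog ρ 0 z / poleMass + h z

open Classical in
/-- The extended-real-valued kernel, with the value `-∞` at the origin. -/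
noncomputable def kernelE (ρ : ℝ) (h : Torus P → ℝ) (z : Torus P) : EReal :=
  if z = 0 then ⊥ else (kernelReal ρ h z : EReal)

theorem kernelE_zero (ρ : ℝ) (h : Torus P → ℝ) : kernelE ρ h 0 = ⊥ := by simp [kernelE]

theorem kernelE_of_ne (ρ : ℝ) (h : Torus P → ℝ) {z : Torus P} (hz : z ≠ 0) :
    kernelE ρ h z = (kernelReal ρ h z : EReal) := by simp [kernelE, hz]

theorem toReal_kernelE_ae (ρ : ℝ) (h : Torus P → ℝ) :
    (fun z => (kernelE ρ h z).toReal) =ᵐ[volume] kernelReal ρ h := by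
  filter_upwards [ae_ne_zero] with z hz
  rw [kernelE_of_ne ρ h hz, EReal.toReal_coe]

omit hP in
theorem isOpen_ne_zero : IsOpen {w : ℝ × ℝ | proj P w ≠ 0} :=
  (isOpen_compl_singleton (x := (0 : Torus P))).preimage continuous_proj

theorem contDiffAt_kernelReal (ρ : ℝ) {h : Torus P → ℝ} (hh : IsTest h) {w : ℝ × ℝ}
    (hw : proj P w ≠ 0) : ContDiffAt ℝ ∞ (fun w => kernelReal ρ h (proj P w)) w := by
  have hg : ContDiffAt ℝ ∞ (fun u => gap (proj P u) + 0) w :=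
    ContDiff.contDiffAt (isTest_gap_add 0)
  have h1 : gap (proj P w) + 0 ≠ 0 := by rw [add_zero]; exact (gap_pos hw).ne'
  have hW : ContDiffAt ℝ ∞ (fun u => weight ρ (proj P u)) w :=
    ContDiff.contDiffAt (isTest_weight ρ)
  exact ((hW.mul (hg.log h1)).div_const _).add (ContDiff.contDiffAt hh)

theorem continuousAt_kernelReal (ρ : ℝ) {h : Torus P → ℝ} (hh : IsTest h) {z : Torus P}
    (hz : z ≠ 0) : ContinuousAt (kernelReal ρ h) z := by
  have hg : ContinuousAt (fun u : Torus P => gap u + 0) z :=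
    (isTest_gap_add 0).continuous.continuousAt
  have h1 : gap z + 0 ≠ 0 := by rw [add_zero]; exact (gap_pos hz).ne'
  exact (((isTest_weight ρ).continuous.continuousAt.mul (hg.log h1)).div_const _).add
    hh.continuous.continuousAt

theorem tendsto_log_gap : Tendsto (fun z : Torus P => Real.log (gap z)) (𝓝[≠] 0) atBot := by
  refine Real.tendsto_log_nhdsGT_zero.comp (tendsto_nhdsWithin_iff.2 ⟨?_, ?_⟩)
  · have := (isTest_gap (P := P)).continuous.tendsto 0
    rw [(gap_eq_zero_iff 0).2 rfl] at this
    exact this.mono_left nhdsWithin_le_nhds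
  · filter_upwards [self_mem_nhdsWithin] with z hz using gap_pos hz

theorem weight_zero (ρ : ℝ) : weight ρ (0 : Torus P) = 1 := by
  have h0 : |cent (0 : Torus P).1| < P / 8 := by
    rw [Prod.fst_zero, cent_zero, abs_zero]; linarith [hP.out]
  rw [weight_strip h0, Prod.fst_zero, cent_zero, mul_zero, Real.exp_zero]

theorem tendsto_kernelReal (ρ : ℝ) {h : Torus P → ℝ} (hh : IsTest h) :
    Tendsto (kernelReal ρ h) (𝓝[≠] 0) atBot := by
  have h1 : Tendsto (fun z : Torus P => weight ρ z / poleMass) (𝓝[≠] 0) (𝓝 (1 / poleMass)) := by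
    have := ((isTest_weight (P := P) ρ).continuous.tendsto 0).div_const poleMass
    rw [weight_zero] at this
    exact this.mono_left nhdsWithin_le_nhds
  have h2 := h1.pos_mul_atBot (one_div_pos.2 poleMass_pos) (tendsto_log_gap (P := P))
  have h3 : Tendsto h (𝓝[≠] 0) (𝓝 (h 0)) :=
    (hh.continuous.tendsto 0).mono_left nhdsWithin_le_nhds
  refine (h2.atBot_add h3).congr fun z => ?_
  rw [kernelReal, regLog, add_zero]
  ring

theorem continuous_kernelE (ρ : ℝ) {h : Torus P → ℝ} (hh : IsTest h) :
    Continuous (kernelE ρ h) := by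
  rw [continuous_iff_continuousAt]
  intro z
  by_cases hz : z = 0
  · subst hz
    rw [ContinuousAt, kernelE_zero, EReal.tendsto_nhds_bot_iff_real]
    intro x
    have h1 := (tendsto_kernelReal ρ hh).eventually (eventually_lt_atBot x)
    rw [eventually_nhdsWithin_iff] at h1
    filter_upwards [h1] with z hz
    by_cases h0 : z = 0
    · rw [h0, kernelE_zero]; exact EReal.bot_lt_coe x
    · rw [kernelE_of_ne ρ h h0]
      exact EReal.coe_lt_coe_iff.2 (hz h0)
  · have h1 : kernelE ρ h =ᶠ[𝓝 z] fun z => (kernelReal ρ h z : EReal) := by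
      filter_upwards [isOpen_compl_singleton.mem_nhds hz] with u hu using kernelE_of_ne ρ h hu
    exact (continuous_coe_real_ereal.continuousAt.comp
      (continuousAt_kernelReal ρ hh hz)).congr h1.symm

theorem integrable_regLog_zero (ρ : ℝ) : Integrable (regLog ρ 0 : Torus P → ℝ) volume := by
  obtain ⟨C, -, hC⟩ := (isTest_weight (P := P) ρ).exists_bound
  have := (integrable_log_gap (P := P)).bdd_mul (c := C)
    (isTest_weight ρ).continuous.aestronglyMeasurable (.of_forall hC)
  have e : (regLog ρ 0 : Torus P → ℝ) = fun z => weight ρ z * Real.log (gap z) := by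
    funext z
    rw [regLog, add_zero]
  rwa [e]

theorem integrable_kernelReal (ρ : ℝ) {h : Torus P → ℝ} (hh : IsTest h) :
    Integrable (kernelReal ρ h) volume :=
  ((integrable_regLog_zero ρ).div_const _).add (hh.integrable _)

theorem IsTest.integrable_mul {φ f : Torus P → ℝ} (hφ : IsTest φ) (hf : Integrable f volume) :
    Integrable (fun z => f z * φ z) volume := by
  obtain ⟨C, -, hC⟩ := hφ.exists_bound
  exact hf.mul_bdd (c := C) hφ.continuous.aestronglyMeasurable (.of_forall hC)

/-- If `κ` carries the resonant Fourier modes of the point mass, a suitable smooth correction turns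
the logarithmic parametrix into a solution of `L_ρ E = δ₀ - κ`. -/
theorem exists_isKernel (ρ : ℝ) {κ : Torus P → ℝ} (hκ : IsTest κ)
    (hres : ∀ m k, symb P ρ m k = 0 → coeffT κ m k = 1) :
    ∃ h : Torus P → ℝ, IsTest h ∧ IsKernel P ρ κ (kernelE ρ h) := by
  have hc := poleMass_pos
  set G : Torus P → ℝ := fun z => (-1 / poleMass) * regDensity ρ 0 z - κ z with hGdef
  have hD := isTest_regDensity_zero (P := P) ρ
  have hG : IsTest G := (hD.const_mul _).sub hκ
  -- testing the parametrix identity with a resonant character, which `L_{-ρ}` annihilates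
  have horth : ∀ m k, symb P ρ m k = 0 → coeffT G m k = 0 := by
    intro m k h0
    have key : ∀ b : ℂ, (b * coeffT G m k).re = 0 := by
      intro b
      have h1 := integral_regLog_mul_lOp ρ (isTest_trig (P := P) b m k)
      have h2 : ∀ z : Torus P, lOp (-ρ) (trig b m k) z = 0 := by
        intro z; rw [lOp_trig, h0]; simp [trig]
      simp only [h2, mul_zero, integral_zero] at h1
      have h3 : trig b m k (0 : Torus P) = b.re := by simp [trig, expT_zero]
      rw [h3] at h1
      rw [← integral_mul_trig (hG.integrable _)]
      simp only [hGdef, sub_mul, mul_assoc]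
      rw [integral_sub (((hD.mul (isTest_trig b m k)).const_mul _).integrable _)
        ((hκ.mul (isTest_trig b m k)).integrable _), integral_const_mul,
        integral_mul_trig (hκ.integrable _), hres m k h0, mul_one]
      have h4 : ∫ z : Torus P, regDensity ρ 0 z * trig b m k z = -(poleMass * b.re) := by linarith
      rw [h4]
      field_simp
      ring
    apply Complex.ext
    · simpa using key 1
    · simpa using key (-Complex.I)
  obtain ⟨h, hh, hsol⟩ := exists_isTest_lOp_eq ρ hG horth
  refine ⟨h, hh, continuous_kernelE ρ hh, ?_, ?_, ?_, ?_, ?_⟩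
  · intro z
    by_cases hz : z = 0
    · simp [hz, kernelE_zero]
    · rw [kernelE_of_ne ρ h hz]; exact EReal.coe_ne_top _
  · intro z
    by_cases hz : z = 0
    · simp [hz, kernelE_zero]
    · rw [kernelE_of_ne ρ h hz]
      simp [hz]
  · intro w hw
    have h1 : (fun w => (kernelE ρ h (proj P w)).toReal) =ᶠ[𝓝 w]
        fun w => kernelReal ρ h (proj P w) := by
      filter_upwards [isOpen_ne_zero.mem_nhds hw] with u hu
      rw [kernelE_of_ne ρ h hu, EReal.toReal_coe]
    exact ((contDiffAt_kernelReal ρ hh hw).congr_of_eventuallyEq h1).contDiffWithinAt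
  · exact (integrable_kernelReal ρ hh).congr (toReal_kernelE_ae ρ h).symm
  · intro φ hφ
    have h1 : ∫ z, (kernelE ρ h z).toReal * lOp (-ρ) φ z =
        ∫ z, (poleMass⁻¹ * (regLog ρ 0 z * lOp (-ρ) φ z) + h z * lOp (-ρ) φ z) := by
      refine integral_congr_ae ?_
      filter_upwards [toReal_kernelE_ae ρ h] with z hz
      rw [hz, kernelReal]
      ring
    rw [h1, integral_add (((hφ.lOp _).integrable_mul (integrable_regLog_zero ρ)).const_mul _)
      ((hh.mul (hφ.lOp _)).integrable _), integral_const_mul, integral_regLog_mul_lOp ρ hφ,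
      hsol φ hφ]
    simp only [hGdef, sub_mul, mul_assoc]
    rw [integral_sub (((hD.mul hφ).const_mul _).integrable _) ((hκ.mul hφ).integrable _),
      integral_const_mul]
    field_simp
    ring

omit hP in
theorem resonance_eq (p : ℤ) (z : Torus P) :
    resonance P p z = (∑ k ∈ ({p, -p} : Finset ℤ), trig 1 0 k z) / mass P := by
  simp only [resonance, mass, expIY_eq_expT, trig, one_mul]

omit hP in
theorem isTest_resonance (p : ℤ) : IsTest (resonance P p) := by
  have h : resonance P p =
      fun z => (∑ k ∈ ({p, -p} : Finset ℤ), trig 1 0 k z) / mass P := funext (resonance_eq p)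
  rw [h]
  have : ContDiff ℝ ∞ fun w => (∑ k ∈ ({p, -p} : Finset ℤ), trig 1 0 k (proj P w)) / mass P :=
    (ContDiff.sum fun k _ => isTest_trig (P := P) 1 0 k).div_const _
  exact this

omit hP in
theorem resonance_eq_ite (p : ℤ) (z : Torus P) :
    resonance P p z = (if p = 0 then 1 else 2) * trig 1 0 p z / mass P := by
  have hneg : trig 1 0 (-p) z = trig 1 0 p z := by
    have := expT_neg 0 p z
    rw [neg_zero] at this
    simp [trig, this]
  rw [resonance_eq]
  by_cases hp : p = 0
  · subst hp; simp
  · rw [Finset.sum_pair (by omega), hneg, if_neg hp]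
    ring

theorem coeffT_resonance (p : ℤ) (m k : ℤ) (h0 : symb P p m k = 0) :
    coeffT (resonance P p) m k = 1 := by
  have hM := (mass_pos (P := P)).ne'
  obtain ⟨rfl, h1⟩ := (symb_eq_zero_iff _ _ _).1 h0
  have h1 : p = k ∨ p = -k := by exact_mod_cast h1
  have key : ∀ b : ℂ, (b * coeffT (resonance P p) 0 k).re = b.re := by
    intro b
    rw [← integral_mul_trig ((isTest_resonance p).integrable _)]
    simp only [resonance_eq_ite]
    have e : ∀ z : Torus P, (if p = 0 then (1 : ℝ) else 2) * trig 1 0 p z / mass P * trig b 0 k z =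
        ((if p = 0 then 1 else 2) / mass P) * (trig 1 0 p z * trig b 0 k z) := by
      intro z; ring
    simp only [e]
    rw [integral_const_mul, integral_trig_mul_trig]
    by_cases hp : p = 0
    · have hk : k = 0 := by omega
      subst hp hk
      simp
      field_simp
      ring
    · rw [if_neg hp]
      rcases h1 with rfl | rfl
      · have : ¬ p = -p := by omega
        simp [this]
        field_simp
      · have : ¬ -k = k := by omega
        simp [this]
        field_simp
  apply Complex.ext
  · simpa using key 1
  · simpa using key (-Complex.I)

end Kernel

/-! ### The Riesz measure -/

section Riesz

variable {P : ℝ} [hP : Fact (0 < P)]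

/-- The space of test functions, inside the continuous functions on the torus. -/
def testSubmodule (P : ℝ) : Submodule ℝ C(Torus P, ℝ) where
  carrier := {f | IsTest f}
  zero_mem' := isTest_const (P := P) 0
  add_mem' hf hg := hf.add hg
  smul_mem' c _ hf := hf.const_mul c

/-- The functional `φ ↦ ∫ v L_{-ρ} φ` is positive on the test functions, a subspace that contains
the constants. It extends to a positive functional on all continuous functions by the theorem of
M. Riesz,
and the extension is a measure by the Riesz–Markov–Kakutani theorem. -/
theorem exists_isRieszMeasure {ρ : ℝ} {v : Torus P → EReal} (hv : IsSubfunction P ρ v) :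
    ∃ ν : Measure (Torus P), IsRieszMeasure P ρ v ν := by
  set Λ : C(Torus P, ℝ) →ₗ.[ℝ] ℝ :=
    { domain := testSubmodule P
      toFun :=
        { toFun := fun f => ∫ z, (v z).toReal * lOp (-ρ) f z
          map_add' := by
            rintro ⟨f, hf⟩ ⟨g, hg⟩
            have hf : IsTest f := hf
            have hg : IsTest g := hg
            have : ∀ z, (v z).toReal * lOp (-ρ) (fun z => f z + g z) z =
                (v z).toReal * lOp (-ρ) f z + (v z).toReal * lOp (-ρ) g z := by
              intro z; rw [lOp_add hf hg]; ring
            change ∫ z, (v z).toReal * lOp (-ρ) (fun z => f z + g z) z = _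
            simp only [this]
            exact integral_add ((hf.lOp _).integrable_mul hv.integrable)
              ((hg.lOp _).integrable_mul hv.integrable)
          map_smul' := by
            rintro c ⟨f, hf⟩
            have hf : IsTest f := hf
            have : ∀ z, (v z).toReal * lOp (-ρ) (fun z => c * f z) z =
                c * ((v z).toReal * lOp (-ρ) f z) := by
              intro z; rw [lOp_const_mul hf]; ring
            change ∫ z, (v z).toReal * lOp (-ρ) (fun z => c * f z) z = _
            simp only [this]
            exact integral_const_mul _ _ } } with hΛ
  have hnonneg : ∀ x : Λ.domain, (x : C(Torus P, ℝ)) ∈ PointedCone.positive ℝ C(Torus P, ℝ) →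
      0 ≤ Λ x := by
    rintro ⟨f, hf⟩ h0
    exact hv.nonneg f hf h0
  have hdense : ∀ y : C(Torus P, ℝ), ∃ x : Λ.domain,
      (x : C(Torus P, ℝ)) + y ∈ PointedCone.positive ℝ C(Torus P, ℝ) := by
    intro y
    obtain ⟨C, hC⟩ := isCompact_univ.exists_bound_of_continuousOn y.continuous.continuousOn
    refine ⟨⟨ContinuousMap.const _ C, isTest_const (P := P) C⟩, fun z => ?_⟩
    have := hC z trivial
    rw [Real.norm_eq_abs, abs_le] at this
    change 0 ≤ C + y z
    linarith
  obtain ⟨g, hg1, hg2⟩ := riesz_extension _ Λ hnonneg hdense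
  set L : CompactlySupportedContinuousMap (Torus P) ℝ →ₚ[ℝ] ℝ :=
    PositiveLinearMap.mk₀
      { toFun := fun f => g f.toContinuousMap
        map_add' := fun f₁ f₂ => g.map_add f₁.toContinuousMap f₂.toContinuousMap
        map_smul' := fun c f => g.map_smul c f.toContinuousMap }
      (fun f hf => hg2 _ fun z => hf z) with hL
  have hint : ∀ f : C(Torus P, ℝ), ∫ z, f z ∂(RealRMK.rieszMeasure L) = g f := by
    intro f
    exact RealRMK.integral_rieszMeasure L ⟨f, HasCompactSupport.of_compactSpace f⟩
  exact ⟨RealRMK.rieszMeasure L, inferInstance, fun φ hφ =>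
    (hg1 ⟨⟨φ, hφ.continuous⟩, hφ⟩).symm.trans (hint ⟨φ, hφ.continuous⟩).symm⟩

theorem IsRieszMeasure.unique {ρ : ℝ} {v : Torus P → EReal} {μ ν : Measure (Torus P)}
    (hμ : IsRieszMeasure P ρ v μ) (hν : IsRieszMeasure P ρ v ν) : μ = ν := by
  have := hμ.finite
  have := hν.finite
  exact measure_ext_of_trig fun a m k => by
    rw [← hμ.eq _ (isTest_trig a m k), ← hν.eq _ (isTest_trig a m k)]

theorem existsUnique_isRieszMeasure {ρ : ℝ} {v : Torus P → EReal} (hv : IsSubfunction P ρ v) :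
    ∃! ν : Measure (Torus P), IsRieszMeasure P ρ v ν := by
  obtain ⟨ν, hν⟩ := exists_isRieszMeasure hv
  exact ⟨ν, hν, fun μ hμ => hμ.unique hν⟩

/-- The Riesz measure is orthogonal to the resonant characters, because they lie in the kernel of
`L_{-ρ}`. -/
theorem IsRieszMeasure.integral_expT {ρ : ℝ} {v : Torus P → EReal} {ν : Measure (Torus P)}
    (hν : IsRieszMeasure P ρ v ν) {m k : ℤ} (h0 : symb P ρ m k = 0) :
    ∫ z, expT m k z ∂ν = 0 := by
  have := hν.finite
  have key : ∀ b : ℂ, ∫ z, trig b m k z ∂ν = 0 := by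
    intro b
    rw [← hν.eq _ (isTest_trig b m k)]
    simp [lOp_trig, h0, trig]
  have hint : Integrable (expT m k : Torus P → ℂ) ν :=
    (continuous_expT m k).integrable_of_hasCompactSupport (HasCompactSupport.of_compactSpace _)
  have h1 := key 1
  have h2 := key (-Complex.I)
  have e1 : ∀ z : Torus P, trig 1 m k z = RCLike.re (expT m k z) := by intro z; simp [trig]
  have e2 : ∀ z : Torus P, trig (-Complex.I) m k z = RCLike.im (expT m k z) := by
    intro z; simp [trig]
  simp only [e1, e2] at h1 h2
  rw [integral_re hint] at h1
  rw [integral_im hint] at h2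
  exact Complex.ext h1 h2

end Riesz

/-! ### Extended integrals and potentials -/

section Potential

/-- For `f ≤ M` on a finite measure space, `extIntegral μ f = M μ(univ) - ∫ (M - f) dμ`, with a
nonnegative integrand on the right. -/
theorem extIntegral_eq_sub {α : Type*} [MeasurableSpace α] {μ : Measure α} [IsFiniteMeasure μ]
    {f : α → EReal} (hf : Measurable f) {M : ℝ} (hM0 : 0 ≤ M) (hM : ∀ a, f a ≤ M) :
    extIntegral μ f = ((M * μ.real univ : ℝ) : EReal) -
      ((∫⁻ a, ((M : EReal) - f a).toENNReal ∂μ : ENNReal) : EReal) := by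
  have hpt : ∀ a, (f a).toENNReal + ((M : EReal) - f a).toENNReal =
      ENNReal.ofReal M + (-(f a)).toENNReal := by
    intro a
    have h := hM a
    induction hfa : f a using EReal.rec with
    | bot => simp
    | coe x =>
      rw [hfa] at h
      have hx : x ≤ M := EReal.coe_le_coe_iff.1 h
      rw [← EReal.coe_sub, ← EReal.coe_neg, EReal.toENNReal_of_ne_top (EReal.coe_ne_top _),
        EReal.toENNReal_of_ne_top (EReal.coe_ne_top _),
        EReal.toENNReal_of_ne_top (EReal.coe_ne_top _), EReal.toReal_coe, EReal.toReal_coe,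
        EReal.toReal_coe]
      rcases le_total 0 x with h0 | h0
      · rw [← ENNReal.ofReal_add h0 (by linarith), ENNReal.ofReal_of_nonpos (by linarith : -x ≤ 0)]
        simp
      · rw [ENNReal.ofReal_of_nonpos h0, ← ENNReal.ofReal_add hM0 (by linarith), zero_add]
        congr 1
    | top =>
      rw [hfa] at h
      exact absurd (top_le_iff.1 h) (EReal.coe_ne_top M)
  have hm1 : Measurable fun a => (f a).toENNReal := hf.ereal_toENNReal
  have hm2 : Measurable fun a => (-(f a)).toENNReal := hf.neg.ereal_toENNReal
  have hint : (∫⁻ a, (f a).toENNReal ∂μ) + ∫⁻ a, ((M : EReal) - f a).toENNReal ∂μ =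
      ENNReal.ofReal M * μ univ + ∫⁻ a, (-(f a)).toENNReal ∂μ := by
    rw [← lintegral_add_left hm1, ← lintegral_const, ← lintegral_add_left measurable_const]
    exact lintegral_congr hpt
  have hfin : ∫⁻ a, (f a).toENNReal ∂μ ≠ ⊤ := by
    have h1 : ∫⁻ a, (f a).toENNReal ∂μ ≤ ∫⁻ _, ENNReal.ofReal M ∂μ := by
      refine lintegral_mono fun a => ?_
      have := EReal.toENNReal_le_toENNReal (hM a)
      rwa [EReal.toENNReal_of_ne_top (EReal.coe_ne_top M), EReal.toReal_coe] at this
    rw [lintegral_const] at h1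
    exact (h1.trans_lt (ENNReal.mul_lt_top ENNReal.ofReal_lt_top (measure_lt_top μ univ))).ne
  rw [extIntegral]
  generalize ∫⁻ a, (f a).toENNReal ∂μ = A at hint hfin ⊢
  generalize ∫⁻ a, ((M : EReal) - f a).toENNReal ∂μ = B at hint ⊢
  generalize ∫⁻ a, (-(f a)).toENNReal ∂μ = C at hint ⊢
  have hMμ : ENNReal.ofReal M * μ univ = ENNReal.ofReal (M * μ.real univ) := by
    rw [ENNReal.ofReal_mul hM0, Measure.real, ENNReal.ofReal_toReal (measure_ne_top μ univ)]
  rw [hMμ] at hint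
  have hK : 0 ≤ M * μ.real univ := mul_nonneg hM0 measureReal_nonneg
  generalize M * μ.real univ = K at hint hK ⊢
  lift A to NNReal using hfin
  by_cases hC : C = ⊤
  · have hB : B = ⊤ := by
      by_contra hB
      rw [hC] at hint
      simp at hint
      exact hB hint
    rw [hC, hB]
    simp
  · have hB : B ≠ ⊤ := by
      intro hB
      rw [hB, add_top] at hint
      exact ENNReal.add_ne_top.2 ⟨ENNReal.ofReal_ne_top, hC⟩ hint.symm
    lift C to NNReal using hC
    lift B to NNReal using hB
    have h2 := congrArg ENNReal.toReal hint
    rw [ENNReal.toReal_add ENNReal.coe_ne_top ENNReal.coe_ne_top,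
      ENNReal.toReal_add ENNReal.ofReal_ne_top ENNReal.coe_ne_top, ENNReal.toReal_ofReal hK] at h2
    simp only [ENNReal.coe_toReal] at h2
    change ((A : ℝ) : EReal) - ((C : ℝ) : EReal) = (K : EReal) - ((B : ℝ) : EReal)
    rw [← EReal.coe_sub, ← EReal.coe_sub]
    congr 1
    linarith

end Potential

/-! ### The representation almost everywhere -/

section Representation

variable {P : ℝ} [hP : Fact (0 < P)]

theorem IsKernel.exists_le {ρ : ℝ} {κ : Torus P → ℝ} {E : Torus P → EReal}
    (hE : IsKernel P ρ κ E) : ∃ M : ℝ, 0 ≤ M ∧ ∀ z, E z ≤ M := by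
  obtain ⟨z₀, -, hz₀⟩ := isCompact_univ.exists_isMaxOn univ_nonempty hE.continuous.continuousOn
  refine ⟨max 0 (E z₀).toReal, le_max_left _ _, fun z => ?_⟩
  refine (hz₀ (mem_univ z)).trans ((EReal.le_coe_toReal (hE.ne_top z₀)).trans ?_)
  exact EReal.coe_le_coe_iff.2 (le_max_right _ _)

theorem IsKernel.measurable_toReal {ρ : ℝ} {κ : Torus P → ℝ} {E : Torus P → EReal}
    (hE : IsKernel P ρ κ E) : Measurable fun z => (E z).toReal :=
  hE.continuous.measurable.ereal_toReal

theorem integrable_sub_prod {e : Torus P → ℝ} (hm : Measurable e) (he : Integrable e volume)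
    (ν : Measure (Torus P)) [IsFiniteMeasure ν] :
    Integrable (fun p : Torus P × Torus P => e (p.1 - p.2)) (volume.prod ν) := by
  have hm' : AEStronglyMeasurable (fun p : Torus P × Torus P => e (p.1 - p.2))
      (volume.prod ν) := (hm.comp (measurable_fst.sub measurable_snd)).aestronglyMeasurable
  rw [integrable_prod_iff' hm']
  refine ⟨.of_forall fun ζ => he.comp_sub_right ζ, ?_⟩
  have : ∀ ζ : Torus P, ∫ z, ‖e (z - ζ)‖ = ∫ z, ‖e z‖ := fun ζ =>
    integral_sub_right_eq_self (fun z => ‖e z‖) ζ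
  simp only [this]
  exact integrable_const _

theorem ae_ae_sub_ne_zero (ν : Measure (Torus P)) [IsFiniteMeasure ν] :
    ∀ᵐ z : Torus P, ∀ᵐ ζ ∂ν, z - ζ ≠ 0 := by
  rw [Measure.ae_ae_comm]
  · refine .of_forall fun ζ => ?_
    exact (measurePreserving_sub_right volume ζ).quasiMeasurePreserving.ae ae_ne_zero
  · exact (measurableSet_singleton (0 : Torus P)).compl.preimage (measurable_fst.sub measurable_snd)

/-- The potential as a function in `L¹`. -/
noncomputable def potReal (E : Torus P → EReal) (ν : Measure (Torus P)) (z : Torus P) : ℝ :=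
  ∫ ζ, (E (z - ζ)).toReal ∂ν

theorem IsKernel.integrable_potReal {ρ : ℝ} {κ : Torus P → ℝ} {E : Torus P → EReal}
    (hE : IsKernel P ρ κ E) (ν : Measure (Torus P)) [IsFiniteMeasure ν] :
    Integrable (potReal E ν) volume :=
  (integrable_sub_prod hE.measurable_toReal hE.integrable ν).integral_prod_left

theorem IsKernel.potential_ae_eq {ρ : ℝ} {κ : Torus P → ℝ} {E : Torus P → EReal}
    (hE : IsKernel P ρ κ E) (ν : Measure (Torus P)) [IsFiniteMeasure ν] :
    ∀ᵐ z : Torus P, potential E ν z = (potReal E ν z : EReal) := by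
  obtain ⟨M, hM0, hM⟩ := hE.exists_le
  filter_upwards [ae_ae_sub_ne_zero ν,
    (integrable_sub_prod hE.measurable_toReal hE.integrable ν).prod_right_ae] with z hz hint
  have hmeas : Measurable fun ζ => E (z - ζ) :=
    hE.continuous.measurable.comp (measurable_const.sub measurable_id)
  rw [potential, extIntegral_eq_sub hmeas hM0 fun ζ => hM _]
  have h1 : ∫⁻ ζ, ((M : EReal) - E (z - ζ)).toENNReal ∂ν =
      ∫⁻ ζ, ENNReal.ofReal (M - (E (z - ζ)).toReal) ∂ν := by
    refine lintegral_congr_ae ?_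
    filter_upwards [hz] with ζ hζ
    have hne : E (z - ζ) ≠ ⊥ := fun h => hζ ((hE.eq_bot_iff _).1 h)
    conv_lhs => rw [← EReal.coe_toReal (hE.ne_top (z - ζ)) hne]
    rw [← EReal.coe_sub, EReal.toENNReal_of_ne_top (EReal.coe_ne_top _), EReal.toReal_coe]
  have hnn : ∀ᵐ ζ ∂ν, 0 ≤ M - (E (z - ζ)).toReal := by
    filter_upwards [hz] with ζ hζ
    have hne : E (z - ζ) ≠ ⊥ := fun h => hζ ((hE.eq_bot_iff _).1 h)
    have := hM (z - ζ)
    rw [← EReal.coe_toReal (hE.ne_top (z - ζ)) hne, EReal.coe_le_coe_iff] at this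
    linarith
  have h2 : Integrable (fun ζ => M - (E (z - ζ)).toReal) ν := (integrable_const M).sub hint
  rw [h1, ← ofReal_integral_eq_lintegral_ofReal h2 hnn, EReal.coe_ennreal_ofReal,
    max_eq_left (integral_nonneg_of_ae hnn), ← EReal.coe_sub,
    integral_sub (integrable_const M) hint, integral_const, smul_eq_mul, potReal]
  congr 1
  ring

/-- If `κ * ν = 0`, the potential of `ν` solves `L_ρ u = ν` in the sense of distributions. -/
theorem IsKernel.integral_potReal_mul_lOp {ρ : ℝ} {κ : Torus P → ℝ} {E : Torus P → EReal}
    (hE : IsKernel P ρ κ E) (hκ : IsTest κ) (ν : Measure (Torus P)) [IsFiniteMeasure ν]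
    (hν : ∀ z, ∫ ζ, κ (z - ζ) ∂ν = 0) {φ : Torus P → ℝ} (hφ : IsTest φ) :
    ∫ z, potReal E ν z * lOp (-ρ) φ z = ∫ z, φ z ∂ν := by
  have swap : ∀ {e ψ : Torus P → ℝ}, Measurable e → Integrable e volume → IsTest ψ →
      ∫ z, (∫ ζ, e (z - ζ) ∂ν) * ψ z = ∫ ζ, ∫ w, e w * ψ (w + ζ) ∂volume ∂ν := by
    intro e ψ hm he hψ
    obtain ⟨C, -, hC⟩ := hψ.exists_bound
    have hint : Integrable (fun p : Torus P × Torus P => e (p.1 - p.2) * ψ p.1)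
        (volume.prod ν) :=
      (integrable_sub_prod hm he ν).mul_bdd (c := C)
        (hψ.continuous.comp continuous_fst).aestronglyMeasurable (.of_forall fun p => hC _)
    calc ∫ z, (∫ ζ, e (z - ζ) ∂ν) * ψ z = ∫ z, ∫ ζ, e (z - ζ) * ψ z ∂ν := by
          simp only [integral_mul_const]
      _ = ∫ ζ, ∫ z, e (z - ζ) * ψ z ∂volume ∂ν := integral_integral_swap hint
      _ = ∫ ζ, ∫ w, e w * ψ (w + ζ) ∂volume ∂ν := by
          congr 1
          funext ζ
          rw [← integral_sub_right_eq_self (fun w => e w * ψ (w + ζ)) ζ]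
          simp only [sub_add_cancel]
  have h1 := swap hE.measurable_toReal hE.integrable (hφ.lOp (-ρ))
  have h2 := swap hκ.continuous.measurable (hκ.integrable _) hφ
  simp only [hν, zero_mul, integral_zero] at h2
  have h3 : ∀ ζ, ∫ w, (E w).toReal * lOp (-ρ) φ (w + ζ) = φ ζ - ∫ w, κ w * φ (w + ζ) := by
    intro ζ
    have := hE.eq _ (hφ.comp_add_right ζ)
    simpa only [lOp_comp_add_right, zero_add] using this
  have h4 : Integrable (fun ζ => ∫ w, κ w * φ (w + ζ)) ν := by
    obtain ⟨C, hC0, hC⟩ := hφ.exists_bound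
    obtain ⟨D, hD0, hD⟩ := hκ.exists_bound
    have hc : Continuous fun p : Torus P × Torus P => κ p.2 * φ (p.2 + p.1) :=
      (hκ.continuous.comp continuous_snd).mul
        (hφ.continuous.comp (continuous_snd.add continuous_fst))
    have : Integrable (fun p : Torus P × Torus P => κ p.2 * φ (p.2 + p.1)) (ν.prod volume) :=
      hc.integrable_of_hasCompactSupport (HasCompactSupport.of_compactSpace _)
    exact this.integral_prod_left
  unfold potReal
  rw [h1]
  simp only [h3]
  rw [integral_sub (hφ.integrable ν) h4, ← h2, sub_zero]

/-- A subfunction differs from the potential of its Riesz measure by an integrable solution of the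
homogeneous equation. -/
theorem IsSubfunction.weak_null_sub_potReal {ρ : ℝ} {κ : Torus P → ℝ} {E v : Torus P → EReal}
    {ν : Measure (Torus P)} (hv : IsSubfunction P ρ v) (hνv : IsRieszMeasure P ρ v ν)
    (hE : IsKernel P ρ κ E) (hκ : IsTest κ) (hν : ∀ z, ∫ ζ, κ (z - ζ) ∂ν = 0) :
    Integrable (fun z => (v z).toReal - potReal E ν z) volume ∧
      ∀ φ, IsTest φ → ∫ z, ((v z).toReal - potReal E ν z) * lOp (-ρ) φ z = 0 := by
  have := hνv.finite
  have hu := hE.integrable_potReal ν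
  refine ⟨hv.integrable.sub hu, fun φ hφ => ?_⟩
  simp only [sub_mul]
  rw [integral_sub ((hφ.lOp _).integrable_mul hv.integrable) ((hφ.lOp _).integrable_mul hu),
    hE.integral_potReal_mul_lOp hκ ν hν hφ, hνv.eq φ hφ, sub_self]

theorem IsSubfunction.ae_eq_potential_add {ρ : ℝ} {κ : Torus P → ℝ} {E v : Torus P → EReal}
    {ν : Measure (Torus P)} (hv : IsSubfunction P ρ v) (hνv : IsRieszMeasure P ρ v ν)
    (hE : IsKernel P ρ κ E) {c : Torus P → ℝ}
    (hc : (fun z => (v z).toReal - potReal E ν z) =ᵐ[volume] c) :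
    ∀ᵐ z : Torus P, v z = potential E ν z + (c z : EReal) := by
  have := hνv.finite
  filter_upwards [hc, hE.potential_ae_eq ν, hv.ae_ne_bot] with z h1 h2 h3
  rw [h2, ← h1, ← EReal.coe_add, add_sub_cancel, EReal.coe_toReal (hv.lt_top z).ne h3]

omit hP in
theorem trig_sub_apply (m k : ℤ) (z ζ : Torus P) :
    trig 1 m k (z - ζ) = trig ((starRingEnd ℂ) (expT m k z)) m k ζ := by
  have h1 : expT m k z = expT m k (z - ζ) * expT m k ζ := by
    rw [← expT_add_apply, sub_add_cancel]
  have h2 : (starRingEnd ℂ) (expT m k ζ) * expT m k ζ = 1 := by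
    rw [← Complex.normSq_eq_conj_mul_self, Complex.normSq_eq_norm_sq, norm_expT]
    simp
  have h3 : (starRingEnd ℂ) (expT m k z) * expT m k ζ = (starRingEnd ℂ) (expT m k (z - ζ)) := by
    rw [h1, map_mul, mul_assoc, h2, mul_one]
  rw [trig, trig, h3, one_mul, Complex.conj_re]

/-- The convolution of `κ_p` with the Riesz measure vanishes, as the measure is orthogonal to the
resonant characters. -/
theorem integral_resonance_sub {p : ℤ} {v : Torus P → EReal} {ν : Measure (Torus P)}
    (hν : IsRieszMeasure P p v ν) (z : Torus P) : ∫ ζ, resonance P p (z - ζ) ∂ν = 0 := by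
  have h0 : symb P p 0 p = 0 := (symb_eq_zero_iff _ _ _).2 ⟨rfl, Or.inl rfl⟩
  have := hν.finite
  simp only [resonance_eq_ite, trig_sub_apply]
  rw [integral_div, integral_const_mul, ← hν.eq _ (isTest_trig _ _ _)]
  simp [lOp_trig, h0, trig]

/-- Two kernels for the same equation that agree almost everywhere up to a continuous function
agree everywhere up to that function. -/
theorem IsKernel.eq_add_of_ae {ρ : ℝ} {κ : Torus P → ℝ} {E E' : Torus P → EReal}
    (hE : IsKernel P ρ κ E) (hE' : IsKernel P ρ κ E') {c : Torus P → ℝ} (hc : Continuous c)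
    (h : (fun z => (E' z).toReal - (E z).toReal) =ᵐ[volume] c) :
    ∀ z, E' z = E z + (c z : EReal) := by
  have h1 : E' =ᵐ[volume] fun z => E z + (c z : EReal) := by
    filter_upwards [h, ae_ne_zero] with z hz h0
    have n1 : E z ≠ ⊥ := fun h => h0 ((hE.eq_bot_iff _).1 h)
    have n2 : E' z ≠ ⊥ := fun h => h0 ((hE'.eq_bot_iff _).1 h)
    rw [← EReal.coe_toReal (hE.ne_top z) n1, ← hz, ← EReal.coe_add, add_sub_cancel,
      EReal.coe_toReal (hE'.ne_top z) n2]
  have h2 : Continuous fun z => E z + (c z : EReal) := by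
    rw [continuous_iff_continuousAt]
    intro z
    exact (EReal.continuousAt_add (Or.inr (EReal.coe_ne_bot _)) (Or.inr (EReal.coe_ne_top _))).comp
      (f := fun z => (E z, (c z : EReal)))
      (hE.continuous.prodMk (continuous_coe_real_ereal.comp hc)).continuousAt
  exact fun z => congrFun (Continuous.ae_eq_iff_eq volume hE'.continuous h2 |>.1 h1) z

theorem IsKernel.weak_null_sub {ρ : ℝ} {κ : Torus P → ℝ} {E E' : Torus P → EReal}
    (hE : IsKernel P ρ κ E) (hE' : IsKernel P ρ κ E') :
    Integrable (fun z => (E' z).toReal - (E z).toReal) volume ∧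
      ∀ φ, IsTest φ → ∫ z, ((E' z).toReal - (E z).toReal) * lOp (-ρ) φ z = 0 := by
  refine ⟨hE'.integrable.sub hE.integrable, fun φ hφ => ?_⟩
  simp only [sub_mul]
  rw [integral_sub ((hφ.lOp _).integrable_mul hE'.integrable)
    ((hφ.lOp _).integrable_mul hE.integrable), hE.eq φ hφ, hE'.eq φ hφ, sub_self]

end Representation

/-! ### Logarithmic disc means -/

section DiscMean

variable {P : ℝ} [hP : Fact (0 < P)]

/-- The point of the torus with coordinates `log ξ`. -/
noncomputable def plog (P : ℝ) (ξ : ℂ) : Torus P := proj P ((Complex.log ξ).re, (Complex.log ξ).im)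

omit hP in
theorem plog_one : plog P 1 = 0 := by
  simp only [plog, Complex.log_one, Complex.zero_re, Complex.zero_im]
  exact proj_mk_zero

omit hP in
theorem measurable_plog : Measurable (plog P) :=
  continuous_proj.measurable.comp
    ((Complex.measurable_re.comp Complex.measurable_log).prodMk
      (Complex.measurable_im.comp Complex.measurable_log))

omit hP in
theorem continuousAt_plog : ContinuousAt (plog P) 1 := by
  have h : ContinuousAt Complex.log 1 := continuousAt_clog (by simp)
  exact continuous_proj.continuousAt.comp
    ((Complex.continuous_re.continuousAt.comp h).prodMk
      (Complex.continuous_im.continuousAt.comp h))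

/-- The uniform probability measure on the disc of radius `r` about `1`. -/
noncomputable def discMeasure (r : ℝ) : Measure ℂ :=
  ProbabilityTheory.cond volume (Metric.ball (1 : ℂ) r)

theorem isProbabilityMeasure_discMeasure {r : ℝ} (hr : 0 < r) :
    IsProbabilityMeasure (discMeasure r) :=
  ProbabilityTheory.cond_isProbabilityMeasure_of_finite
    (Metric.measure_ball_pos volume _ hr).ne' measure_ball_lt_top.ne

theorem ae_discMeasure_mem (r : ℝ) : ∀ᵐ ξ ∂discMeasure r, ξ ∈ Metric.ball (1 : ℂ) r :=
  ProbabilityTheory.ae_cond_mem Metric.isOpen_ball.measurableSet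

/-- Locally, the covering map preserves null sets. -/
theorem proj_preimage_null {S : Set (Torus P)} (hS : volume S = 0) :
    volume (proj P ⁻¹' S) = 0 := by
  refine measure_null_of_locally_null _ fun x _ => ?_
  set B : Set (ℝ × ℝ) := Ioc (x.1 - P / 2) (x.1 - P / 2 + P) ×ˢ
    Ioc (x.2 - Real.pi) (x.2 - Real.pi + 2 * Real.pi) with hB
  have hB0 : B ∈ 𝓝 x := by
    refine prod_mem_nhds (Ioc_mem_nhds ?_ ?_) (Ioc_mem_nhds ?_ ?_) <;>
      linarith [hP.out, Real.pi_pos]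
  refine ⟨B ∩ proj P ⁻¹' S, inter_mem (mem_nhdsWithin_of_mem_nhds hB0) self_mem_nhdsWithin, ?_⟩
  have h := (measurePreserving_proj (P := P) (x.1 - P / 2) (x.2 - Real.pi)).quasiMeasurePreserving
  have h1 := h.preimage_null hS
  rw [Measure.prod_restrict, ← Measure.volume_eq_prod,
    Measure.restrict_apply₀' (measurableSet_Ioc.prod measurableSet_Ioc).nullMeasurableSet] at h1
  rwa [inter_comm]

/-- A preimage under `log` is an image under the smooth map `exp`, so it is null if the set is. -/
theorem plog_preimage_null {S : Set (Torus P)} (hS : volume S = 0) :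
    volume (plog P ⁻¹' S) = 0 := by
  set T : Set ℂ := Complex.measurableEquivRealProd ⁻¹' (proj P ⁻¹' S)
  have hT : volume T = 0 :=
    Complex.volume_preserving_equiv_real_prod.quasiMeasurePreserving.preimage_null
      (proj_preimage_null hS)
  have hd : Differentiable ℝ Complex.exp := Complex.differentiable_exp
  have h1 : volume (Complex.exp '' T) = 0 :=
    addHaar_image_eq_zero_of_differentiableOn_of_addHaar_eq_zero volume hd.differentiableOn hT
  refine measure_mono_null (t := Complex.exp '' T ∪ {0}) (fun ξ hξ => ?_)
    (measure_union_null h1 (measure_singleton _))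
  by_cases h0 : ξ = 0
  · exact Or.inr h0
  · exact Or.inl ⟨Complex.log ξ, hξ, Complex.exp_log h0⟩

/-- The mean of `N(z + log ξ)` over the disc of radius `r` about `ξ = 1`. In the coordinate
`Z = e^z` this is a mean over a disc centred at `Z`. -/
noncomputable def discMean (N : Torus P → ENNReal) (z : Torus P) (r : ℝ) : ENNReal :=
  ∫⁻ ξ, N (z + plog P ξ) ∂discMeasure r

theorem ae_add_plog {p : Torus P → Prop} (h : ∀ᵐ x : Torus P, p x) (z : Torus P) (r : ℝ) :
    ∀ᵐ ξ ∂discMeasure r, p (z + plog P ξ) := by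
  refine ProbabilityTheory.cond_absolutelyContinuous.ae_le ?_
  have h1 : volume ((fun x => z + x) ⁻¹' {x | ¬ p x}) = 0 := by
    rw [measure_preimage_add]
    exact h
  exact plog_preimage_null h1

theorem discMean_mono_ae {N₁ N₂ : Torus P → ENNReal} (h : ∀ᵐ x : Torus P, N₁ x ≤ N₂ x)
    (z : Torus P) (r : ℝ) : discMean N₁ z r ≤ discMean N₂ z r :=
  lintegral_mono_ae (ae_add_plog h z r)

theorem discMean_congr {N₁ N₂ : Torus P → ENNReal} (h : N₁ =ᵐ[volume] N₂) (z : Torus P) (r : ℝ) :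
    discMean N₁ z r = discMean N₂ z r :=
  lintegral_congr_ae (ae_add_plog h z r)

omit hP in
theorem discMean_add {N₁ N₂ : Torus P → ENNReal} (h : Measurable N₁) (z : Torus P) (r : ℝ) :
    discMean (fun x => N₁ x + N₂ x) z r = discMean N₁ z r + discMean N₂ z r :=
  lintegral_add_left (h.comp (measurable_plog.const_add z)) _

omit hP in
/-- For a point `w` near `z` and a small radius, the disc mean only sees a neighbourhood of `z`. -/
theorem eventually_forall_ball {p : Torus P → Prop} {z : Torus P} (h : ∀ᶠ x in 𝓝 z, p x) :
    ∀ᶠ q : Torus P × ℝ in 𝓝 z ×ˢ 𝓝[>] 0, ∀ ξ ∈ Metric.ball (1 : ℂ) q.2, p (q.1 + plog P ξ) := by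
  have h1 : Tendsto (fun q : Torus P × ℂ => q.1 + plog P q.2) (𝓝 z ×ˢ 𝓝 1) (𝓝 z) := by
    have h2 : Tendsto (plog P) (𝓝 1) (𝓝 0) := by
      simpa [plog_one] using (continuousAt_plog (P := P)).tendsto
    simpa using (tendsto_fst.add (h2.comp tendsto_snd) :
      Tendsto (fun q : Torus P × ℂ => q.1 + plog P q.2) (𝓝 z ×ˢ 𝓝 1) (𝓝 (z + 0)))
  obtain ⟨pa, ha, pb, hb, hab⟩ := eventually_prod_iff.1 (h1.eventually h)
  obtain ⟨δ, hδ, hball⟩ := Metric.eventually_nhds_iff_ball.1 hb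
  refine (ha.prod_mk (Ioo_mem_nhdsGT hδ : ∀ᶠ r in 𝓝[>] (0 : ℝ), r ∈ Ioo 0 δ)).mono ?_
  rintro ⟨x, r⟩ ⟨hx, hr⟩ ξ hξ
  exact hab hx (hball ξ (Metric.ball_subset_ball hr.2.le hξ))

omit hP in
theorem eventually_ae_discMeasure {p : Torus P → Prop} {z : Torus P} (h : ∀ᶠ x in 𝓝 z, p x) :
    ∀ᶠ q : Torus P × ℝ in 𝓝 z ×ˢ 𝓝[>] 0, ∀ᵐ ξ ∂discMeasure q.2, p (q.1 + plog P ξ) :=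
  (eventually_forall_ball h).mono fun q hq => (ae_discMeasure_mem q.2).mono hq

omit hP in
theorem eventually_ae_discMeasure_right {p : Torus P → Prop} {z : Torus P}
    (h : ∀ᶠ x in 𝓝 z, p x) : ∀ᶠ r in 𝓝[>] (0 : ℝ), ∀ᵐ ξ ∂discMeasure r, p (z + plog P ξ) :=
  ((eventually_ae_discMeasure h).curry).self_of_nhds

omit hP in
theorem le_discMean_of_lt {N : Torus P → ENNReal} (hN : LowerSemicontinuous N) {z : Torus P}
    {a : ENNReal} (ha : a < N z) : ∀ᶠ r in 𝓝[>] (0 : ℝ), a ≤ discMean N z r := by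
  filter_upwards [eventually_ae_discMeasure_right (hN z a ha), self_mem_nhdsWithin] with r hr hr0
  have := isProbabilityMeasure_discMeasure hr0
  calc a = ∫⁻ _, a ∂discMeasure r := by simp
    _ ≤ _ := lintegral_mono_ae (hr.mono fun ξ hξ => hξ.le)

/-- Functions whose value at each point is the limit of the disc means at that point. If
`N = M - v`, this is what normalization of `v` provides. -/
structure Regular (N : Torus P → ENNReal) : Prop where
  lsc : LowerSemicontinuous N
  mean_le : ∀ z, N z ≠ ⊤ → ∀ ε : ENNReal, ε ≠ 0 →
    ∀ᶠ r in 𝓝[>] (0 : ℝ), discMean N z r ≤ N z + ε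

theorem Regular.le_of_ae_eq {N₁ N₂ : Torus P → ENNReal} (h₁ : Regular N₁) (h₂ : Regular N₂)
    (h : N₁ =ᵐ[volume] N₂) (z : Torus P) : N₁ z ≤ N₂ z := by
  by_cases ht : N₂ z = ⊤
  · rw [ht]; exact le_top
  refine le_of_forall_lt_imp_le_of_dense fun a ha => ?_
  refine ENNReal.le_of_forall_pos_le_add fun ε hε _ => ?_
  have hε' : (ε : ENNReal) ≠ 0 := by exact_mod_cast hε.ne'
  obtain ⟨r, hr1, hr2⟩ := ((le_discMean_of_lt h₁.lsc ha).and (h₂.mean_le z ht ε hε')).exists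
  rw [discMean_congr h] at hr1
  exact hr1.trans hr2

theorem Regular.eq_of_ae_eq {N₁ N₂ : Torus P → ENNReal} (h₁ : Regular N₁) (h₂ : Regular N₂)
    (h : N₁ =ᵐ[volume] N₂) (z : Torus P) : N₁ z = N₂ z :=
  le_antisymm (h₁.le_of_ae_eq h₂ h z) (h₂.le_of_ae_eq h₁ h.symm z)

omit hP in
theorem Regular.add {N₁ N₂ : Torus P → ENNReal} (h₁ : Regular N₁) (h₂ : Regular N₂) :
    Regular fun z => N₁ z + N₂ z where
  lsc := h₁.lsc.add h₂.lsc
  mean_le z hz ε hε := by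
    rw [Ne, ENNReal.add_eq_top, not_or] at hz
    have hε2 : ε / 2 ≠ 0 := by simpa using hε
    filter_upwards [h₁.mean_le z hz.1 _ hε2, h₂.mean_le z hz.2 _ hε2] with r hr1 hr2
    rw [discMean_add h₁.lsc.measurable]
    calc _ ≤ (N₁ z + ε / 2) + (N₂ z + ε / 2) := add_le_add hr1 hr2
      _ = N₁ z + N₂ z + (ε / 2 + ε / 2) := by abel
      _ = _ := by rw [ENNReal.add_halves]

omit hP in
theorem regular_ofReal {c : Torus P → ℝ} (hc : Continuous c) :
    Regular fun z => ENNReal.ofReal (c z) where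
  lsc := (ENNReal.continuous_ofReal.comp hc).lowerSemicontinuous
  mean_le z _ ε hε := by
    have hcont : Continuous fun z => ENNReal.ofReal (c z) := ENNReal.continuous_ofReal.comp hc
    have h1 : ∀ᶠ x in 𝓝 z, ENNReal.ofReal (c x) < ENNReal.ofReal (c z) + ε :=
      hcont.continuousAt.eventually (gt_mem_nhds (ENNReal.lt_add_right (by simp) hε))
    filter_upwards [eventually_ae_discMeasure_right h1, self_mem_nhdsWithin] with r hr hr0
    have := isProbabilityMeasure_discMeasure hr0
    calc _ ≤ ∫⁻ _, (ENNReal.ofReal (c z) + ε) ∂discMeasure r :=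
          lintegral_mono_ae (hr.mono fun ξ hξ => hξ.le)
      _ = _ := by simp

end DiscMean

/-! ### Disc means from circle means -/

section Circle

/-- The angular interval of polar coordinates is replaced by the one used for circle means. -/
theorem lintegral_Ioo_circleMap (f : ℂ → ENNReal) (s : ℝ) :
    ∫⁻ θ in Ioo (-Real.pi) Real.pi, f (circleMap 0 s θ) =
      ∫⁻ θ in Ioc 0 (2 * Real.pi), f (circleMap 0 s θ) := by
  have hper : Function.Periodic (fun θ => f (circleMap 0 s θ)) (2 * Real.pi) :=
    (periodic_circleMap 0 s).comp f
  have h := fun t => AddCircle.lintegral_preimage (2 * Real.pi) t hper.lift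
  have h1 := (h (-Real.pi)).trans (h 0).symm
  simp only [Function.Periodic.lift_coe, zero_add] at h1
  rw [show -Real.pi + 2 * Real.pi = Real.pi by ring] at h1
  rw [← h1]
  exact setLIntegral_congr Ioo_ae_eq_Ioc

theorem lintegral_ball_eq_polar {f : ℂ → ENNReal} (hf : Measurable f) (r : ℝ) :
    ∫⁻ ξ in Metric.ball 0 r, f ξ = ∫⁻ s in Ioo 0 r, ENNReal.ofReal s *
      ∫⁻ θ in Ioc 0 (2 * Real.pi), f (circleMap 0 s θ) := by
  have hsymm : ∀ p : ℝ × ℝ, Complex.polarCoord.symm p = circleMap 0 p.1 p.2 := fun p => by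
    rw [Complex.polarCoord_symm_apply, circleMap, zero_add, Complex.exp_mul_I,
      Complex.ofReal_cos, Complex.ofReal_sin]
  have hcm : Measurable fun p : ℝ × ℝ => circleMap 0 p.1 p.2 := by
    unfold circleMap; fun_prop
  rw [← lintegral_indicator Metric.isOpen_ball.measurableSet,
    ← Complex.lintegral_comp_polarCoord_symm, polarCoord_target,
    Measure.volume_eq_prod, ← Measure.prod_restrict]
  have hm : Measurable fun p : ℝ × ℝ => ENNReal.ofReal p.1 *
      (Metric.ball (0 : ℂ) r).indicator f (circleMap 0 p.1 p.2) :=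
    (ENNReal.measurable_ofReal.comp measurable_fst).mul
      ((hf.indicator Metric.isOpen_ball.measurableSet).comp hcm)
  simp only [hsymm, smul_eq_mul]
  rw [lintegral_prod _ hm.aemeasurable, ← lintegral_indicator measurableSet_Ioi,
    ← lintegral_indicator measurableSet_Ioo]
  refine lintegral_congr fun s => ?_
  by_cases hs : 0 < s
  · rw [indicator_of_mem (mem_Ioi.2 hs)]
    have hm' : Measurable fun θ => (Metric.ball (0 : ℂ) r).indicator f (circleMap 0 s θ) :=
      (hf.indicator Metric.isOpen_ball.measurableSet).comp
        (hcm.comp (measurable_const.prodMk measurable_id))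
    dsimp only
    rw [lintegral_const_mul _ hm', lintegral_Ioo_circleMap]
    by_cases hsr : s < r
    · rw [indicator_of_mem (show s ∈ Ioo 0 r from ⟨hs, hsr⟩)]
      congr 2
      funext θ
      rw [indicator_of_mem]
      simpa [abs_of_pos hs] using hsr
    · rw [indicator_of_notMem (fun h => hsr h.2)]
      have : ∀ θ, (Metric.ball (0 : ℂ) r).indicator f (circleMap 0 s θ) = 0 := fun θ => by
        rw [indicator_of_notMem]
        simpa [abs_of_pos hs] using hsr
      simp [this]
  · rw [indicator_of_notMem (show s ∉ Ioi 0 from hs), indicator_of_notMem (fun h => hs h.1)]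

/-- If all circle means of `f` about `1` are at most `B`, so are the disc means. The circles may
be parametrized from an arbitrary direction `u`. -/
theorem lintegral_discMeasure_le {f : ℂ → ENNReal} (hf : Measurable f) {r : ℝ} (hr : 0 < r)
    {B : ENNReal} {u : ℂ} (hu : ‖u‖ = 1)
    (h : ∀ s ∈ Ioo 0 r, ∫⁻ θ in Ioc 0 (2 * Real.pi), f (1 + u * circleMap 0 s θ) ≤
      ENNReal.ofReal (2 * Real.pi) * B) :
    ∫⁻ ξ, f ξ ∂discMeasure r ≤ B := by
  have hm : Measurable fun ξ : ℂ => f (1 + u * ξ) := hf.comp (by fun_prop)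
  have h1 : ∫⁻ ξ in Metric.ball 1 r, f ξ = ∫⁻ ξ in Metric.ball 0 r, f (1 + u * ξ) := by
    rw [← lintegral_indicator Metric.isOpen_ball.measurableSet,
      ← lintegral_indicator Metric.isOpen_ball.measurableSet,
      ← lintegral_add_left_eq_self _ (1 : ℂ)]
    have hrot := (rotation ⟨u, mem_sphere_zero_iff_norm.2 hu⟩).measurePreserving
    rw [← hrot.lintegral_comp_emb (rotation _).toMeasurableEquiv.measurableEmbedding]
    refine lintegral_congr fun ξ => ?_
    have hξ : (rotation ⟨u, mem_sphere_zero_iff_norm.2 hu⟩) ξ = u * ξ := rfl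
    simp only [hξ, indicator, Metric.mem_ball, dist_eq_norm,
      add_sub_cancel_left, norm_mul, hu, one_mul, sub_zero]
  have h2 : ∫⁻ ξ in Metric.ball (0 : ℂ) r, f (1 + u * ξ) ≤ volume (Metric.ball (0 : ℂ) r) * B := by
    have h3 := lintegral_ball_eq_polar (measurable_const (a := B)) r
    rw [setLIntegral_const, mul_comm] at h3
    rw [h3, lintegral_ball_eq_polar hm]
    refine setLIntegral_mono' measurableSet_Ioo fun s hs => ?_
    gcongr ENNReal.ofReal s * ?_
    refine (h s hs).trans_eq ?_
    rw [setLIntegral_const, Real.volume_Ioc, sub_zero, mul_comm]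
  rw [discMeasure, ProbabilityTheory.cond, lintegral_smul_measure, h1, smul_eq_mul]
  have hv : volume (Metric.ball (1 : ℂ) r) = volume (Metric.ball (0 : ℂ) r) := by
    simp only [Complex.volume_ball]
  rw [hv]
  have h0 : volume (Metric.ball (0 : ℂ) r) ≠ 0 := (Metric.measure_ball_pos volume _ hr).ne'
  calc _ ≤ (volume (Metric.ball (0 : ℂ) r))⁻¹ * (volume (Metric.ball (0 : ℂ) r) * B) := by gcongr
    _ = B := by rw [← mul_assoc, ENNReal.inv_mul_cancel h0 measure_ball_lt_top.ne, one_mul]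

end Circle

/-! ### Normalized functions are regular -/

section Normalized

variable {P : ℝ} [hP : Fact (0 < P)]

theorem continuous_const_sub_ereal (M : ℝ) : Continuous fun x : EReal => (M : EReal) - x := by
  refine continuous_iff_continuousAt.2 fun x => ?_
  have hn : ContinuousAt (fun x : EReal => ((M : EReal), -x)) x :=
    continuousAt_const.prodMk continuous_neg.continuousAt
  exact ContinuousAt.comp (g := fun p : EReal × EReal => p.1 + p.2)
    (f := fun x : EReal => ((M : EReal), -x))
    (EReal.continuousAt_add (Or.inl (EReal.coe_ne_top M)) (Or.inl (EReal.coe_ne_bot M))) hn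

theorem antitone_toENNReal_const_sub (M : ℝ) :
    Antitone fun x : EReal => ((M : EReal) - x).toENNReal := fun _ _ h =>
  EReal.toENNReal_le_toENNReal (EReal.sub_le_sub le_rfl h)

theorem lowerSemicontinuous_toENNReal_const_sub {X : Type*} [TopologicalSpace X] {v : X → EReal}
    (hv : UpperSemicontinuous v) (M : ℝ) :
    LowerSemicontinuous fun z => ((M : EReal) - v z).toENNReal :=
  (continuous_const_sub_ereal M).ereal_toENNReal.comp_upperSemicontinuous_antitone hv
    (antitone_toENNReal_const_sub M)

/-- A weighted submean inequality, expressed for the nonnegative function `M - x`. -/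
theorem lintegral_const_sub_le {α : Type*} [MeasurableSpace α] {μ : Measure α}
    [IsProbabilityMeasure μ] {x : α → EReal} (hx : Measurable x) {l : α → ℝ} (hl : Measurable l)
    {M l₁ l₂ y : ℝ} (hM0 : 0 ≤ M) (hM : ∀ a, x a ≤ M) (hl₁ : 0 < l₁)
    (hll : ∀ a, l₁ ≤ l a ∧ l a ≤ l₂)
    (h : (y : EReal) ≤ extIntegral μ fun a => x a * (l a : EReal)) :
    ∫⁻ a, ((M : EReal) - x a).toENNReal ∂μ ≤ ENNReal.ofReal ((l₂ * M - y) / l₁) := by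
  -- a point is needed only for `l₁ ≤ l₂`
  obtain ⟨a₀⟩ : Nonempty α := by
    by_contra hne
    rw [not_nonempty_iff] at hne
    exact IsProbabilityMeasure.ne_zero μ (Measure.eq_zero_of_isEmpty μ)
  have hl₂ : 0 < l₂ := hl₁.trans_le ((hll a₀).1.trans (hll a₀).2)
  have hpos : ∀ a, 0 < l a := fun a => hl₁.trans_le (hll a).1
  have hbd : ∀ a, x a * (l a : EReal) ≤ ((l₂ * M : ℝ) : EReal) := by
    intro a
    have h1 := hM a
    induction hxa : x a using EReal.rec with
    | bot => rw [EReal.bot_mul_coe_of_pos (hpos a)]; exact bot_le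
    | top => rw [hxa] at h1; exact absurd (top_le_iff.1 h1) (EReal.coe_ne_top M)
    | coe t =>
      rw [hxa, EReal.coe_le_coe_iff] at h1
      rw [← EReal.coe_mul, EReal.coe_le_coe_iff]
      nlinarith [hll a, hpos a]
  have hpt : ∀ a, ENNReal.ofReal l₁ * ((M : EReal) - x a).toENNReal ≤
      (((l₂ * M : ℝ) : EReal) - x a * (l a : EReal)).toENNReal := by
    intro a
    have h1 := hM a
    induction hxa : x a using EReal.rec with
    | bot => rw [EReal.bot_mul_coe_of_pos (hpos a), EReal.coe_sub_bot]; exact le_top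
    | top => rw [hxa] at h1; exact absurd (top_le_iff.1 h1) (EReal.coe_ne_top M)
    | coe t =>
      rw [hxa, EReal.coe_le_coe_iff] at h1
      rw [← EReal.coe_mul, ← EReal.coe_sub, ← EReal.coe_sub, EReal.real_coe_toENNReal,
        EReal.real_coe_toENNReal, ← ENNReal.ofReal_mul hl₁.le]
      refine ENNReal.ofReal_le_ofReal ?_
      nlinarith [hll a, hpos a]
  have hm : Measurable fun a => x a * (l a : EReal) := hx.mul hl.coe_real_ereal
  rw [extIntegral_eq_sub hm (by positivity) hbd] at h
  have h2 : ENNReal.ofReal l₁ * ∫⁻ a, ((M : EReal) - x a).toENNReal ∂μ ≤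
      ∫⁻ a, (((l₂ * M : ℝ) : EReal) - x a * (l a : EReal)).toENNReal ∂μ := by
    have hm' : Measurable fun a => ((M : EReal) - x a).toENNReal :=
      ((continuous_const_sub_ereal M).measurable.comp hx).ereal_toENNReal
    rw [← lintegral_const_mul _ hm']
    exact lintegral_mono hpt
  generalize ∫⁻ a, (((l₂ * M : ℝ) : EReal) - x a * (l a : EReal)).toENNReal ∂μ = J at h h2
  have hJ : J ≠ ⊤ := by
    rintro rfl
    simp at h
  lift J to NNReal using hJ
  have h3 : y ≤ l₂ * M - J := by
    have h4 : (y : EReal) ≤ ((l₂ * M * μ.real univ : ℝ) : EReal) - ((J : ℝ) : EReal) := h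
    rw [← EReal.coe_sub, EReal.coe_le_coe_iff, probReal_univ, mul_one] at h4
    exact h4
  rw [ENNReal.ofReal_div_of_pos hl₁, ENNReal.le_div_iff_mul_le (by simp [hl₁]) (by simp), mul_comm]
  refine h2.trans ?_
  rw [← ENNReal.ofReal_coe_nnreal]
  exact ENNReal.ofReal_le_ofReal (by linarith)

/-- The normalized arc length measure on the parameter interval of a circle. -/
noncomputable def circleMeasure : Measure ℝ :=
  (ENNReal.ofReal (2 * Real.pi))⁻¹ • (volume : Measure ℝ).restrict (Ioc 0 (2 * Real.pi))

theorem ofReal_two_pi_ne_zero : ENNReal.ofReal (2 * Real.pi) ≠ 0 := by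
  simp [Real.pi_pos]

instance isProbabilityMeasure_circleMeasure : IsProbabilityMeasure circleMeasure := by
  constructor
  rw [circleMeasure, Measure.smul_apply, Measure.restrict_apply_univ, Real.volume_Ioc, sub_zero,
    smul_eq_mul, ENNReal.inv_mul_cancel ofReal_two_pi_ne_zero ENNReal.ofReal_ne_top]

theorem lintegral_circle_eq (f : ℝ → ENNReal) :
    ∫⁻ θ in Ioc 0 (2 * Real.pi), f θ = ENNReal.ofReal (2 * Real.pi) * ∫⁻ θ, f θ ∂circleMeasure := by
  rw [circleMeasure, lintegral_smul_measure, smul_eq_mul, ← mul_assoc,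
    ENNReal.mul_inv_cancel ofReal_two_pi_ne_zero ENNReal.ofReal_ne_top, one_mul]

omit hP in
/-- Multiplication of `Z` by `ξ` is translation by `log ξ` on the torus. -/
theorem proj_log_exp_mul (w : ℝ × ℝ) {ξ : ℂ} (hξ : ξ ≠ 0) :
    proj P ((Complex.log (Complex.exp (w.1 + w.2 * Complex.I) * ξ)).re,
      (Complex.log (Complex.exp (w.1 + w.2 * Complex.I) * ξ)).im) = proj P w + plog P ξ := by
  have h : Complex.exp (Complex.log (Complex.exp (w.1 + w.2 * Complex.I) * ξ)) =
      Complex.exp (w.1 + w.2 * Complex.I + Complex.log ξ) := by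
    rw [Complex.exp_log (mul_ne_zero (Complex.exp_ne_zero _) hξ), Complex.exp_add _ (Complex.log ξ),
      Complex.exp_log hξ]
  obtain ⟨n, hn⟩ := Complex.exp_eq_exp_iff_exists_int.1 h
  rw [hn, plog, ← proj_add]
  refine Prod.ext ?_ ?_
  · simp [proj]
  · have : ((n : ℂ) * (2 * Real.pi * Complex.I)).im = n * (2 * Real.pi) := by simp
    simp only [proj, Complex.add_im, this, Prod.snd_add]
    rw [AddCircle.coe_add, AddCircle.coe_add]
    have h2 : (((n : ℝ) * (2 * Real.pi) : ℝ) : AddCircle (2 * Real.pi)) = 0 := by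
      rw [← zsmul_eq_mul, AddCircle.coe_zsmul, AddCircle.coe_period, smul_zero]
    rw [h2, add_zero]
    simp

omit hP in
theorem lift_exp_mul (ρ : ℝ) (v : Torus P → EReal) (w : ℝ × ℝ) {ξ : ℂ} (hξ : ξ ≠ 0) :
    lift ρ v (Complex.exp (w.1 + w.2 * Complex.I) * ξ) =
      v (proj P w + plog P ξ) * ((Real.exp w.1 ^ ρ * ‖ξ‖ ^ ρ : ℝ) : EReal) := by
  rw [lift, proj_log_exp_mul w hξ, norm_mul, Complex.norm_exp,
    Real.mul_rpow (Real.exp_pos _).le (norm_nonneg _)]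
  simp

omit hP in
/-- The submean inequality for the lift of `v`, on small discs. -/
theorem discMean_le_of_isSubharmonicOn {ρ : ℝ} {v : Torus P → EReal} (hv : UpperSemicontinuous v)
    {M : ℝ} (hM0 : 0 ≤ M) (hM : ∀ z, v z ≤ M) (hs : IsSubharmonicOn (lift ρ v) {0}ᶜ)
    {z : Torus P} {y : ℝ} (hy : v z = y) {l₁ l₂ r : ℝ} (hl₁ : 0 < l₁) (hr : 0 < r) (hr1 : r ≤ 1)
    (hll : ∀ ξ ∈ Metric.ball (1 : ℂ) r, l₁ ≤ ‖ξ‖ ^ ρ ∧ ‖ξ‖ ^ ρ ≤ l₂) :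
    discMean (fun z => ((M : EReal) - v z).toENNReal) z r ≤ ENNReal.ofReal ((l₂ * M - y) / l₁) := by
  obtain ⟨w, rfl⟩ := surjective_proj z
  set Z : ℂ := Complex.exp (w.1 + w.2 * Complex.I) with hZ
  have hZ0 : Z ≠ 0 := Complex.exp_ne_zero _
  have hZn : 0 < ‖Z‖ := norm_pos_iff.2 hZ0
  set c : ℝ := Real.exp w.1 ^ ρ with hc
  have hc0 : 0 < c := Real.rpow_pos_of_pos (Real.exp_pos _) _
  -- in terms of `ξ`, the circle about `Z` starts from the direction of `|Z| / Z`
  set u : ℂ := ‖Z‖ / Z with hu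
  have hu1 : ‖u‖ = 1 := by
    rw [hu, norm_div, Complex.norm_real, norm_norm, div_self hZn.ne']
  have hNm : Measurable fun z => ((M : EReal) - v z).toENNReal :=
    (lowerSemicontinuous_toENNReal_const_sub hv M).measurable
  refine lintegral_discMeasure_le (hNm.comp (measurable_plog.const_add _)) hr hu1 fun s hs' => ?_
  have hξball : ∀ θ, 1 + u * circleMap 0 s θ ∈ Metric.ball (1 : ℂ) r := fun θ => by
    rw [Metric.mem_ball, dist_eq_norm, add_sub_cancel_left, norm_mul, hu1, one_mul,
      norm_circleMap_zero, abs_of_pos hs'.1]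
    exact hs'.2
  have hξ0 : ∀ θ, 1 + u * circleMap 0 s θ ≠ 0 := fun θ h0 => by
    have := hξball θ
    rw [h0, Metric.mem_ball, dist_eq_norm, zero_sub, norm_neg, norm_one] at this
    linarith
  have hcirc : ∀ θ, circleMap Z (‖Z‖ * s) θ = Z * (1 + u * circleMap 0 s θ) := fun θ => by
    rw [hu, mul_add, mul_one, ← mul_assoc, mul_div_cancel₀ _ hZ0, circleMap, circleMap]
    push_cast
    ring
  have hsub := hs.submean Z hZ0 (‖Z‖ * s) (mul_pos hZn hs'.1) (by
    intro x hx hx0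
    rw [mem_singleton_iff] at hx0
    rw [hx0, Metric.mem_closedBall, dist_eq_norm, zero_sub, norm_neg] at hx
    nlinarith [hs'.2])
  have hZv : lift ρ v Z = ((y * c : ℝ) : EReal) := by
    have := lift_exp_mul ρ v w one_ne_zero
    rw [mul_one, plog_one, add_zero, hy, norm_one, Real.one_rpow, mul_one, ← EReal.coe_mul] at this
    exact this
  rw [hZv] at hsub
  simp only [hcirc] at hsub
  simp only [hZ, lift_exp_mul ρ v w (hξ0 _)] at hsub
  have hmain := lintegral_const_sub_le (μ := circleMeasure)
    (x := fun θ => v (proj P w + plog P (1 + u * circleMap 0 s θ)))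
    (l := fun θ => c * ‖1 + u * circleMap 0 s θ‖ ^ ρ)
    (hv.measurable.comp ((measurable_plog.comp (by unfold circleMap; fun_prop)).const_add _))
    (by unfold circleMap; fun_prop)
    hM0 (fun θ => hM _) (mul_pos hc0 hl₁) (l₂ := c * l₂) (fun θ =>
      ⟨mul_le_mul_of_nonneg_left (hll _ (hξball θ)).1 hc0.le,
        mul_le_mul_of_nonneg_left (hll _ (hξball θ)).2 hc0.le⟩) hsub
  rw [lintegral_circle_eq]
  gcongr
  refine hmain.trans_eq ?_
  congr 1
  field_simp

omit hP in
theorem regular_const_sub_of_isSubharmonicOn {ρ : ℝ} {v : Torus P → EReal}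
    (hv : UpperSemicontinuous v) {M : ℝ} (hM0 : 0 ≤ M) (hM : ∀ z, v z ≤ M)
    (hs : IsSubharmonicOn (lift ρ v) {0}ᶜ) :
    Regular fun z => ((M : EReal) - v z).toENNReal where
  lsc := lowerSemicontinuous_toENNReal_const_sub hv M
  mean_le z hz ε hε := by
    obtain ⟨y, hy⟩ : ∃ y : ℝ, v z = y := by
      have h1 : v z ≠ ⊤ := ((hM z).trans_lt (EReal.coe_lt_top M)).ne
      have h2 : v z ≠ ⊥ := fun h => hz (by simp [h])
      exact ⟨(v z).toReal, (EReal.coe_toReal h1 h2).symm⟩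
    rw [hy, ← EReal.coe_sub, EReal.real_coe_toENNReal]
    -- the bound for oscillation `δ` of the weight tends to `M - y` as `δ` tends to zero
    have ht : Tendsto (fun δ : ℝ => ENNReal.ofReal (((1 + δ) * M - y) / (1 - δ))) (𝓝 0)
        (𝓝 (ENNReal.ofReal (M - y))) := by
      refine ENNReal.tendsto_ofReal ?_
      have : ContinuousAt (fun δ : ℝ => ((1 + δ) * M - y) / (1 - δ)) 0 :=
        ContinuousAt.div (by fun_prop) (by fun_prop) (by norm_num)
      simpa using this.tendsto
    have h3 := ht.eventually (gt_mem_nhds (ENNReal.lt_add_right ENNReal.ofReal_ne_top hε))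
    obtain ⟨δ, hδ, hδ0, hδ1⟩ : ∃ δ : ℝ, ENNReal.ofReal (((1 + δ) * M - y) / (1 - δ)) <
        ENNReal.ofReal (M - y) + ε ∧ 0 < δ ∧ δ < 1 := by
      obtain ⟨δ, h4, h5⟩ := ((h3.filter_mono nhdsWithin_le_nhds).and
        (Ioo_mem_nhdsGT (zero_lt_one' ℝ))).exists
      exact ⟨δ, h4, h5.1, h5.2⟩
    have hcont : ContinuousAt (fun ξ : ℂ => ‖ξ‖ ^ ρ) 1 :=
      continuous_norm.continuousAt.rpow_const (Or.inl (by simp))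
    have h6 : ∀ᶠ ξ in 𝓝 (1 : ℂ), ‖ξ‖ ^ ρ ∈ Icc (1 - δ) (1 + δ) := by
      have h7 : Tendsto (fun ξ : ℂ => ‖ξ‖ ^ ρ) (𝓝 1) (𝓝 1) := by
        simpa using hcont.tendsto
      exact h7.eventually (Icc_mem_nhds (by linarith) (by linarith))
    obtain ⟨r₀, hr₀, hball⟩ := Metric.eventually_nhds_iff_ball.1 h6
    filter_upwards [Ioo_mem_nhdsGT hr₀, Ioo_mem_nhdsGT (zero_lt_one' ℝ)] with r hr hr1
    exact (discMean_le_of_isSubharmonicOn hv hM0 hM hs hy (sub_pos.2 hδ1) hr.1 hr1.2.le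
      fun ξ hξ => hball ξ (Metric.ball_subset_ball hr.2.le hξ)).trans hδ.le

end Normalized

/-! ### Kernel potentials are regular -/

section NearSup

variable {P : ℝ} [hP : Fact (0 < P)]

/-- The disc means of `k` about points near `w₀` exceed the values of `k` by an arbitrarily small
amount, uniformly. -/
def NearSup (k : Torus P → ENNReal) (w₀ : Torus P) : Prop :=
  ∀ ε : ENNReal, ε ≠ 0 →
    ∀ᶠ q : Torus P × ℝ in 𝓝 w₀ ×ˢ 𝓝[>] 0, discMean k q.1 q.2 ≤ k q.1 + ε

omit hP in
theorem nearSup_of_continuousAt {k : Torus P → ENNReal} {w₀ : Torus P} (hk : ContinuousAt k w₀)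
    (hfin : k w₀ ≠ ⊤) : NearSup k w₀ := by
  intro ε hε
  have hε2 : ε / 2 ≠ 0 := by simpa using hε
  have h1 : ∀ᶠ x in 𝓝 w₀, k x < k w₀ + ε / 2 :=
    hk.eventually (gt_mem_nhds (ENNReal.lt_add_right hfin hε2))
  have h2 : ∀ᶠ x in 𝓝 w₀, k w₀ ≤ k x + ε / 2 := by
    have h3 : ContinuousAt (fun x => k x + ε / 2) w₀ := hk.add continuousAt_const
    exact (h3.eventually (lt_mem_nhds (ENNReal.lt_add_right hfin hε2))).mono fun _ h => h.le
  filter_upwards [eventually_ae_discMeasure h1, tendsto_fst.eventually h2,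
    tendsto_snd.eventually self_mem_nhdsWithin] with q hq hq2 hr
  have := isProbabilityMeasure_discMeasure (r := q.2) hr
  calc discMean k q.1 q.2 ≤ ∫⁻ _, (k w₀ + ε / 2) ∂discMeasure q.2 :=
        lintegral_mono_ae (hq.mono fun ξ hξ => hξ.le)
    _ = k w₀ + ε / 2 := by simp
    _ ≤ k q.1 + ε / 2 + ε / 2 := by gcongr
    _ = k q.1 + ε := by rw [add_assoc, ENNReal.add_halves]

/-- Uniformity over the torus follows by compactness. -/
theorem eventually_forall_discMean_le {k : Torus P → ENNReal} (hk : ∀ w, NearSup k w)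
    {ε : ENNReal} (hε : ε ≠ 0) :
    ∀ᶠ r in 𝓝[>] (0 : ℝ), ∀ w, discMean k w r ≤ k w + ε := by
  have h := (isCompact_univ (X := Torus P)).mem_prod_nhdsSet_of_forall (l := 𝓝[>] (0 : ℝ))
    (s := {q : ℝ × Torus P | discMean k q.2 q.1 ≤ k q.2 + ε}) fun w _ => by
      rw [prod_comm]
      exact hk w ε hε
  rw [nhdsSet_univ] at h
  obtain ⟨s, hs, t, ht, hst⟩ := mem_prod_iff.1 h
  rw [mem_top] at ht
  filter_upwards [hs] with r hr w
  exact hst (mk_mem_prod hr (ht ▸ mem_univ w))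

/-- Lower semicontinuity of the potential is the lemma of Fatou, and the bound for its means is the
theorem of Tonelli. -/
theorem regular_lintegral_sub {k : Torus P → ENNReal} (hlsc : LowerSemicontinuous k)
    (hk : ∀ w, NearSup k w) (ν : Measure (Torus P)) [IsFiniteMeasure ν] :
    Regular fun z => ∫⁻ ζ, k (z - ζ) ∂ν where
  lsc := by
    refine lowerSemicontinuous_iff_le_liminf.2 fun z => ?_
    refine le_trans (lintegral_mono fun ζ => ?_)
      (lintegral_liminf_le fun z' => hlsc.measurable.comp (measurable_const.sub measurable_id))
    have : LowerSemicontinuous fun z' => k (z' - ζ) := hlsc.comp (continuous_sub_right ζ)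
    exact lowerSemicontinuous_iff_le_liminf.1 this z
  mean_le z _ ε hε := by
    have hm0 : ν univ + 1 ≠ 0 := by simp
    have hmt : ν univ + 1 ≠ ⊤ := by simp
    have hε' : ε / (ν univ + 1) ≠ 0 := (ENNReal.div_pos hε hmt).ne'
    filter_upwards [eventually_forall_discMean_le hk hε', self_mem_nhdsWithin] with r hr hr0
    have := isProbabilityMeasure_discMeasure hr0
    have hmeas : Measurable (Function.uncurry fun (ξ : ℂ) (ζ : Torus P) =>
        k (z + plog P ξ - ζ)) :=
      hlsc.measurable.comp
        (((measurable_plog.comp measurable_fst).const_add z).sub measurable_snd)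
    calc discMean (fun z => ∫⁻ ζ, k (z - ζ) ∂ν) z r
        = ∫⁻ ζ, discMean k (z - ζ) r ∂ν := by
          rw [discMean, lintegral_lintegral_swap hmeas.aemeasurable]
          refine lintegral_congr fun ζ => lintegral_congr fun ξ => ?_
          rw [sub_add_eq_add_sub]
      _ ≤ ∫⁻ ζ, (k (z - ζ) + ε / (ν univ + 1)) ∂ν := lintegral_mono fun ζ => hr (z - ζ)
      _ = (∫⁻ ζ, k (z - ζ) ∂ν) + ε / (ν univ + 1) * ν univ := by
          rw [lintegral_add_right _ measurable_const, lintegral_const]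
      _ ≤ (∫⁻ ζ, k (z - ζ) ∂ν) + ε / (ν univ + 1) * (ν univ + 1) := by
          gcongr
          exact le_self_add
      _ = _ := by rw [ENNReal.div_mul_cancel hm0 hmt]

end NearSup

/-! ### The logarithmic pole -/

section LogMean

variable {P : ℝ} [hP : Fact (0 < P)]

theorem norm_exp_sub_one_sq (x y : ℝ) :
    ‖Complex.exp (x + y * Complex.I) - 1‖ ^ 2 =
      Real.exp x * (2 * Real.cosh x - 2 * Real.cos y) := by
  have h1 := Real.exp_add x (-x)
  rw [add_neg_cancel, Real.exp_zero] at h1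
  rw [Complex.sq_norm, Complex.normSq_apply, Real.cosh_eq]
  simp only [Complex.sub_re, Complex.sub_im, Complex.one_re, Complex.one_im, Complex.exp_re,
    Complex.exp_im, Complex.add_re, Complex.add_im, Complex.ofReal_re, Complex.ofReal_im,
    Complex.mul_re, Complex.mul_im, Complex.I_re, Complex.I_im, mul_zero, mul_one, sub_zero,
    zero_add, add_zero]
  linear_combination Real.exp x ^ 2 * Real.sin_sq_add_cos_sq y + h1

/-- The formula `gap = e^{-x} |e^z - 1|²` at a translate by `log ξ`, as a function of `ξ`. -/
theorem gap_proj_add_plog {w : ℝ × ℝ} (hw : |w.1| < P / 16) {ξ : ℂ} (hξ : ξ ≠ 0)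
    (hξP : |Real.log ‖ξ‖| < P / 16) :
    gap (proj P w + plog P ξ) =
      Real.exp w.1 * ‖ξ‖⁻¹ * ‖ξ - Complex.exp (-(w.1 + w.2 * Complex.I))‖ ^ 2 := by
  have hp := hP.out
  have hξ0 : 0 < ‖ξ‖ := norm_pos_iff.2 hξ
  have habs : |w.1 + (Complex.log ξ).re| < P / 8 := by
    rw [Complex.log_re]
    have := abs_add_le w.1 (Real.log ‖ξ‖)
    linarith
  rw [plog, ← proj_add]
  have hc : cent ((w + ((Complex.log ξ).re, (Complex.log ξ).im)).1 : AddCircle P) =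
      w.1 + (Complex.log ξ).re := cent_coe_of_abs_lt (by
    simp only [Prod.fst_add]; linarith)
  rw [gap_strip (by rwa [hc]), hc]
  have h1 := norm_exp_sub_one_sq (w.1 + (Complex.log ξ).re) (w.2 + (Complex.log ξ).im)
  have h2 : Complex.exp (((w.1 + (Complex.log ξ).re : ℝ) : ℂ) +
      ((w.2 + (Complex.log ξ).im : ℝ) : ℂ) * Complex.I) =
      Complex.exp (w.1 + w.2 * Complex.I) * ξ := by
    conv_rhs => rw [← Complex.exp_log hξ]
    rw [← Complex.exp_add]
    congr 1
    conv_rhs => rw [← Complex.re_add_im (Complex.log ξ)]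
    push_cast
    ring
  have h3 : Complex.exp (w.1 + w.2 * Complex.I) * ξ - 1 = Complex.exp (w.1 + w.2 * Complex.I) *
      (ξ - Complex.exp (-(w.1 + w.2 * Complex.I))) := by
    rw [mul_sub, ← Complex.exp_add, add_neg_cancel, Complex.exp_zero]
  rw [h2, h3, norm_mul, Complex.norm_exp, Real.exp_add, Complex.log_re, Real.exp_log hξ0] at h1
  simp only [Complex.add_re, Complex.ofReal_re, Complex.mul_re, Complex.I_re, Complex.ofReal_im,
    Complex.I_im, mul_zero, zero_mul, sub_zero, add_zero, mul_pow] at h1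
  simp only [Prod.snd_add, Complex.log_re]
  have he := Real.exp_pos w.1
  field_simp
  apply mul_left_cancel₀ he.ne'
  linarith

/-- The logarithm `log ‖ξ - a‖` satisfies the submean inequality at `1`, and `log ‖ξ‖` has mean
zero over circles about `1` of radius less than `1`. -/
theorem integral_circle_log_le {s : ℝ} (hs0 : 0 < s) (hs1 : s < 1) {a : ℂ} (ha : a ≠ 1) (A : ℝ) :
    IntegrableOn (fun θ => A + Real.log ‖circleMap 1 s θ‖ - 2 * Real.log ‖circleMap 1 s θ - a‖)
        (Ioc 0 (2 * Real.pi)) volume ∧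
      ∫ θ in Ioc 0 (2 * Real.pi),
        (A + Real.log ‖circleMap 1 s θ‖ - 2 * Real.log ‖circleMap 1 s θ - a‖) ≤
        2 * Real.pi * (A - 2 * Real.log ‖1 - a‖) := by
  have hpi := Real.two_pi_pos
  have key : ∀ b : ℂ, IntegrableOn (fun θ => Real.log ‖circleMap 1 s θ - b‖)
      (Ioc 0 (2 * Real.pi)) volume ∧ ∫ θ in Ioc 0 (2 * Real.pi), Real.log ‖circleMap 1 s θ - b‖ =
        2 * Real.pi * (Real.log s + Real.posLog (s⁻¹ * ‖1 - b‖)) := fun b => by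
    have h1 := circleIntegrable_log_norm_sub_const (a := b) (c := 1) s
    have h2 := circleAverage_log_norm_sub_const_eq_log_radius_add_posLog (a := b) (c := 1) hs0.ne'
    rw [CircleIntegrable, intervalIntegrable_iff_integrableOn_Ioc_of_le hpi.le] at h1
    rw [Real.circleAverage_def, intervalIntegral.integral_of_le hpi.le, smul_eq_mul] at h2
    refine ⟨h1, ?_⟩
    rw [← h2, ← mul_assoc, mul_inv_cancel₀ hpi.ne', one_mul]
  obtain ⟨i0, e0⟩ := key 0
  obtain ⟨ia, ea⟩ := key a
  simp only [sub_zero, norm_one, mul_one] at i0 e0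
  have hz : Real.log s + Real.posLog s⁻¹ = 0 := by
    rw [Real.posLog_eq_log (by
      rw [abs_of_pos (inv_pos.2 hs0)]; exact (one_lt_inv₀ hs0).2 hs1 |>.le), Real.log_inv]
    ring
  have hna : 0 < ‖1 - a‖ := norm_pos_iff.2 (sub_ne_zero.2 ha.symm)
  have hl : Real.log ‖1 - a‖ ≤ Real.log s + Real.posLog (s⁻¹ * ‖1 - a‖) := by
    have h1 : Real.log (s⁻¹ * ‖1 - a‖) ≤ Real.posLog (s⁻¹ * ‖1 - a‖) := le_max_right _ _
    rw [Real.log_mul (inv_pos.2 hs0).ne' hna.ne', Real.log_inv] at h1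
    linarith
  have iA : IntegrableOn (fun _ : ℝ => A) (Ioc 0 (2 * Real.pi)) volume := by
    rw [integrableOn_const_iff]
    exact Or.inr measure_Ioc_lt_top
  have i1 : IntegrableOn (fun θ => A + Real.log ‖circleMap 1 s θ‖) (Ioc 0 (2 * Real.pi)) volume :=
    iA.add i0
  refine ⟨i1.sub (ia.const_mul 2), ?_⟩
  rw [integral_sub i1 (ia.const_mul 2), integral_add iA i0, integral_const_mul, e0, ea, hz]
  simp only [integral_const, measureReal_restrict_apply_univ, Real.volume_real_Ioc_of_le hpi.le,
    sub_zero, smul_eq_mul, mul_zero, add_zero]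
  nlinarith

theorem eventually_abs_log_norm_lt {δ : ℝ} (hδ : 0 < δ) :
    ∀ᶠ r in 𝓝[>] (0 : ℝ), ∀ ξ ∈ Metric.ball (1 : ℂ) r, |Real.log ‖ξ‖| < δ := by
  have h1 : Tendsto (fun ξ : ℂ => |Real.log ‖ξ‖|) (𝓝 1) (𝓝 0) := by
    have : ContinuousAt (fun ξ : ℂ => |Real.log ‖ξ‖|) 1 :=
      (continuous_norm.continuousAt.log (by simp)).abs
    simpa using this.tendsto
  obtain ⟨r₀, hr₀, hb⟩ := Metric.eventually_nhds_iff_ball.1 (h1.eventually (gt_mem_nhds hδ))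
  filter_upwards [Ioo_mem_nhdsGT hr₀] with r hr ξ hξ
  exact hb ξ (Metric.ball_subset_ball hr.2.le hξ)

theorem eventually_gap_lt_one : ∀ᶠ z : Torus P in 𝓝 0, gap z < 1 := by
  have := (isTest_gap (P := P)).continuous.tendsto 0
  rw [(gap_eq_zero_iff 0).2 rfl] at this
  exact this.eventually (gt_mem_nhds one_pos)

/-- Near the origin, `1 - log gap` satisfies the supermean inequality. -/
theorem eventually_discMean_log_gap_le :
    ∀ᶠ q : Torus P × ℝ in 𝓝 0 ×ˢ 𝓝[>] 0, q.1 ≠ 0 →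
      discMean (fun z => ENNReal.ofReal (1 - Real.log (gap z))) q.1 q.2 ≤
        ENNReal.ofReal (1 - Real.log (gap q.1)) := by
  have hp := hP.out
  have hc : ∀ᶠ z : Torus P in 𝓝 0, |cent z.1| < P / 16 := by
    have := continuous_abs_cent (P := P).tendsto 0
    exact this.eventually (gt_mem_nhds (by
      simp only [Prod.fst_zero, cent_zero, abs_zero]; positivity))
  filter_upwards [tendsto_fst.eventually hc, eventually_forall_ball eventually_gap_lt_one,
    tendsto_snd.eventually self_mem_nhdsWithin,
    tendsto_snd.eventually (Ioo_mem_nhdsGT one_pos),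
    tendsto_snd.eventually (eventually_abs_log_norm_lt (by positivity : 0 < P / 16))]
  rintro ⟨z, r⟩ hz hgr hr0 hr1 hlog hne
  simp only at hz hgr hr0 hr1 hlog hne ⊢
  obtain ⟨w, rfl, hw⟩ : ∃ w : ℝ × ℝ, proj P w = z ∧ |w.1| < P / 16 := by
    obtain ⟨y, hy⟩ := QuotientAddGroup.mk_surjective z.2
    exact ⟨(cent z.1, y), Prod.ext (coe_cent z.1) hy, hz⟩
  set a : ℂ := Complex.exp (-(w.1 + w.2 * Complex.I)) with ha
  have hm : Measurable fun z : Torus P => ENNReal.ofReal (1 - Real.log (gap z)) :=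
    ENNReal.measurable_ofReal.comp
      (measurable_const.sub (Real.measurable_log.comp measurable_gap))
  have hgap : ∀ ξ ∈ Metric.ball (1 : ℂ) r, gap (proj P w + plog P ξ) =
      Real.exp w.1 * ‖ξ‖⁻¹ * ‖ξ - a‖ ^ 2 := fun ξ hξ => by
    refine gap_proj_add_plog hw ?_ (hlog ξ hξ)
    rintro rfl
    rw [Metric.mem_ball, dist_eq_norm, zero_sub, norm_neg, norm_one] at hξ
    linarith [hr1.2]
  have hgap1 : gap (proj P w) = Real.exp w.1 * ‖1 - a‖ ^ 2 := by
    have := hgap 1 (Metric.mem_ball_self hr0)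
    rwa [plog_one, add_zero, norm_one, inv_one, mul_one] at this
  have ha1 : a ≠ 1 := by
    intro h
    have := gap_pos hne
    rw [hgap1, h, sub_self, norm_zero] at this
    simp at this
  have hna : ‖1 - a‖ ≠ 0 := norm_ne_zero_iff.2 (sub_ne_zero.2 ha1.symm)
  have hlog1 : Real.log (gap (proj P w)) = w.1 + 2 * Real.log ‖1 - a‖ := by
    rw [hgap1, Real.log_mul (Real.exp_pos _).ne' (pow_ne_zero 2 hna), Real.log_exp, Real.log_pow]
    norm_num
  refine lintegral_discMeasure_le (u := 1) (hm.comp (measurable_plog.const_add _)) hr0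
    norm_one fun s hs => ?_
  have hcm : ∀ θ, 1 + 1 * circleMap 0 s θ = circleMap 1 s θ := fun θ => by
    simp [circleMap]
  have hin : ∀ θ, circleMap 1 s θ ∈ Metric.ball (1 : ℂ) r := fun θ => by
    rw [Metric.mem_ball, dist_eq_norm, circleMap_sub_center, norm_circleMap_zero, abs_of_pos hs.1]
    exact hs.2
  simp only [hcm, Function.comp_apply]
  -- the logarithm of zero is zero, so the point `a` has to be left out
  have hae : ∀ᵐ θ ∂volume.restrict (Ioc 0 (2 * Real.pi)), circleMap 1 s θ ≠ a :=
    ae_restrict_of_ae (((countable_singleton a).preimage_circleMap 1 hs.1.ne').ae_notMem _)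
  have hform : ∀ θ, circleMap 1 s θ ≠ a → 1 - Real.log (gap (proj P w + plog P (circleMap 1 s θ))) =
      1 - w.1 + Real.log ‖circleMap 1 s θ‖ - 2 * Real.log ‖circleMap 1 s θ - a‖ := fun θ hθ => by
    have h0 : ‖circleMap 1 s θ‖ ≠ 0 := fun h => by
      have h1 := hin θ
      rw [norm_eq_zero.1 h, Metric.mem_ball, dist_eq_norm, zero_sub, norm_neg, norm_one] at h1
      linarith [hr1.2]
    have h1 : ‖circleMap 1 s θ - a‖ ≠ 0 := norm_ne_zero_iff.2 (sub_ne_zero.2 hθ)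
    rw [hgap _ (hin θ), Real.log_mul (mul_ne_zero (Real.exp_pos _).ne' (inv_ne_zero h0))
      (pow_ne_zero 2 h1), Real.log_mul (Real.exp_pos _).ne' (inv_ne_zero h0), Real.log_exp,
      Real.log_inv, Real.log_pow]
    push_cast
    ring
  obtain ⟨hint, hle⟩ := integral_circle_log_le hs.1 (hs.2.trans hr1.2) ha1 (1 - w.1)
  rw [lintegral_congr_ae (hae.mono fun θ hθ => congrArg ENNReal.ofReal (hform θ hθ)),
    ← ofReal_integral_eq_lintegral_ofReal hint (hae.mono fun θ hθ => by
      dsimp only [Pi.zero_apply]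
      rw [← hform θ hθ]
      have := Real.log_nonpos (gap_nonneg _) (hgr _ (hin θ)).le
      linarith), ← ENNReal.ofReal_mul Real.two_pi_pos.le]
  refine ENNReal.ofReal_le_ofReal (hle.trans_eq ?_)
  rw [hlog1]
  ring

end LogMean

/-! ### The representation at every point -/

section Everywhere

variable {P : ℝ} [hP : Fact (0 < P)]

/-- The weight differs from `1` by `O(|x|)`, which beats the logarithmic pole. -/
theorem continuousAt_weight_sub_one_mul_log_gap (ρ : ℝ) :
    ContinuousAt (fun z : Torus P => (weight ρ z - 1) * Real.log (gap z)) 0 := by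
  have hp := hP.out
  have h0 : (weight ρ (0 : Torus P) - 1) * Real.log (gap (0 : Torus P)) = 0 := by
    rw [weight_zero, sub_self, zero_mul]
  have hcont := continuous_abs_cent (P := P)
  have hc0 : |cent (0 : Torus P).1| = 0 := by rw [Prod.fst_zero, cent_zero, abs_zero]
  have hsmall : ∀ {δ : ℝ}, 0 < δ → ∀ᶠ z : Torus P in 𝓝 0, |cent z.1| < δ := fun hδ =>
    (hcont.tendsto 0).eventually (gt_mem_nhds (by rwa [hc0]))
  have hlim : Tendsto (fun z : Torus P => 4 * |ρ| * |(|cent z.1| * Real.log |cent z.1|)|)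
      (𝓝 0) (𝓝 0) := by
    have : Continuous fun z : Torus P => 4 * |ρ| * |(|cent z.1| * Real.log |cent z.1|)| :=
      continuous_const.mul (Real.continuous_mul_log.comp hcont).abs
    have h := this.tendsto 0
    simp only [hc0] at h
    simpa using h
  rw [ContinuousAt, h0]
  have hρ1 : 0 < 1 / (|ρ| + 1) := by positivity
  refine squeeze_zero_norm' ?_ hlim
  filter_upwards [eventually_gap_lt_one, hsmall (by positivity : 0 < P / 8), hsmall one_pos,
    hsmall hρ1] with z hz1 hz2 hz3 hz4
  rcases eq_or_ne (cent z.1) 0 with hx | hx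
  · rw [weight_strip hz2, hx]
    simp
  · have hx2 : 0 < cent z.1 ^ 2 := by positivity
    have hle : cent z.1 ^ 2 ≤ gap z := by
      have h1 := min_le_gap z
      have h2 : cent z.1 ^ 2 ≤ 1 := by
        rw [← sq_abs]
        nlinarith [abs_nonneg (cent z.1)]
      rwa [min_eq_right h2] at h1
    have hl1 : Real.log (gap z) ≤ 0 := Real.log_nonpos (gap_nonneg z) hz1.le
    have hl2 : 2 * Real.log |cent z.1| ≤ Real.log (gap z) := by
      have := Real.log_le_log hx2 hle
      rw [Real.log_pow] at this
      rw [Real.log_abs]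
      exact_mod_cast this
    have hρx : |-ρ * cent z.1| ≤ |ρ| * |cent z.1| := by rw [abs_mul, abs_neg]
    have hexp : |Real.exp (-ρ * cent z.1) - 1| ≤ 2 * (|ρ| * |cent z.1|) := by
      refine (Real.abs_exp_sub_one_le ?_).trans (by linarith)
      refine hρx.trans ?_
      rw [lt_div_iff₀ (by positivity)] at hz4
      nlinarith [abs_nonneg (cent z.1)]
    rw [weight_strip hz2, Real.norm_eq_abs, abs_mul, abs_mul, abs_abs]
    have h3 : |Real.log (gap z)| ≤ 2 * |Real.log (|cent z.1|)| := by
      rw [abs_of_nonpos hl1, abs_of_nonpos (by linarith : Real.log |cent z.1| ≤ 0)]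
      linarith
    calc _ ≤ 2 * (|ρ| * |cent z.1|) * (2 * |Real.log (|cent z.1|)|) := by gcongr
      _ = _ := by ring

/-- Near its pole a kernel is, up to a continuous function, a positive multiple of `log gap`,
which is subharmonic in the coordinate `e^z`. -/
theorem nearSup_const_sub_kernelE (ρ : ℝ) {h : Torus P → ℝ} (hh : IsTest h) {M : ℝ}
    (hM : 1 / poleMass + h 0 < M) (w₀ : Torus P) :
    NearSup (fun z => ((M : EReal) - kernelE ρ h z).toENNReal) w₀ := by
  have hcontk : Continuous fun z => ((M : EReal) - kernelE ρ h z).toENNReal :=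
    ((continuous_const_sub_ereal M).comp (continuous_kernelE ρ hh)).ereal_toENNReal
  by_cases hw₀ : w₀ ≠ 0
  · refine nearSup_of_continuousAt hcontk.continuousAt ?_
    rw [kernelE_of_ne ρ h hw₀, ← EReal.coe_sub, EReal.real_coe_toENNReal]
    exact ENNReal.ofReal_ne_top
  rw [not_not] at hw₀
  subst hw₀
  set c : ℝ := poleMass with hc
  have hc0 : 0 < c := poleMass_pos
  -- off the pole, `M - E = (1 - log gap) / c + b` with `b` continuous and positive at the pole
  set b : Torus P → ℝ := fun z =>
    M - 1 / c - h z - (weight ρ z - 1) * Real.log (gap z) / c with hb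
  have hbc : ContinuousAt b 0 :=
    (continuousAt_const.sub hh.continuous.continuousAt).sub
      ((continuousAt_weight_sub_one_mul_log_gap ρ).div_const c)
  have hb0 : 0 < b 0 := by
    simp only [hb, weight_zero, sub_self, zero_mul, zero_div, sub_zero]
    linarith
  have hkE : ∀ z : Torus P, z ≠ 0 → ((M : EReal) - kernelE ρ h z).toENNReal =
      ENNReal.ofReal (1 / c * (1 - Real.log (gap z)) + b z) := fun z hz => by
    rw [kernelE_of_ne ρ h hz, ← EReal.coe_sub, EReal.real_coe_toENNReal]
    congr 1
    simp only [kernelReal, regLog, hb, add_zero, ← hc]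
    field_simp
    ring
  set L : Torus P → ENNReal := fun z => ENNReal.ofReal (1 - Real.log (gap z)) with hL
  have hLm : Measurable L := ENNReal.measurable_ofReal.comp
    (measurable_const.sub (Real.measurable_log.comp measurable_gap))
  have hB : NearSup (fun z => ENNReal.ofReal (b z)) 0 :=
    nearSup_of_continuousAt (ENNReal.continuous_ofReal.continuousAt.comp hbc) ENNReal.ofReal_ne_top
  intro ε hε
  filter_upwards [hB ε hε, eventually_discMean_log_gap_le,
    tendsto_fst.eventually eventually_gap_lt_one,
    tendsto_fst.eventually (hbc.eventually (lt_mem_nhds hb0))]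
  rintro ⟨z, r⟩ h1 h2 h3 h4
  simp only at h1 h2 h3 h4 ⊢
  -- at the pole itself `M - E` is infinite
  by_cases hz : z = 0
  · rw [hz, kernelE_zero]
    simp
  have hlog : 0 ≤ 1 - Real.log (gap z) := by
    have := Real.log_nonpos (gap_nonneg z) h3.le
    linarith
  have hae : ∀ᵐ x : Torus P, ((M : EReal) - kernelE ρ h x).toENNReal ≤
      ENNReal.ofReal (1 / c) * L x + ENNReal.ofReal (b x) := by
    filter_upwards [ae_ne_zero] with x hx
    rw [hkE x hx, hL, ← ENNReal.ofReal_mul (by positivity)]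
    exact ENNReal.ofReal_add_le
  calc _ ≤ discMean (fun x => ENNReal.ofReal (1 / c) * L x + ENNReal.ofReal (b x)) z r :=
        discMean_mono_ae hae z r
    _ = ENNReal.ofReal (1 / c) * discMean L z r + discMean (fun x => ENNReal.ofReal (b x)) z r := by
        have hm : Measurable fun ξ => L (z + plog P ξ) := hLm.comp (measurable_plog.const_add z)
        rw [discMean_add (hLm.const_mul _), discMean, lintegral_const_mul _ hm]
        rfl
    _ ≤ ENNReal.ofReal (1 / c) * L z + (ENNReal.ofReal (b z) + ε) := by
        gcongr
        exact h2 hz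
    _ = _ := by
        rw [hkE z hz, hL, ← ENNReal.ofReal_mul (by positivity), ← add_assoc,
          ← ENNReal.ofReal_add (by positivity) h4.le]

/-- Rewriting `v = T - n + c` without subtraction. -/
theorem const_sub_add_eq_iff {v : EReal} {n : ENNReal} {M T c K : ℝ} (hv : v ≤ M) (hK : 0 ≤ K)
    (hc : 0 ≤ K + M - T - c) :
    ((M : EReal) - v).toENNReal + ENNReal.ofReal K = n + ENNReal.ofReal (K + M - T - c) ↔
      v = (T : EReal) - (n : EReal) + (c : EReal) := by
  induction v using EReal.rec with
  | top => exact absurd (top_le_iff.1 hv) (EReal.coe_ne_top M)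
  | bot =>
    rw [EReal.coe_sub_bot, EReal.toENNReal_top, top_add]
    induction n with
    | top => simp
    | coe n =>
      constructor
      · intro h
        exact absurd h.symm (ENNReal.add_ne_top.2 ⟨ENNReal.coe_ne_top, ENNReal.ofReal_ne_top⟩)
      · intro h
        change (⊥ : EReal) = (T : EReal) - ((n : ℝ) : EReal) + (c : EReal) at h
        rw [← EReal.coe_sub, ← EReal.coe_add] at h
        exact absurd h.symm (EReal.coe_ne_bot _)
  | coe v =>
    rw [EReal.coe_le_coe_iff] at hv
    rw [← EReal.coe_sub, EReal.real_coe_toENNReal, ← ENNReal.ofReal_add (by linarith) hK]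
    induction n with
    | top => simp
    | coe n =>
      change _ ↔ (v : EReal) = (T : EReal) - ((n : ℝ) : EReal) + (c : EReal)
      rw [← EReal.coe_sub, ← EReal.coe_add, EReal.coe_eq_coe_iff, ← ENNReal.ofReal_coe_nnreal,
        ← ENNReal.ofReal_add n.coe_nonneg hc,
        ENNReal.ofReal_eq_ofReal_iff (by linarith) (by positivity)]
      constructor <;> intro h <;> linarith

theorem exists_le_of_upperSemicontinuous {v : Torus P → EReal} (hv : UpperSemicontinuous v)
    (ht : ∀ z, v z < ⊤) : ∃ M : ℝ, 0 ≤ M ∧ ∀ z, v z ≤ M := by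
  obtain ⟨z₀, -, hz₀⟩ := UpperSemicontinuousOn.exists_isMaxOn univ_nonempty isCompact_univ
    (hv.upperSemicontinuousOn univ)
  refine ⟨max 0 (v z₀).toReal, le_max_left _ _, fun z => ?_⟩
  refine (hz₀ (mem_univ z)).trans ((EReal.le_coe_toReal (ht z₀).ne).trans ?_)
  exact EReal.coe_le_coe_iff.2 (le_max_right _ _)

/-- A normalized function that agrees almost everywhere with a kernel potential plus a continuous
function agrees with it everywhere. -/
theorem eq_potential_add_of_isSubharmonicOn {σ ρ : ℝ} {v : Torus P → EReal}
    (hv : UpperSemicontinuous v) (ht : ∀ z, v z < ⊤) {h : Torus P → ℝ} (hh : IsTest h)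
    {ν : Measure (Torus P)} [IsFiniteMeasure ν] {c : Torus P → ℝ} (hc : Continuous c)
    (hae : ∀ᵐ z, v z = potential (kernelE ρ h) ν z + (c z : EReal))
    (hs : IsSubharmonicOn (lift σ v) {0}ᶜ) (z : Torus P) :
    v z = potential (kernelE ρ h) ν z + (c z : EReal) := by
  obtain ⟨M, hM0, hM⟩ := exists_le_of_upperSemicontinuous hv ht
  have hEc := continuous_kernelE ρ hh
  obtain ⟨M₁, hM₁0, hM₁⟩ := exists_le_of_upperSemicontinuous hEc.upperSemicontinuous fun z => by
    by_cases hz : z = 0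
    · rw [hz, kernelE_zero]; exact bot_lt_top
    · rw [kernelE_of_ne ρ h hz]; exact EReal.coe_lt_top _
  obtain ⟨z₀, -, hz₀⟩ := isCompact_univ.exists_isMaxOn univ_nonempty hc.continuousOn
  have hcz : ∀ z, c z ≤ c z₀ := fun z => hz₀ (mem_univ z)
  set M₂ : ℝ := max M₁ (1 / poleMass + h 0 + 1) with hM₂
  have hM₂0 : 0 ≤ M₂ := hM₁0.trans (le_max_left _ _)
  have hM₂E : ∀ z, kernelE ρ h z ≤ M₂ := fun z =>
    (hM₁ z).trans (EReal.coe_le_coe_iff.2 (le_max_left _ _))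
  have hM₂h : 1 / poleMass + h 0 < M₂ :=
    lt_of_lt_of_le (by linarith) (le_max_right M₁ (1 / poleMass + h 0 + 1))
  set T : ℝ := M₂ * ν.real univ with hT
  set N : Torus P → ENNReal := fun z => ∫⁻ ζ, ((M₂ : EReal) - kernelE ρ h (z - ζ)).toENNReal ∂ν
  have hpot : ∀ z, potential (kernelE ρ h) ν z = (T : EReal) - (N z : EReal) := fun z =>
    extIntegral_eq_sub (hEc.measurable.comp (measurable_const.sub measurable_id)) hM₂0
      fun ζ => hM₂E _
  -- a constant that makes both sides of the identity nonnegative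
  set K : ℝ := max 0 (T + c z₀ - M)
  have hK0 : 0 ≤ K := le_max_left _ _
  have hKc : ∀ z, 0 ≤ K + M - T - c z := fun z => by
    have : T + c z₀ - M ≤ K := le_max_right _ _
    linarith [hcz z]
  have hN : Regular N := regular_lintegral_sub
    (lowerSemicontinuous_toENNReal_const_sub hEc.upperSemicontinuous M₂)
    (nearSup_const_sub_kernelE ρ hh hM₂h) ν
  have h1 : Regular fun z => ((M : EReal) - v z).toENNReal + ENNReal.ofReal K :=
    (regular_const_sub_of_isSubharmonicOn hv hM0 hM hs).add (regular_ofReal continuous_const)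
  have h2 : Regular fun z => N z + ENNReal.ofReal (K + M - T - c z) :=
    hN.add (regular_ofReal (by fun_prop))
  rw [hpot]
  refine (const_sub_add_eq_iff (hM z) hK0 (hKc z)).1 (h1.eq_of_ae_eq h2 ?_ z)
  filter_upwards [hae] with x hx
  rw [hpot] at hx
  exact (const_sub_add_eq_iff (hM x) hK0 (hKc x)).2 hx

theorem kernelE_add (ρ : ℝ) (h c : Torus P → ℝ) (z : Torus P) :
    kernelE ρ (fun z => h z + c z) z = kernelE ρ h z + (c z : EReal) := by
  by_cases hz : z = 0
  · rw [hz, kernelE_zero, kernelE_zero, EReal.bot_add]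
  · rw [kernelE_of_ne ρ _ hz, kernelE_of_ne ρ _ hz, ← EReal.coe_add, kernelReal, kernelReal,
      add_assoc]

theorem exists_isFundamentalSolution_kernelE {ρ : ℝ} (hρ : ∀ n : ℤ, ρ ≠ n) :
    ∃ h : Torus P → ℝ, IsTest h ∧ IsFundamentalSolution P ρ (kernelE ρ h) :=
  exists_isKernel ρ (isTest_const 0) fun m k h0 => by
    rcases ((symb_eq_zero_iff ρ m k).1 h0).2 with h | h
    · exact absurd h (hρ k)
    · exact absurd (by rw [h]; push_cast; rfl) (hρ (-k))

theorem IsFundamentalSolution.unique {ρ : ℝ} (hρ : ∀ n : ℤ, ρ ≠ n) {E E' : Torus P → EReal}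
    (hE : IsFundamentalSolution P ρ E) (hE' : IsFundamentalSolution P ρ E') : E' = E := by
  funext z
  obtain ⟨hi, hw⟩ := IsKernel.weak_null_sub hE hE'
  have h0 : (fun z => (E' z).toReal - (E z).toReal) =ᵐ[volume] fun _ => (0 : ℝ) :=
    ae_eq_zero_of_weak_null hρ hi hw
  simpa using IsKernel.eq_add_of_ae hE hE' continuous_const h0 z

theorem existsUnique_isFundamentalSolution {ρ : ℝ} (hρ : ∀ n : ℤ, ρ ≠ n) :
    ∃! E : Torus P → EReal, IsFundamentalSolution P ρ E := by
  obtain ⟨h, -, hE⟩ := exists_isFundamentalSolution_kernelE (P := P) hρ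
  exact ⟨kernelE ρ h, hE, fun E' hE' => hE.unique hρ hE'⟩

theorem exists_isGenFundamentalSolution_kernelE (p : ℤ) :
    ∃ h : Torus P → ℝ, IsTest h ∧ IsGenFundamentalSolution P p (kernelE p h) :=
  exists_isKernel _ (isTest_resonance p) (coeffT_resonance p)

theorem IsGenFundamentalSolution.exists_eq_kernelE {p : ℤ} {E : Torus P → EReal}
    (hE : IsGenFundamentalSolution P p E) : ∃ h, IsTest h ∧ E = kernelE p h := by
  obtain ⟨h, hh, hE₀⟩ := exists_isGenFundamentalSolution_kernelE (P := P) p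
  obtain ⟨hi, hw⟩ := IsKernel.weak_null_sub hE₀ hE
  obtain ⟨C, hC⟩ := ae_eq_trig_of_weak_null hi hw
  refine ⟨fun z => h z + trig C 0 p z, hh.add (isTest_trig C 0 p), funext fun z => ?_⟩
  rw [IsKernel.eq_add_of_ae hE₀ hE (isTest_trig C 0 p).continuous hC, kernelE_add]

/-- The representation of subfunctions for a nonintegral exponent. -/
theorem IsSubfunction.eq_potential {ρ : ℝ} (hρ : ∀ n : ℤ, ρ ≠ n) {v E : Torus P → EReal}
    (hv : IsSubfunction P ρ v) {ν : Measure (Torus P)} (hν : IsRieszMeasure P ρ v ν)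
    (hE : IsFundamentalSolution P ρ E) :
    (∀ᵐ z, v z = potential E ν z) ∧
      (IsSubharmonicOn (lift ρ v) {0}ᶜ → ∀ z, v z = potential E ν z) := by
  have := hν.finite
  obtain ⟨hi, hw⟩ := hv.weak_null_sub_potReal hν hE (isTest_const 0) (by simp)
  have h0 : (fun z => (v z).toReal - potReal E ν z) =ᵐ[volume] fun _ => (0 : ℝ) :=
    ae_eq_zero_of_weak_null hρ hi hw
  have hae := hv.ae_eq_potential_add hν hE h0
  refine ⟨by simpa using hae, fun hs z => ?_⟩
  obtain ⟨h, hh, hE₀⟩ := exists_isFundamentalSolution_kernelE (P := P) hρ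
  obtain rfl := hE₀.unique hρ hE
  simpa using eq_potential_add_of_isSubharmonicOn hv.usc hv.lt_top hh continuous_const hae hs z

/-- The representation of subfunctions for an integral exponent. -/
theorem IsSubfunction.exists_eq_potential_add {p : ℤ} {v E : Torus P → EReal}
    (hv : IsSubfunction P p v) {ν : Measure (Torus P)} (hν : IsRieszMeasure P p v ν)
    (hE : IsGenFundamentalSolution P p E) :
    ∃ C : ℂ, (∀ᵐ z, v z = potential E ν z + (((C * expIY p z).re : ℝ) : EReal)) ∧
      (IsSubharmonicOn (lift (p : ℝ) v) {0}ᶜ →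
        ∀ z, v z = potential E ν z + (((C * expIY p z).re : ℝ) : EReal)) := by
  have := hν.finite
  obtain ⟨hi, hw⟩ := hv.weak_null_sub_potReal hν hE (isTest_resonance p)
    (integral_resonance_sub hν)
  obtain ⟨C, hC⟩ := ae_eq_trig_of_weak_null hi hw
  have hae := hv.ae_eq_potential_add hν hE hC
  simp only [expIY_eq_expT]
  refine ⟨C, hae, fun hs z => ?_⟩
  obtain ⟨h, hh, rfl⟩ := hE.exists_eq_kernelE
  exact eq_potential_add_of_isSubharmonicOn hv.usc hv.lt_top hh
    (isTest_trig C 0 p).continuous hae hs z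

theorem IsRieszMeasure.integral_expIY {p k : ℤ} {v : Torus P → EReal} {ν : Measure (Torus P)}
    (hν : IsRieszMeasure P p v ν) (hk : p = k ∨ p = -k) : ∫ z, expIY k z ∂ν = 0 := by
  simp only [expIY_eq_expT]
  refine hν.integral_expT ((symb_eq_zero_iff _ _ _).2 ⟨rfl, ?_⟩)
  exact_mod_cast hk

end Everywhere

end LRho

theorem mainTheorem11 (P : ℝ) [Fact (0 < P)] :
    (∀ ρ : ℝ, 0 < ρ → (∀ n : ℤ, ρ ≠ n) →
      (∃! E : LRho.Torus P → EReal, LRho.IsFundamentalSolution P ρ E) ∧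
      ∀ v : LRho.Torus P → EReal, LRho.IsSubfunction P ρ v →
        (∃! ν : Measure (LRho.Torus P), LRho.IsRieszMeasure P ρ v ν) ∧
        ∀ ν : Measure (LRho.Torus P), LRho.IsRieszMeasure P ρ v ν →
        ∀ E : LRho.Torus P → EReal, LRho.IsFundamentalSolution P ρ E →
          (∀ᵐ z ∂(volume : Measure (LRho.Torus P)), v z = LRho.potential E ν z) ∧
          (LRho.IsSubharmonicOn (LRho.lift ρ v) {0}ᶜ → ∀ z, v z = LRho.potential E ν z)) ∧
    (∀ p : ℤ,
      (∃ E : LRho.Torus P → EReal, LRho.IsGenFundamentalSolution P p E) ∧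
      ∀ v : LRho.Torus P → EReal, LRho.IsSubfunction P p v →
        (∃! ν : Measure (LRho.Torus P), LRho.IsRieszMeasure P p v ν) ∧
        ∀ ν : Measure (LRho.Torus P), LRho.IsRieszMeasure P p v ν →
          (∫ z, LRho.expIY p z ∂ν = 0 ∧ ∫ z, LRho.expIY (-p) z ∂ν = 0) ∧
          ∀ E : LRho.Torus P → EReal, LRho.IsGenFundamentalSolution P p E →
            ∃ C : ℂ,
              (∀ᵐ z ∂(volume : Measure (LRho.Torus P)),
                v z = LRho.potential E ν z + (((C * LRho.expIY p z).re : ℝ) : EReal)) ∧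
              (LRho.IsSubharmonicOn (LRho.lift (p : ℝ) v) {0}ᶜ →
                ∀ z, v z = LRho.potential E ν z +
                  (((C * LRho.expIY p z).re : ℝ) : EReal))) := by
  refine ⟨fun ρ _ hρ => ⟨LRho.existsUnique_isFundamentalSolution hρ, fun v hv =>
    ⟨LRho.existsUnique_isRieszMeasure hv, fun ν hν E hE => hv.eq_potential hρ hν hE⟩⟩,
    fun p => ⟨?_, fun v hv => ⟨LRho.existsUnique_isRieszMeasure hv, fun ν hν =>
      ⟨⟨hν.integral_expIY (Or.inl rfl), hν.integral_expIY (Or.inr (neg_neg p).symm)⟩,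
        fun E hE => hv.exists_eq_potential_add hν hE⟩⟩⟩⟩
  obtain ⟨h, -, hE⟩ := LRho.exists_isGenFundamentalSolution_kernelE (P := P) p
  exact ⟨_, hE⟩
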